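/- For points $P_1,P_2$ with coordinates in a field $k$ of characteristic $0$, let $$\mathcal X_2=\{(Q,z_1,z_2)\in\mathbb A^2\times\mathbb A^2 : d(P_1,Q)^2=z_1^2,\ d(P_2,Q)^2=z_2^2\}\subset\mathbb A^4_k,$$ where $d((a,b),(x,y))^2=(x-a)^2+(y-b)^2$, and let $\overline{\mathcal X}_2$ be its closure in $\mathbb P^4_k$ under $(x,y,z_1,z_2)\mapsto(x:y:z_1:z_2:1)$. A Del Pezzo surface of degree $d$ over an algebraically closed field of characteristic $0$ is an integral normal proper surface with at most canonical Gorenstein singularities (rational double points), whose anticanonical divisor $-K$ is ample with $(-K)^2=d$. (1) Let $P_1\neq P_2$ be points of $\mathbb R^2$. Then the complex surface $\overline{\mathcal X}_2$ is a Del Pezzo surface of degree $4$. (2) Let $P_1\ne P_2$ be points of $\mathbb Q^2$. Then $\mathcal X_2$ is rational over $\mathbb Q$, i.e. birational over $\mathbb Q$ to $\mathbb A^2_{\mathbb Q}$, and its set of rational points $\mathcal X_2(\mathbb Q)$ is Zariski-dense: the Zariski closure of $\mathcal X_2(\mathbb Q)$ in $\mathbb A^4(\mathbb C)$ is $\mathcal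 X_2(\mathbb C)$. -/

import Mathlib

open AlgebraicGeometry CategoryTheory

universe u

noncomputable section

namespace RationalDistance

/-! ### Del Pezzo surfaces -/

section Forms

variable (k F : Type u) [Field k] [Field F] [Algebra k F]

/-- Rational 2-forms of a function field `F / k`: the second exterior power over `F` of the
Kähler differentials. It is one-dimensional over `F` when `F` is the function field of a surface
in characteristic zero. -/
abbrev TwoForms : Type u := ⋀[F]^2 Ω[F⁄k]

variable {k F}

/-- The rational 2-form `da ∧ db`. -/
def dWedge (a b : F) : TwoForms k F :=
  exteriorPower.ιMulti F 2 ![KaehlerDifferential.D k F a, KaehlerDifferential.D k F b]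

/-- The 2-forms that are regular on a `k`-subalgebra `R` of `F`: the `R`-span of the `da ∧ db` with
`a b ∈ R`, that is, the image of the second exterior power of the differentials of `R / k`. -/
def regularForms (R : Subalgebra k F) : Submodule R (TwoForms k F) :=
  Submodule.span R {ω | ∃ a ∈ R, ∃ b ∈ R, ω = dWedge a b}

end Forms

section Surface

variable {k : Type u} [Field k] {X : Scheme.{u}}

/-- The map from the base field to the local ring of a `k`-scheme at a point. -/
def scalars (f : X ⟶ Spec (.of k)) (x : X) : k →+* X.presheaf.stalk x :=
  (X.presheaf.germ ⊤ x (TopologicalSpace.Opens.mem_top x)).hom.comp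
    (f.appTop.hom.comp (Scheme.ΓSpecIso (.of k)).inv.hom)

/-- The function field of an integral `k`-scheme, with its structure of a `k`-algebra. -/
def FunField (_f : X ⟶ Spec (.of k)) [IsIntegral X] : Type u := X.functionField

variable (f : X ⟶ Spec (.of k)) [IsIntegral X]

instance : Field (FunField f) := inferInstanceAs (Field X.functionField)

instance : Algebra k (FunField f) := (scalars f (genericPoint X)).toAlgebra

/-- The inclusion of a local ring into the function field. -/
def stalkToFunField (x : X) : X.presheaf.stalk x →+* FunField f :=
  algebraMap (X.presheaf.stalk x) X.functionField

lemma stalkToFunField_scalars (x : X) (c : k) :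
    stalkToFunField f x (scalars f x c) = algebraMap k (FunField f) c := by
  exact congrArg (fun g : Γ(X, ⊤) ⟶ X.presheaf.stalk (genericPoint X) =>
      g.hom (f.appTop.hom ((Scheme.ΓSpecIso (.of k)).inv.hom c)))
    (X.presheaf.germ_stalkSpecializes (U := ⊤) (y := x) (TopologicalSpace.Opens.mem_top x)
      ((genericPoint_spec X).specializes trivial))

/-- The local ring `𝒪_{X,x}` as a subring of the function field. -/
def localRing (x : X) : Subalgebra k (FunField f) where
  __ := (stalkToFunField f x).range
  algebraMap_mem' c := ⟨scalars f x c, stalkToFunField_scalars f x c⟩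

/-- `y` is the generic point of a prime divisor: a point of codimension one. -/
def IsPrimeDivisor (y : X) : Prop := ringKrullDim (X.presheaf.stalk y) = 1

/-- The stalk at `x` of the canonical sheaf `ω_X` of a normal surface `X` over a field of
characteristic zero: the rational 2-forms without poles along the prime divisors through `x`.
(This is the sheaf `j_* Ω²`, with `j` the inclusion of the regular locus.) -/
def canonicalStalk (x : X) : Set (TwoForms k (FunField f)) :=
  {ω | ∀ y : X, IsPrimeDivisor y → y ⤳ x → ω ∈ regularForms (localRing f y)}

/-- `η` generates the canonical sheaf at `x` freely: `ω_{X,x} = 𝒪_{X,x} · η`. -/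
def IsCanonicalGenerator (x : X) (η : TwoForms k (FunField f)) : Prop :=
  canonicalStalk f x = {ω | ∃ r ∈ localRing f x, ω = r • η}

/-- The global sections of `ω_X^{-m}`, that is, `H⁰(X, -m K_X)`. A rational section of `ω_X^{-m}`
is a homogeneous function `s` of degree `m` on the line of rational 2-forms, `s (c η) = c ^ m s η`;
it is regular if at each prime divisor it takes regular forms to regular functions. -/
def antiCanonicalSections (m : ℕ) :
    Submodule k (TwoForms k (FunField f) → FunField f) where
  carrier := {s | (∀ (c : FunField f) (η), s (c • η) = c ^ m * s η) ∧
    ∀ y : X, IsPrimeDivisor y → ∀ η ∈ regularForms (localRing f y), s η ∈ localRing f y}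
  zero_mem' := ⟨fun _ _ => by simp, fun _ _ _ _ => zero_mem _⟩
  add_mem' := fun hs ht =>
    ⟨fun c η => by simp [hs.1, ht.1, mul_add],
      fun y hy η hη => add_mem (hs.2 y hy η hη) (ht.2 y hy η hη)⟩
  smul_mem' := fun a s hs =>
    ⟨fun c η => by simp [hs.1], fun y hy η hη => Subalgebra.smul_mem _ (hs.2 y hy η hη) a⟩

/-- The section `s` of a power of `ω_X^{-1}` does not vanish at `x`: its value on a local
generator of `ω_X` is a unit of the local ring. -/
def NonvanishingAt (s : TwoForms k (FunField f) → FunField f) (x : X) : Prop :=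
  ∃ η, IsCanonicalGenerator f x η ∧
    s η ≠ 0 ∧ s η ∈ localRing f x ∧ (s η)⁻¹ ∈ localRing f x

/-- A valuation ring `R` of the function field of a surface over `k` is divisorial (the local ring
of a prime divisor on some normal model) if it is discrete, contains `k`, and its residue
field is not algebraic over `k`: some `t ∈ R` has a residue that is transcendental over `k`. -/
structure IsDivisorial (R : ValuationSubring (FunField f)) : Prop where
  isDVR : IsDiscreteValuationRing R
  exists_transcendental : ∃ t ∈ R, ∀ p : Polynomial k, p ≠ 0 →
    Polynomial.aeval t p ≠ 0 ∧ (Polynomial.aeval t p)⁻¹ ∈ R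

/-- `f : X ⟶ Spec k` makes the integral scheme `X` a Del Pezzo surface of degree `d` (`k`
algebraically closed of characteristic zero): a normal proper surface whose anticanonical divisor
`-K` is an ample Cartier divisor with `(-K)² = d` and whose singularities, if any, are canonical
(that is, rational double points). -/
structure IsDelPezzoOfDegree [IsAlgClosed k] [CharZero k] (d : ℕ) : Prop where
  proper : IsProper f
  dim_eq_two : Algebra.trdeg k (FunField f) = 2
  normal : ∀ x : X, IsIntegrallyClosed (X.presheaf.stalk x)
  /-- The canonical divisor is Cartier. -/
  gorenstein : ∀ x : X, ∃ η, IsCanonicalGenerator f x η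
  /-- The singularities are canonical: a 2-form that is regular at `x` has no pole along any
  prime divisor over `X` whose centre contains `x`. -/
  canonical : ∀ (x : X) (R : ValuationSubring (FunField f)), IsDivisorial f R →
    ∀ hR : (∀ a ∈ localRing f x, a ∈ R), ∀ ω ∈ canonicalStalk f x,
      ω ∈ regularForms ({ R.toSubring with
        algebraMap_mem' := fun c => hR _ ((localRing f x).algebraMap_mem c) } :
          Subalgebra k (FunField f))
  /-- The anticanonical sheaf is ample: each point lies in an affine open set that is the
  nonvanishing locus of a section of a positive power of `ω_X^{-1}`. -/
  ample : ∀ x : X, ∃ m : ℕ, 0 < m ∧ ∃ s ∈ antiCanonicalSections f m, ∃ U : X.Opens,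
    IsAffineOpen U ∧ x ∈ U ∧ ∀ z : X, z ∈ U ↔ NonvanishingAt f s z
  /-- The self-intersection number `(-K)²`, read off from
  `h⁰(X, -m K) = (-K)² m² / 2 + O(m)`. -/
  degree_eq : Filter.Tendsto
    (fun m : ℕ => 2 * (Module.finrank k (antiCanonicalSections f m) : ℝ) / (m : ℝ) ^ 2)
    Filter.atTop (nhds (d : ℝ))

end Surface

/-- The `k`-scheme `X` is a Del Pezzo surface of degree `d`. -/
def IsDelPezzoSurface {k : Type u} [Field k] [IsAlgClosed k] [CharZero k] {X : Scheme.{u}}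
    (f : X ⟶ Spec (.of k)) (d : ℕ) : Prop :=
  ∃ _ : IsIntegral X, IsDelPezzoOfDegree f d

/-! ### The surface of points with two distances -/

section X2

open MvPolynomial

variable (k : Type u) [Field k] (P₁ P₂ : k × k)

/-- The polynomial `d(P, Q)² - z²`, where `Q = (X 0, X 1)` and `z` is the coordinate `X i`. -/
def distEq (P : k × k) (i : Fin 4) : MvPolynomial (Fin 4) k :=
  (X 0 - C P.1) ^ 2 + (X 1 - C P.2) ^ 2 - X i ^ 2

/-- The ideal of `𝒳₂ = {(Q, z₁, z₂) ∈ 𝔸² × 𝔸² : d(P₁, Q)² = z₁², d(P₂, Q)² = z₂²}`. -/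
def idealX2 : Ideal (MvPolynomial (Fin 4) k) :=
  Ideal.span {distEq k P₁ 2, distEq k P₂ 3}

/-- The coordinate ring of the affine surface `𝒳₂`. -/
abbrev RingX2 : Type u := MvPolynomial (Fin 4) k ⧸ idealX2 k P₁ P₂

/-- The affine surface `𝒳₂ ⊆ 𝔸⁴`. -/
def X2 : Scheme.{u} := Spec (.of (RingX2 k P₁ P₂))

/-- The structure morphism of `𝒳₂`. -/
def X2.toBase : X2 k P₁ P₂ ⟶ Spec (.of k) :=
  Spec.map (CommRingCat.ofHom (algebraMap k (RingX2 k P₁ P₂)))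

instance gradedRingP4 : GradedRing (homogeneousSubmodule (Fin 5) k) :=
  MvPolynomial.gradedAlgebra

/-- Projective 4-space over `k`. -/
def P4 : Scheme.{u} := Proj (homogeneousSubmodule (Fin 5) k)

/-- The structure morphism of `ℙ⁴`. -/
def P4.toBase : P4 k ⟶ Spec (.of k) :=
  Proj.toSpecZero (homogeneousSubmodule (Fin 5) k) ≫
    Spec.map (CommRingCat.ofHom (algebraMap k (homogeneousSubmodule (Fin 5) k 0)))

/-- The homogeneous coordinates `(x : y : z₁ : z₂ : 1)` on `𝒳₂`. -/
def homogCoords : MvPolynomial (Fin 5) k →+* RingX2 k P₁ P₂ :=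
  (aeval (![Ideal.Quotient.mk _ (X 0), Ideal.Quotient.mk _ (X 1), Ideal.Quotient.mk _ (X 2),
    Ideal.Quotient.mk _ (X 3), 1] : Fin 5 → RingX2 k P₁ P₂)).toRingHom

lemma map_irrelevant_homogCoords :
    (HomogeneousIdeal.irrelevant (homogeneousSubmodule (Fin 5) k)).toIdeal.map
      ((Scheme.ΓSpecIso (.of (RingX2 k P₁ P₂))).inv.hom.comp (homogCoords k P₁ P₂)) = ⊤ := by
  rw [Ideal.eq_top_iff_one]
  have h : ((Scheme.ΓSpecIso (.of (RingX2 k P₁ P₂))).inv.hom.comp (homogCoords k P₁ P₂))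
      (X 4) = 1 := by
    have h1 : homogCoords k P₁ P₂ (X 4) = 1 := by
      simp only [homogCoords, AlgHom.toRingHom_eq_coe, RingHom.coe_coe, aeval_X]
      rfl
    rw [RingHom.comp_apply, h1, map_one]
  rw [← h]
  apply Ideal.mem_map_of_mem
  change _ ∈ HomogeneousIdeal.irrelevant _
  rw [HomogeneousIdeal.mem_irrelevant_iff, GradedRing.proj_apply]
  exact DirectSum.decompose_of_mem_ne (ℳ := homogeneousSubmodule (Fin 5) k) (i := 1)
    (isHomogeneous_X k (4 : Fin 5)) one_ne_zero

/-- The embedding `𝒳₂ → ℙ⁴`, `(x, y, z₁, z₂) ↦ (x : y : z₁ : z₂ : 1)`. -/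
def X2.toP4 : X2 k P₁ P₂ ⟶ P4 k :=
  Proj.fromOfGlobalSections (X := Spec (.of (RingX2 k P₁ P₂)))
    (homogeneousSubmodule (Fin 5) k) _ (map_irrelevant_homogCoords k P₁ P₂)

/-- The projective completion of `𝒳₂`: its scheme-theoretic closure in `ℙ⁴`. -/
def X2Bar : Scheme.{u} := (X2.toP4 k P₁ P₂).image

/-- The structure morphism of the projective completion of `𝒳₂`. -/
def X2Bar.toBase : X2Bar k P₁ P₂ ⟶ Spec (.of k) :=
  (X2.toP4 k P₁ P₂).imageι ≫ P4.toBase k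

/-- The `k`-rational points of `𝒳₂`. -/
def pointsX2 : Set (Fin 4 → k) := zeroLocus k (idealX2 k P₁ P₂)

end X2

end RationalDistance

end

/-!
# The surface of points at two rational distances

Both parts come from explicit coordinates on `𝒳₂`. The first holds over any algebraically closed
field `k` of characteristic zero with `d(P₁, P₂)² ≠ 0`, the second over any field of characteristic
zero with `P₁ ≠ P₂`.

**The closure is a quartic Del Pezzo surface.** Choose `δ` with `δ² = d(P₁, P₂)²` and use the
coordinates `u`, `v` along and across the vector from `P₁` to `P₂`, scaled by `δ`. The two equations
become `(δz₁ - u)(δz₁ + u) = v²` and `(δz₂ - u')(δz₂ + u') = v²` with `u' = u - δ²w`. The five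
linear forms `v, δz₁ ± u, δz₂ ± u'` (`diamondForm`) are coordinates on `ℙ⁴`, and in them the
closure is the surface `x₀x₁ = x₂² = x₃x₄`: the toric surface whose polygon is the diamond
`|i| + |j| ≤ 1` with its five lattice points. With `x = v / (δz₁ + u)` and
`y = v / (δz₂ + u')` its function field is `k(x, y)`, and it is covered by four affine charts with
coordinate rings `k[t, ts, t/s]` for `t ∈ {x, 1/x, y, 1/y}` (`isToricDiamondX2Bar`).
Each chart is an `A₁`-singularity.

Everything in the definition of a Del Pezzo surface is then read off from the charts
(`IsToricDiamond.isDelPezzoOfDegree`). The ring `k[t, ts, t/s]` is spanned by the Laurent monomials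
in a cone; it is integrally closed since the cone is the intersection of two half-planes, each of
which gives a localization of a polynomial ring. Put `η = dx ∧ dy / (xy)`. Along a prime divisor of
the chart of `t` one of `s`, `1/s` is regular, and `t η = ± dt ∧ ds / s` is the generator of the
regular forms there. By the algebraic Hartogs lemma, `t η` generates the canonical sheaf on the
whole chart. The same computation in a valuation ring shows that `t η` has no pole along a divisor
over the chart, so the singularities are canonical. The sections of `-mK` are the functions `g` such
that `g t ^ m` is regular on each chart, so they have a basis of Laurent monomials with exponents
in the diamond `|i| + |j| ≤ m`, which contains `(m + 1)² + m² = 2m² + O(m)` lattice points; this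
gives the degree `4`. The section `1/t` of `-K` has the chart of `t` as its nonvanishing locus,
which gives ampleness.

To identify the charts of the closure, which is defined as a scheme-theoretic image in `Proj`, the
generic point of `𝒳₂` is used: it embeds the function field of the closure in the fraction field
of the coordinate ring (`funFieldX2Bar`), and takes the functions on the complement of the
hyperplane `r = 0` to the algebra generated by the quotients of the homogeneous coordinates by `r`
(`exists_section_chartX2Bar_iff`).

**Rationality and density.** The lines through `P₁` are parametrized by `m`, with direction
`(1 - m², 2m)`, of length `1 + m²`. With `n = z₂ - z₁`, the second equation becomes linear in the
remaining unknown. This identifies the complement of a curve in the `(m, n)`-plane with an open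
subset of `𝒳₂` (`isLocalization_paramX2`). The coordinate ring of `𝒳₂` is free over `k[x, y]`, so it
embeds in its localization; hence it is a domain, and `𝒳₂` is birational to the plane. A
polynomial that vanishes at the rational points of `𝒳₂` vanishes at the rational points of the
parameter plane, hence it is zero on `𝒳₂`.
-/

open AlgebraicGeometry CategoryTheory

noncomputable section

namespace RationalDistance

/-! ### Algebraic Hartogs -/

section Hartogs

variable {A K : Type*} [CommRing A] [Field K] [Algebra A K]

/-- The ideal of denominators `{a | a x ∈ A}` of an element `x` of an `A`-algebra `K`. -/
def denomIdeal (A : Type*) {K : Type*} [CommRing A] [Field K] [Algebra A K] (x : K) : Ideal A where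
  carrier := {a | ∃ c : A, algebraMap A K a * x = algebraMap A K c}
  zero_mem' := ⟨0, by simp⟩
  add_mem' := by
    rintro a b ⟨c, hc⟩ ⟨d, hd⟩
    exact ⟨c + d, by rw [map_add, map_add, add_mul, hc, hd]⟩
  smul_mem' := by
    rintro a b ⟨c, hc⟩
    exact ⟨a * c, by rw [smul_eq_mul, map_mul, map_mul, mul_assoc, hc]⟩

lemma mem_denomIdeal {x : K} {a : A} :
    a ∈ denomIdeal A x ↔ ∃ c : A, algebraMap A K a * x = algebraMap A K c := Iff.rfl

lemma mem_denomIdeal_smul {x : K} {a b : A} :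
    a ∈ denomIdeal A (algebraMap A K b * x) ↔ a * b ∈ denomIdeal A x := by
  simp only [mem_denomIdeal, map_mul, mul_assoc]

/-- Algebraic Hartogs: over a normal Noetherian domain, a fraction that is regular at all primes of
height one below a prime `P` is regular at `P`. An ideal of denominators `Q ≤ P` that is maximal
among those of the multiples of the fraction is a prime of height one. -/
theorem exists_denom_notMem_of_height_one [IsDomain A] [IsNoetherianRing A] [IsIntegrallyClosed A]
    [IsFractionRing A K] (P : Ideal A) [P.IsPrime] (r : K)
    (h : ∀ Q : Ideal A, Q.IsPrime → Q.height = 1 → Q ≤ P → ¬ denomIdeal A r ≤ Q) :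
    ¬ denomIdeal A r ≤ P := by
  intro hr
  let S : Set (Ideal A) := {J | J ≤ P ∧ ∃ s : A, J = denomIdeal A (algebraMap A K s * r)}
  obtain ⟨Q, ⟨hQP, s, hQs⟩, hmax⟩ : ∃ Q : Ideal A, Q ∈ S ∧ ∀ J ∈ S, ¬ Q < J :=
    set_has_maximal_iff_noetherian.mpr inferInstance S ⟨denomIdeal A r, hr, 1, by simp⟩
  set t := algebraMap A K s * r with ht
  have hle (a : A) : Q ≤ denomIdeal A (algebraMap A K a * t) := fun b hb => by
    rw [mem_denomIdeal_smul, ← hQs]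
    exact Ideal.mul_mem_right _ _ hb
  have hmax' (a : A) (ha : denomIdeal A (algebraMap A K a * t) ≤ P) (b : A) (hb : b * a ∈ Q) :
      b ∈ Q := by
    by_contra hbQ
    refine hmax _ ⟨ha, a * s, by rw [ht, map_mul, mul_assoc]⟩ (lt_of_le_of_ne (hle a) ?_)
    rintro heq
    apply hbQ
    rw [heq, mem_denomIdeal_smul, ← hQs]
    exact hb
  have hQprime : Q.IsPrime := by
    refine ⟨fun h1 => ?_, fun {a b} hab => ?_⟩
    · exact (inferInstance : P.IsPrime).ne_top (top_le_iff.mp (h1 ▸ hQP))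
    · by_cases ha : denomIdeal A (algebraMap A K a * t) ≤ P
      · exact Or.inr (hmax' a ha b (by rwa [mul_comm]))
      · left
        obtain ⟨c, hc, hcP⟩ := SetLike.not_le_iff_exists.mp ha
        rw [mem_denomIdeal_smul, ← hQs] at hc
        refine hmax' c (fun d hd => ?_) a (by rwa [mul_comm])
        rw [mem_denomIdeal_smul, ← hQs] at hd
        exact ((inferInstance : P.IsPrime).mem_or_mem (hQP hd)).resolve_right hcP
  have hQ0 : Q ≠ ⊥ := by
    obtain ⟨a, b, hb, hab⟩ := IsFractionRing.div_surjective (A := A) t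
    have hb' : algebraMap A K b ≠ 0 :=
      IsFractionRing.to_map_ne_zero_of_mem_nonZeroDivisors hb
    rw [Submodule.ne_bot_iff]
    refine ⟨b, ?_, nonZeroDivisors.ne_zero hb⟩
    rw [hQs]
    exact ⟨a, by rw [← hab]; field_simp⟩
  have htQ : ∀ q ∈ Q, ∃ c : A, algebraMap A K q * t = algebraMap A K c := fun q hq => by
    rw [hQs] at hq
    exact hq
  have htA : ∀ c : A, t ≠ algebraMap A K c := fun c hc => by
    apply hQprime.ne_top
    rw [Ideal.eq_top_iff_one, hQs]
    exact ⟨c, by rw [map_one, one_mul, hc]⟩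
  -- If `Q t ⊆ Q`, then `t` is integral over `A`; otherwise `Q` is minimal over some `q ∈ Q`.
  have hq : ∃ q ∈ Q, ∃ c ∉ Q, algebraMap A K q * t = algebraMap A K c := by
    by_contra! hcon
    let M := Submodule.map (Algebra.linearMap A K) Q
    have hint : IsIntegral A t := by
      refine isIntegral_of_smul_mem_submodule M ?_ (Submodule.FG.map _ (IsNoetherian.noetherian Q))
        t ?_
      · obtain ⟨a, haQ, ha0⟩ := (Submodule.ne_bot_iff _).mp hQ0
        rw [Submodule.ne_bot_iff]
        exact ⟨_, ⟨a, haQ, rfl⟩, by simpa using ha0⟩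
      · rintro _ ⟨q, hq, rfl⟩
        obtain ⟨c, hc⟩ := htQ q hq
        refine ⟨c, by_contra fun hcQ => hcon q hq c hcQ hc, ?_⟩
        simp [← hc, mul_comm]
    obtain ⟨c, hc⟩ := IsIntegrallyClosed.algebraMap_eq_of_integral hint
    exact htA c hc.symm
  obtain ⟨q, hqQ, u, huQ, hqu⟩ := hq
  have hmin : Q ∈ (Ideal.span {q}).minimalPrimes := by
    refine ⟨⟨hQprime, by simpa [Ideal.span_le] using hqQ⟩, ?_⟩
    rintro Q' ⟨hQ', hqQ'⟩ hle' p hp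
    obtain ⟨a, ha⟩ := htQ p hp
    have hpu : p * u = q * a := by
      apply IsFractionRing.injective A K
      rw [map_mul, map_mul, ← hqu, ← ha]
      ring
    have hqm : q ∈ Q' := hqQ' (Ideal.mem_span_singleton_self q)
    exact (hQ'.mem_or_mem (hpu ▸ Ideal.mul_mem_right a _ hqm)).resolve_right
      fun hu => huQ (hle' hu)
  have hht : Q.height = 1 := by
    refine le_antisymm (Ideal.height_le_one_of_isPrincipal_of_mem_minimalPrimes _ _ hmin) ?_
    rw [Order.one_le_iff_ne_zero, Ne, Ideal.height_eq_zero_iff_eq_bot]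
    exact hQ0
  refine h Q hQprime hht hQP fun b hb => ?_
  rw [hQs]
  obtain ⟨c, hc⟩ := hb
  exact ⟨s * c, by rw [ht, map_mul, ← hc]; ring⟩

end Hartogs

/-! ### Rational 2-forms on a purely transcendental field extension -/

section FieldForms

variable (k : Type u) {F : Type u} [Field k] [Field F] [Algebra k F]

/-- `F = k(x, y)` is a purely transcendental extension of `k` with coordinates `x` and `y`. -/
structure IsCoordinatePair (x y : F) : Prop where
  trdeg_eq : Algebra.trdeg k F = 2
  adjoin_eq_top : IntermediateField.adjoin k {x, y} = ⊤

variable {k}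

lemma IsCoordinatePair.exists_div {x y : F} (h : IsCoordinatePair k x y) (z : F) :
    ∃ p q : MvPolynomial (Fin 2) k,
      z = MvPolynomial.aeval ![x, y] p / MvPolynomial.aeval ![x, y] q := by
  have hz : z ∈ IntermediateField.adjoin k (Set.range ![x, y]) := by
    rw [Matrix.range_cons_cons_empty, h.adjoin_eq_top]
    trivial
  rw [IntermediateField.mem_adjoin_range_iff] at hz
  exact hz

lemma IsCoordinatePair.algebraicIndependent {x y : F} (h : IsCoordinatePair k x y) :
    AlgebraicIndependent k ![x, y] := by
  have : Algebra.IsAlgebraic (Algebra.adjoin k (Set.range ![x, y])) F := by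
    refine ⟨fun z => ?_⟩
    obtain ⟨p, q, rfl⟩ := h.exists_div z
    have hm (p : MvPolynomial (Fin 2) k) : IsAlgebraic (Algebra.adjoin k (Set.range ![x, y]))
        (MvPolynomial.aeval ![x, y] p) := by
      have : MvPolynomial.aeval ![x, y] p ∈ Algebra.adjoin k (Set.range ![x, y]) := by
        rw [Algebra.adjoin_range_eq_range_aeval]
        exact ⟨p, rfl⟩
      exact isAlgebraic_algebraMap (⟨_, this⟩ : Algebra.adjoin k (Set.range ![x, y]))
    rw [div_eq_mul_inv]
    exact (hm p).mul (hm q).inv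
  exact (Algebra.IsAlgebraic.isTranscendenceBasis_of_lift_le_trdeg_of_finite k
    ![x, y]
    (by simp [h.trdeg_eq])).1

lemma IsCoordinatePair.exists_basis {x y : F} (h : IsCoordinatePair k x y) :
    ∃ b : Module.Basis (Fin 2) F Ω[F⁄k],
      b 0 = KaehlerDifferential.D k F x ∧ b 1 = KaehlerDifferential.D k F y := by
  let φ : MvPolynomial (Fin 2) k →ₐ[k] F := MvPolynomial.aeval ![x, y]
  algebraize [φ.toRingHom]
  have : IsScalarTower k (MvPolynomial (Fin 2) k) F :=
    IsScalarTower.of_algebraMap_eq fun c => (φ.commutes c).symm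
  have hφ : Function.Injective φ := h.algebraicIndependent
  have : FaithfulSMul (MvPolynomial (Fin 2) k) F :=
    (faithfulSMul_iff_algebraMap_injective _ _).mpr hφ
  have : IsFractionRing (MvPolynomial (Fin 2) k) F := by
    refine IsFractionRing.of_field _ _ fun z => ?_
    obtain ⟨p, q, hz⟩ := h.exists_div z
    exact ⟨p, q, hz⟩
  let b := (KaehlerDifferential.mvPolynomialBasis k (Fin 2)).ofIsLocalizedModule F
    (nonZeroDivisors (MvPolynomial (Fin 2) k))
    (KaehlerDifferential.map k k (MvPolynomial (Fin 2) k) F)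
  have hb (i : Fin 2) : b i = KaehlerDifferential.D k F (φ (MvPolynomial.X i)) := by
    rw [Module.Basis.ofIsLocalizedModule_apply, KaehlerDifferential.mvPolynomialBasis_apply,
      KaehlerDifferential.map_D]
    rfl
  exact ⟨b, by simp [hb, φ], by simp [hb, φ]⟩

/-- The rational 2-forms of `k(x, y)` are the multiples of `dx ∧ dy`. -/
lemma IsCoordinatePair.exists_linearEquiv {x y : F} (h : IsCoordinatePair k x y) :
    ∃ τ : TwoForms k F ≃ₗ[F] F, τ (dWedge x y) = 1 := by
  obtain ⟨b, h0, h1⟩ := h.exists_basis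
  let τ := exteriorPower.alternatingMapLinearEquiv b.det
  have hb : ![KaehlerDifferential.D k F x, KaehlerDifferential.D k F y] = b := by
    ext i
    fin_cases i <;> simp [h0, h1]
  have hτ (v : Fin 2 → Ω[F⁄k]) : τ (exteriorPower.ιMulti F 2 v) = b.det v :=
    exteriorPower.alternatingMapLinearEquiv_apply_ιMulti _ _
  have hone : τ (dWedge x y) = 1 := by
    rw [dWedge, hτ, hb, b.det_self]
  have hinv : LinearMap.comp (LinearMap.toSpanSingleton F (TwoForms k F) (dWedge x y)) τ
      = LinearMap.id := by
    apply exteriorPower.linearMap_ext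
    refine Module.Basis.ext_alternating b fun v hv => ?_
    have hτv := hτ fun i => b (v i)
    obtain ⟨σ, rfl⟩ : ∃ σ : Equiv.Perm (Fin 2), v = σ :=
      ⟨Equiv.ofBijective v (Finite.injective_iff_bijective.mp hv), rfl⟩
    have e := AlternatingMap.map_perm (exteriorPower.ιMulti F 2) b σ
    have e' := AlternatingMap.map_perm b.det b σ
    simp only [LinearMap.compAlternatingMap_apply, LinearMap.comp_apply, LinearMap.id_apply]
    change τ _ • dWedge x y = _
    rw [hτ, dWedge, hb]
    change b.det (b ∘ σ) • _ = exteriorPower.ιMulti F 2 (b ∘ σ)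
    rw [e, e', b.det_self, smul_assoc, one_smul]
  refine ⟨LinearEquiv.ofLinearMap τ (LinearMap.toSpanSingleton F _ (dWedge x y)) ?_ hinv, hone⟩
  ext
  simp [hone]

lemma dWedge_swap (a b : F) : dWedge (k := k) a b = -dWedge b a := by
  have := (exteriorPower.ιMulti F 2).map_swap
    ![KaehlerDifferential.D k F a, KaehlerDifferential.D k F b] (i := 0) (j := 1) (by decide)
  rw [dWedge, dWedge, ← neg_eq_iff_eq_neg, ← this]
  congr 1
  ext i
  fin_cases i <;> simp

lemma dWedge_eq_smul {a b x y p q p' q' : F}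
    (hx : KaehlerDifferential.D k F x =
      p • KaehlerDifferential.D k F a + q • KaehlerDifferential.D k F b)
    (hy : KaehlerDifferential.D k F y =
      p' • KaehlerDifferential.D k F a + q' • KaehlerDifferential.D k F b) :
    dWedge (k := k) x y = (p * q' - q * p') • dWedge a b := by
  let w := fun u v : Ω[F⁄k] => exteriorPower.ιMulti F 2 ![u, v]
  have hl (c d : F) (u u' v) : w (c • u + d • u') v = c • w u v + d • w u' v := by
    have h1 := (exteriorPower.ιMulti F 2).map_update_add ![u, v] 0 (c • u) (d • u')
    have h2 := (exteriorPower.ιMulti F 2).map_update_smul ![u, v] 0 c u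
    have h3 := (exteriorPower.ιMulti F 2).map_update_smul ![u, v] 0 d u'
    have e (z : Ω[F⁄k]) : Function.update ![u, v] 0 z = ![z, v] := by
      ext i
      fin_cases i <;> simp
    simp only [e] at h1 h2 h3
    simpa [w, ← h2, ← h3] using h1
  have hr (c d : F) (u v v') : w u (c • v + d • v') = c • w u v + d • w u v' := by
    have h1 := (exteriorPower.ιMulti F 2).map_update_add ![u, v] 1 (c • v) (d • v')
    have h2 := (exteriorPower.ιMulti F 2).map_update_smul ![u, v] 1 c v
    have h3 := (exteriorPower.ιMulti F 2).map_update_smul ![u, v] 1 d v'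
    have e (z : Ω[F⁄k]) : Function.update ![u, v] 1 z = ![u, z] := by
      ext i
      fin_cases i <;> simp
    simp only [e] at h1 h2 h3
    simpa [w, ← h2, ← h3] using h1
  have h0 (u) : w u u = 0 :=
    (exteriorPower.ιMulti F 2).map_eq_zero_of_eq ![u, u] (i := 0) (j := 1) rfl (by decide)
  have hs (a b : F) : w (KaehlerDifferential.D k F b) (KaehlerDifferential.D k F a) =
      - w (KaehlerDifferential.D k F a) (KaehlerDifferential.D k F b) := dWedge_swap b a
  change w _ _ = _ • w _ _
  rw [hx, hy, hl, hr, hr, h0, h0, hs]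
  module

/-- If `R` consists of fractions of elements of `k[a, b]`, then its regular 2-forms are the
multiples of `da ∧ db`. -/
lemma mem_regularForms_iff {R : Subalgebra k F} {a b : F} (ha : a ∈ R) (hb : b ∈ R)
    (h : ∀ r ∈ R, ∃ f ∈ Algebra.adjoin k {a, b}, ∃ g ∈ Algebra.adjoin k {a, b},
      g ≠ 0 ∧ g⁻¹ ∈ R ∧ r * g = f) (ω : TwoForms k F) :
    ω ∈ regularForms R ↔ ∃ r ∈ R, ω = r • dWedge a b := by
  have hsub : Algebra.adjoin k {a, b} ≤ R := by
    rw [Algebra.adjoin_le_iff]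
    rintro _ (rfl | rfl) <;> assumption
  have hadj : ∀ f ∈ Algebra.adjoin k {a, b}, ∃ p ∈ R, ∃ q ∈ R, KaehlerDifferential.D k F f =
      p • KaehlerDifferential.D k F a + q • KaehlerDifferential.D k F b := by
    intro f hf
    induction hf using Algebra.adjoin_induction with
    | mem x hx =>
      rcases hx with rfl | rfl
      · exact ⟨1, one_mem _, 0, zero_mem _, by simp⟩
      · exact ⟨0, zero_mem _, 1, one_mem _, by simp⟩
    | algebraMap c => exact ⟨0, zero_mem _, 0, zero_mem _, by simp⟩
    | add x y hx hy ihx ihy =>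
      obtain ⟨p, hp, q, hq, h1⟩ := ihx
      obtain ⟨p', hp', q', hq', h2⟩ := ihy
      exact ⟨p + p', add_mem hp hp', q + q', add_mem hq hq', by rw [map_add, h1, h2]; module⟩
    | mul x y hx hy ihx ihy =>
      obtain ⟨p, hp, q, hq, h1⟩ := ihx
      obtain ⟨p', hp', q', hq', h2⟩ := ihy
      exact ⟨x * p' + y * p, add_mem (mul_mem (hsub hx) hp') (mul_mem (hsub hy) hp),
        x * q' + y * q, add_mem (mul_mem (hsub hx) hq') (mul_mem (hsub hy) hq),
        by rw [Derivation.leibniz, h1, h2]; module⟩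
  have hD : ∀ r ∈ R, ∃ p ∈ R, ∃ q ∈ R, KaehlerDifferential.D k F r =
      p • KaehlerDifferential.D k F a + q • KaehlerDifferential.D k F b := by
    intro r hr
    obtain ⟨f, hf, g, hg, hg0, hgR, hrg⟩ := h r hr
    obtain ⟨p, hp, q, hq, h1⟩ := hadj f hf
    obtain ⟨p', hp', q', hq', h2⟩ := hadj g hg
    have hr' : r = f / g := by rw [← hrg]; field_simp
    refine ⟨g⁻¹ * p - g⁻¹ * r * p', sub_mem (mul_mem hgR hp) (mul_mem (mul_mem hgR hr) hp'),
      g⁻¹ * q - g⁻¹ * r * q', sub_mem (mul_mem hgR hq) (mul_mem (mul_mem hgR hr) hq'), ?_⟩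
    have h3 : KaehlerDifferential.D k F f =
        r • KaehlerDifferential.D k F g + g • KaehlerDifferential.D k F r := by
      rw [← hrg, Derivation.leibniz]
    have h4 : KaehlerDifferential.D k F r = g⁻¹ • (KaehlerDifferential.D k F f -
        r • KaehlerDifferential.D k F g) := by
      rw [h3, add_sub_cancel_left, smul_smul, inv_mul_cancel₀ hg0, one_smul]
    rw [h4, h1, h2]
    module
  constructor
  · intro hω
    induction hω using Submodule.span_induction with
    | mem x hx =>
      obtain ⟨x, hx, y, hy, rfl⟩ := hx
      obtain ⟨p, hp, q, hq, h1⟩ := hD x hx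
      obtain ⟨p', hp', q', hq', h2⟩ := hD y hy
      exact ⟨p * q' - q * p', sub_mem (mul_mem hp hq') (mul_mem hq hp'), dWedge_eq_smul h1 h2⟩
    | zero => exact ⟨0, zero_mem _, by simp⟩
    | add x y _ _ ihx ihy =>
      obtain ⟨r, hr, rfl⟩ := ihx
      obtain ⟨s, hs, rfl⟩ := ihy
      exact ⟨r + s, add_mem hr hs, by rw [add_smul]⟩
    | smul c x _ ih =>
      obtain ⟨r, hr, rfl⟩ := ih
      exact ⟨c * r, mul_mem c.2 hr, by rw [mul_smul]; rfl⟩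
  · rintro ⟨r, hr, rfl⟩
    exact Submodule.smul_mem (regularForms R) (⟨r, hr⟩ : R)
      (Submodule.subset_span ⟨a, ha, b, hb, rfl⟩)

/-- The change of coordinates `(t, s) ↦ (t / s, s)` turns `dt ∧ ds / s` into a form without
poles. -/
lemma dWedge_div_left {t s : F} (hs : s ≠ 0) :
    dWedge (k := k) (t / s) s = s⁻¹ • dWedge t s := by
  have h1 : KaehlerDifferential.D k F (t / s) = s⁻¹ • KaehlerDifferential.D k F t +
      (-t * s⁻¹ ^ 2) • KaehlerDifferential.D k F s := by
    rw [Derivation.leibniz_div, smul_sub, smul_smul, smul_smul, sub_eq_add_neg, ← neg_smul]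
    congr 2 <;> field_simp
  have h2 : KaehlerDifferential.D k F s = (0 : F) • KaehlerDifferential.D k F t +
      (1 : F) • KaehlerDifferential.D k F s := by simp
  rw [dWedge_eq_smul h1 h2]
  simp

lemma dWedge_inv_right {t s : F} :
    dWedge (k := k) t s⁻¹ = (-s⁻¹ ^ 2) • dWedge t s := by
  have h1 : KaehlerDifferential.D k F t = (1 : F) • KaehlerDifferential.D k F t +
      (0 : F) • KaehlerDifferential.D k F s := by simp
  have h2 : KaehlerDifferential.D k F s⁻¹ = (0 : F) • KaehlerDifferential.D k F t +
      (-s⁻¹ ^ 2) • KaehlerDifferential.D k F s := by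
    rw [Derivation.leibniz_inv]; simp
  rw [dWedge_eq_smul h1 h2]
  simp

end FieldForms

/-! ### The chart `k[t, ts, t/s]` -/

section Charts

variable {k F : Type u} [Field k] [Field F] [Algebra k F]

lemma IsCoordinatePair.of_mem_adjoin {x y x' y' : F} (h : IsCoordinatePair k x y)
    (hx : x ∈ IntermediateField.adjoin k {x', y'}) (hy : y ∈ IntermediateField.adjoin k {x', y'}) :
    IsCoordinatePair k x' y' := by
  refine ⟨h.trdeg_eq, top_le_iff.mp ?_⟩
  rw [← h.adjoin_eq_top, IntermediateField.adjoin_le_iff]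
  rintro _ (rfl | rfl) <;> assumption

lemma IsCoordinatePair.swap {x y : F} (h : IsCoordinatePair k x y) : IsCoordinatePair k y x :=
  h.of_mem_adjoin (IntermediateField.subset_adjoin _ _ (by simp))
    (IntermediateField.subset_adjoin _ _ (by simp))

lemma IsCoordinatePair.inv_left {x y : F} (h : IsCoordinatePair k x y) :
    IsCoordinatePair k x⁻¹ y := by
  refine h.of_mem_adjoin ?_ (IntermediateField.subset_adjoin _ _ (by simp))
  rw [← inv_inv x]
  exact inv_mem (IntermediateField.subset_adjoin _ _ (by simp))

lemma IsCoordinatePair.inv_right {x y : F} (h : IsCoordinatePair k x y) :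
    IsCoordinatePair k x y⁻¹ :=
  h.swap.inv_left.swap

lemma IsCoordinatePair.ne_zero_left {x y : F} (h : IsCoordinatePair k x y) : x ≠ 0 :=
  h.algebraicIndependent.ne_zero 0

lemma IsCoordinatePair.ne_zero_right {x y : F} (h : IsCoordinatePair k x y) : y ≠ 0 :=
  h.algebraicIndependent.ne_zero 1

lemma IsCoordinatePair.mul_right {x y : F} (h : IsCoordinatePair k x y) :
    IsCoordinatePair k x (x * y) := by
  have hx : x ∈ IntermediateField.adjoin k {x, x * y} :=
    IntermediateField.subset_adjoin _ _ (by simp)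
  refine h.of_mem_adjoin hx ?_
  have : x⁻¹ * (x * y) ∈ IntermediateField.adjoin k {x, x * y} := mul_mem (inv_mem hx)
    (IntermediateField.subset_adjoin _ _ (by simp))
  rwa [inv_mul_cancel_left₀ h.ne_zero_left] at this

/-- The Laurent monomial `x ^ i y ^ j`. -/
def laurentMonomial (x y : F) (p : ℤ × ℤ) : F := x ^ p.1 * y ^ p.2

lemma laurentMonomial_add {x y : F} (hx : x ≠ 0) (hy : y ≠ 0) (p q : ℤ × ℤ) :
    laurentMonomial x y (p + q) = laurentMonomial x y p * laurentMonomial x y q := by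
  simp only [laurentMonomial, Prod.fst_add, Prod.snd_add, zpow_add₀ hx, zpow_add₀ hy]
  ring

lemma laurentMonomial_inv_right (x y : F) (p : ℤ × ℤ) :
    laurentMonomial x y⁻¹ p = laurentMonomial x y (p.1, -p.2) := by
  simp [laurentMonomial]

lemma IsCoordinatePair.linearIndependent {x y : F} (h : IsCoordinatePair k x y) :
    LinearIndependent k (laurentMonomial x y) := by
  have hx := h.ne_zero_left
  have hy := h.ne_zero_right
  have hnat : LinearIndependent k fun d : Fin 2 →₀ ℕ =>
      MvPolynomial.aeval ![x, y] (MvPolynomial.monomial d (1 : k)) := by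
    have := (MvPolynomial.basisMonomials (Fin 2) k).linearIndependent.map'
      (MvPolynomial.aeval ![x, y] : MvPolynomial (Fin 2) k →ₐ[k] F).toLinearMap
      (LinearMap.ker_eq_bot.mpr h.algebraicIndependent)
    simpa [Function.comp_def] using this
  rw [linearIndependent_iff_finset_linearIndependent]
  intro S
  obtain ⟨N, hN⟩ : ∃ N : ℕ, ∀ p ∈ S, 0 ≤ p.1 + N ∧ 0 ≤ p.2 + N := by
    refine ⟨∑ p ∈ S, (p.1.natAbs + p.2.natAbs), fun p hp => ?_⟩
    have := Finset.single_le_sum (f := fun p : ℤ × ℤ => p.1.natAbs + p.2.natAbs)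
      (fun _ _ => Nat.zero_le _) hp
    change p.1.natAbs + p.2.natAbs ≤ _ at this
    omega
  -- Multiplying by `(x y) ^ N` turns the Laurent monomials in `S` into monomials.
  let e (p : S) : Fin 2 →₀ ℕ :=
    Finsupp.equivFunOnFinite.symm ![(p.1.1 + N).toNat, (p.1.2 + N).toNat]
  have he : Function.Injective e := by
    intro p q hpq
    have h0 : (p.1.1 + N).toNat = (q.1.1 + N).toNat := DFunLike.congr_fun hpq 0
    have h1 : (p.1.2 + N).toNat = (q.1.2 + N).toNat := DFunLike.congr_fun hpq 1
    have hp := hN p.1 p.2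
    have hq := hN q.1 q.2
    ext <;> omega
  have hmul := hnat.comp e he
  refine LinearIndependent.of_comp (LinearMap.mulLeft k ((x * y) ^ N)) ?_
  convert! hmul using 1
  funext p
  have hp := hN p.1 p.2
  simp only [Function.comp_apply, LinearMap.mulLeft_apply, MvPolynomial.aeval_monomial, map_one,
    one_mul, laurentMonomial]
  rw [Finsupp.prod_fintype _ _ (by simp)]
  simp only [e, Fin.prod_univ_two, Finsupp.equivFunOnFinite_symm_apply_apply, Matrix.cons_val_zero,
    Matrix.cons_val_one]
  rw [← zpow_natCast x, ← zpow_natCast y, Int.toNat_of_nonneg hp.1, Int.toNat_of_nonneg hp.2,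
    zpow_add₀ hx, zpow_add₀ hy, zpow_natCast, zpow_natCast, mul_pow]
  ring

lemma IsCoordinatePair.span_inf_span {x y : F} (h : IsCoordinatePair k x y) (S T : Set (ℤ × ℤ)) :
    Submodule.span k (laurentMonomial x y '' S) ⊓ Submodule.span k (laurentMonomial x y '' T) =
      Submodule.span k (laurentMonomial x y '' (S ∩ T)) := by
  rw [Finsupp.span_image_eq_map_linearCombination, Finsupp.span_image_eq_map_linearCombination,
    Finsupp.span_image_eq_map_linearCombination, Finsupp.supported_inter,
    Submodule.map_inf _ h.linearIndependent]

/-- The coordinate ring `k[t, ts, t/s] ≅ k[a, b, c] / (a² - bc)` of an `A₁`-singularity. -/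
def chartAlgebra (k : Type u) {F : Type u} [Field k] [Field F] [Algebra k F] (t s : F) :
    Subalgebra k F :=
  Algebra.adjoin k {t, t * s, t / s}

lemma chartAlgebra_inv_right (t s : F) : chartAlgebra k t s⁻¹ = chartAlgebra k t s := by
  rw [chartAlgebra, chartAlgebra, div_inv_eq_mul, ← div_eq_mul_inv, Set.pair_comm]

lemma left_mem_chartAlgebra (t s : F) : t ∈ chartAlgebra k t s :=
  Algebra.subset_adjoin (by simp)

lemma mul_mem_chartAlgebra (t s : F) : t * s ∈ chartAlgebra k t s :=
  Algebra.subset_adjoin (by simp)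

lemma div_mem_chartAlgebra (t s : F) : t / s ∈ chartAlgebra k t s :=
  Algebra.subset_adjoin (by simp)

lemma laurentMonomial_mem_chartAlgebra {t s : F} (ht : t ≠ 0) {p : ℤ × ℤ}
    (hp : |p.2| ≤ p.1) : laurentMonomial t s p ∈ chartAlgebra k t s := by
  obtain ⟨i, j⟩ := p
  simp only at hp
  have hi : 0 ≤ i - |j| := by omega
  have h1 : laurentMonomial t s (i, j) = t ^ (i - |j|) * laurentMonomial t s (|j|, j) := by
    simp only [laurentMonomial, ← mul_assoc, ← zpow_add₀ ht, sub_add_cancel]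
  rw [h1]
  refine mul_mem ?_ ?_
  · lift i - |j| to ℕ using hi with n
    rw [zpow_natCast]
    exact pow_mem (left_mem_chartAlgebra t s) n
  · rcases le_total 0 j with h | h
    · lift j to ℕ using h
      rw [Nat.abs_cast, laurentMonomial, zpow_natCast, zpow_natCast, ← mul_pow]
      exact pow_mem (mul_mem_chartAlgebra t s) j
    · obtain ⟨n, rfl⟩ := Int.exists_eq_neg_ofNat h
      rw [abs_neg, Nat.abs_cast, laurentMonomial, zpow_neg, zpow_natCast, zpow_natCast, ← inv_pow,
        ← mul_pow, ← div_eq_mul_inv]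
      exact pow_mem (div_mem_chartAlgebra t s) n

lemma adjoin_le_span_laurentMonomial {t s : F} (ht : t ≠ 0) (hs : s ≠ 0) (S : AddSubmonoid (ℤ × ℤ))
    {G : Set F} (hG : G ⊆ laurentMonomial t s '' S) :
    Subalgebra.toSubmodule (Algebra.adjoin k G) ≤
      Submodule.span k (laurentMonomial t s '' S) := by
  rw [Algebra.adjoin_eq_span]
  apply Submodule.span_mono
  intro z hz
  induction hz using Submonoid.closure_induction with
  | mem x hx => exact hG hx
  | one => exact ⟨0, S.zero_mem, by simp [laurentMonomial]⟩
  | mul x y _ _ hx hy =>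
    obtain ⟨p, hp, rfl⟩ := hx
    obtain ⟨q, hq, rfl⟩ := hy
    exact ⟨p + q, S.add_mem hp hq, laurentMonomial_add ht hs p q⟩

/-- The monoid of exponents of the monomials in `chartAlgebra k t s`. -/
def chartCone : AddSubmonoid (ℤ × ℤ) where
  carrier := {p | |p.2| ≤ p.1}
  zero_mem' := by simp
  add_mem' {p q} hp hq := by
    simp only [Set.mem_ofPred_eq, Prod.snd_add, Prod.fst_add] at *
    exact (abs_add_le _ _).trans (add_le_add hp hq)

lemma chartAlgebra_eq_span {t s : F} (ht : t ≠ 0) (hs : s ≠ 0) :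
    Subalgebra.toSubmodule (chartAlgebra k t s) =
      Submodule.span k (laurentMonomial t s '' {p | |p.2| ≤ p.1}) := by
  apply le_antisymm
  · refine adjoin_le_span_laurentMonomial ht hs chartCone ?_
    rintro _ (rfl | rfl | rfl)
    · exact ⟨(1, 0), by simp [chartCone], by simp [laurentMonomial]⟩
    · exact ⟨(1, 1), by simp [chartCone], by simp [laurentMonomial]⟩
    · exact ⟨(1, -1), by simp [chartCone], by simp [laurentMonomial, div_eq_mul_inv]⟩
  · rw [Submodule.span_le]
    rintro _ ⟨p, hp, rfl⟩
    exact laurentMonomial_mem_chartAlgebra ht hp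

lemma IsCoordinatePair.isIntegrallyClosed_adjoin {x y : F} (h : IsCoordinatePair k x y) :
    IsIntegrallyClosed (Algebra.adjoin k {x, y}) := by
  rw [← Matrix.range_cons_cons_empty x y ![]]
  exact IsIntegrallyClosed.of_equiv h.algebraicIndependent.aevalEquiv.toRingEquiv

lemma IsCoordinatePair.isFractionRing_adjoin {x y : F} (h : IsCoordinatePair k x y) :
    IsFractionRing (Algebra.adjoin k {x, y}) F := by
  rw [← Matrix.range_cons_cons_empty x y ![]]
  refine IsFractionRing.of_field _ _ fun z => ?_
  obtain ⟨p, q, hz⟩ := h.exists_div z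
  exact ⟨h.algebraicIndependent.aevalEquiv p, h.algebraicIndependent.aevalEquiv q,
    by simpa using hz⟩

/-- An element that is integral over `k[t, ts, t/s]` is a Laurent polynomial in `t`, `s` whose
exponents lie in the half-plane `j ≤ i`: inverting `ts` gives the ring `k[t, ts, 1/(ts)]`, a
localization of a polynomial ring. -/
lemma IsCoordinatePair.mem_span_of_isIntegral {t s z : F} (h : IsCoordinatePair k t s)
    (hz : IsIntegral (chartAlgebra k t s) z) :
    z ∈ Submodule.span k (laurentMonomial t s '' {p | p.2 ≤ p.1}) := by
  have ht := h.ne_zero_left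
  have hs := h.ne_zero_right
  have hp := h.mul_right
  let B := Algebra.adjoin k {t, t * s}
  have : IsIntegrallyClosed B := hp.isIntegrallyClosed_adjoin
  have : IsFractionRing B F := hp.isFractionRing_adjoin
  let b : B := ⟨t * s, Algebra.subset_adjoin (by simp)⟩
  have hb : b ≠ 0 := fun h0 => mul_ne_zero ht hs (congrArg Subtype.val h0)
  have hM : Submonoid.powers b ≤ nonZeroDivisors B := powers_le_nonZeroDivisors_of_noZeroDivisors hb
  let L := Localization.subalgebra.ofField F (Submonoid.powers b) hM
  have : IsIntegrallyClosed L := isIntegrallyClosed_of_isLocalization L (Submonoid.powers b) hM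
  have hmem (w : F) (hw : w ∈ B) : w ∈ L := ⟨⟨w, hw⟩, 1, one_mem _, by simp⟩
  have hbinv : (t * s)⁻¹ ∈ L := ⟨1, b, Submonoid.mem_powers b, by simp [b]⟩
  have hA : ∀ w ∈ chartAlgebra k t s, w ∈ L := by
    intro w hw
    induction hw using Algebra.adjoin_induction with
    | mem x hx =>
      rcases hx with rfl | rfl | rfl
      · exact hmem _ (Algebra.subset_adjoin (by simp))
      · exact hmem _ (Algebra.subset_adjoin (by simp))
      · have : t / s = t * t * (t * s)⁻¹ := by field_simp
        rw [this]
        have htL := hmem t (Algebra.subset_adjoin (by simp))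
        exact mul_mem (mul_mem htL htL) hbinv
    | algebraMap c => exact hmem _ (algebraMap_mem B c)
    | add x y _ _ hx hy => exact add_mem hx hy
    | mul x y _ _ hx hy => exact mul_mem hx hy
  let φ : chartAlgebra k t s →+* L :=
    (chartAlgebra k t s).val.toRingHom.codRestrict L fun w => hA w w.2
  have hzL : IsIntegral L z := IsIntegral.map_of_comp_eq φ (RingHom.id F) rfl hz
  obtain ⟨⟨w, f, c, ⟨n, rfl⟩, hw⟩, rfl⟩ := IsIntegrallyClosed.algebraMap_eq_of_integral hzL
  let H : AddSubmonoid (ℤ × ℤ) :=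
    { carrier := {p | p.2 ≤ p.1}
      zero_mem' := le_refl (0 : ℤ)
      add_mem' := fun {p q} hp hq => add_le_add (Set.mem_ofPred_eq ▸ hp) hq }
  refine adjoin_le_span_laurentMonomial ht hs H (G := {t, t * s, (t * s)⁻¹}) ?_ ?_
  · rintro _ (rfl | rfl | rfl)
    · exact ⟨(1, 0), by simp [H], by simp [laurentMonomial]⟩
    · exact ⟨(1, 1), by simp [H], by simp [laurentMonomial]⟩
    · exact ⟨(-1, -1), by simp [H], by simp [laurentMonomial, mul_comm]⟩
  · change w ∈ Algebra.adjoin k {t, t * s, (t * s)⁻¹}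
    rw [hw]
    refine mul_mem (Algebra.adjoin_mono (by simp [Set.insert_subset_iff]) f.2) ?_
    rw [map_pow, ← inv_pow]
    exact pow_mem (Algebra.subset_adjoin (by simp [b])) n

/-- The ring `k[t, ts, t/s]` is integrally closed: its cone of exponents is the intersection of the
half-planes `j ≤ i` and `-j ≤ i`. -/
lemma IsCoordinatePair.mem_chartAlgebra_of_isIntegral {t s z : F} (h : IsCoordinatePair k t s)
    (hz : IsIntegral (chartAlgebra k t s) z) : z ∈ chartAlgebra k t s := by
  have h1 := h.mem_span_of_isIntegral hz
  have h2 := h.inv_right.mem_span_of_isIntegral (chartAlgebra_inv_right (k := k) t s ▸ hz)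
  have e : laurentMonomial t s⁻¹ '' {p | p.2 ≤ p.1} = laurentMonomial t s '' {p | -p.2 ≤ p.1} := by
    ext w
    constructor
    · rintro ⟨p, hp, rfl⟩
      exact ⟨(p.1, -p.2), by simpa using hp, (laurentMonomial_inv_right t s p).symm⟩
    · rintro ⟨p, hp, rfl⟩
      exact ⟨(p.1, -p.2), by simpa using hp, by rw [laurentMonomial_inv_right, neg_neg]⟩
  rw [e] at h2
  rw [← Subalgebra.mem_toSubmodule, chartAlgebra_eq_span h.ne_zero_left h.ne_zero_right]
  have h3 := Submodule.mem_inf.mpr ⟨h1, h2⟩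
  rw [h.span_inf_span] at h3
  convert h3 using 4
  ext p
  simp [abs_le, neg_le, and_comm]

/-- Let `R` contain the chart `k[t, ts, t/s]` and either `s` or `1/s`. Then the form `dt ∧ ds / s`
is, up to sign, `dc ∧ ds` with `c = t/s`, or `dc ∧ d(1/s)` with `c = ts`, and `k[t, ts, t/s]` is
contained in the polynomial ring `k[c, s]`, respectively `k[c, 1/s]`. -/
lemma exists_dWedge_eq {R : Subalgebra k F} {t s : F} (hs0 : s ≠ 0)
    (hR : chartAlgebra k t s ≤ R) (hs : s ∈ R ∨ s⁻¹ ∈ R) :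
    ∃ a ∈ R, ∃ b ∈ R, chartAlgebra k t s ≤ Algebra.adjoin k {a, b} ∧
      ∃ ε : F, (ε = 1 ∨ ε = -1) ∧ dWedge (k := k) a b = ε • (s⁻¹ • dWedge t s) := by
  have key (s : F) (hs0 : s ≠ 0) : chartAlgebra k t s ≤ Algebra.adjoin k {t / s, s} := by
    have h1 : t / s ∈ Algebra.adjoin k {t / s, s} := Algebra.subset_adjoin (by simp)
    have h2 : s ∈ Algebra.adjoin k {t / s, s} := Algebra.subset_adjoin (by simp)
    have h3 : t ∈ Algebra.adjoin k {t / s, s} := by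
      have := mul_mem h1 h2
      rwa [div_mul_cancel₀ _ hs0] at this
    rw [chartAlgebra, Algebra.adjoin_le_iff]
    rintro _ (rfl | rfl | rfl)
    exacts [h3, mul_mem h3 h2, h1]
  rcases hs with hs | hs
  · refine ⟨t / s, hR (div_mem_chartAlgebra t s), s, hs, key s hs0, 1, Or.inl rfl, ?_⟩
    rw [one_smul, dWedge_div_left hs0]
  · refine ⟨t / s⁻¹, ?_, s⁻¹, hs, ?_, -1, Or.inr rfl, ?_⟩
    · rw [div_inv_eq_mul]
      exact hR (mul_mem_chartAlgebra t s)
    · rw [← chartAlgebra_inv_right]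
      exact key _ (inv_ne_zero hs0)
    · rw [dWedge_div_left (inv_ne_zero hs0), dWedge_inv_right, smul_smul, inv_inv, smul_smul]
      congr 1
      field_simp

lemma smul_dWedge_mem_regularForms {R : Subalgebra k F} {t s : F} (hs0 : s ≠ 0)
    (hR : chartAlgebra k t s ≤ R) (hs : s ∈ R ∨ s⁻¹ ∈ R) {r : F} (hr : r ∈ R) :
    r • (s⁻¹ • dWedge t s) ∈ regularForms R := by
  obtain ⟨a, ha, b, hb, -, ε, hε, h⟩ := exists_dWedge_eq hs0 hR hs
  have hεR : ε ∈ R := by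
    rcases hε with rfl | rfl
    exacts [one_mem _, neg_mem (one_mem _)]
  have hε2 : ε * ε = 1 := by rcases hε with rfl | rfl <;> norm_num
  have : r • (s⁻¹ • dWedge t s) = (r * ε) • dWedge (k := k) a b := by
    rw [h, smul_smul (r * ε), mul_assoc, hε2, mul_one]
  rw [this]
  exact Submodule.smul_mem (regularForms R) (⟨r * ε, mul_mem hr hεR⟩ : R)
    (Submodule.subset_span ⟨a, ha, b, hb, rfl⟩)

lemma mem_regularForms_iff_of_chart {R : Subalgebra k F} {t s : F} (hs0 : s ≠ 0)
    (hR : chartAlgebra k t s ≤ R) (hs : s ∈ R ∨ s⁻¹ ∈ R)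
    (hfrac : ∀ r ∈ R, ∃ f ∈ chartAlgebra k t s, ∃ g ∈ chartAlgebra k t s,
      g ≠ 0 ∧ g⁻¹ ∈ R ∧ r * g = f) (ω : TwoForms k F) :
    ω ∈ regularForms R ↔ ∃ r ∈ R, ω = r • (s⁻¹ • dWedge t s) := by
  refine ⟨fun hω => ?_, ?_⟩
  · obtain ⟨a, ha, b, hb, hab, ε, hε, h⟩ := exists_dWedge_eq hs0 hR hs
    obtain ⟨r, hr, rfl⟩ := (mem_regularForms_iff ha hb (fun r hr => by
      obtain ⟨f, hf, g, hg, h⟩ := hfrac r hr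
      exact ⟨f, hab hf, g, hab hg, h⟩) ω).mp hω
    refine ⟨r * ε, mul_mem hr ?_, by rw [h, smul_smul]⟩
    rcases hε with rfl | rfl
    exacts [one_mem _, neg_mem (one_mem _)]
  · rintro ⟨r, hr, rfl⟩
    exact smul_dWedge_mem_regularForms hs0 hR hs hr

end Charts

/-! ### Local rings of an integral scheme -/

section LocalRings

lemma isPrimeDivisor_iff {X : Scheme.{u}} {U : X.Opens} (hU : IsAffineOpen U) (y : U) :
    IsPrimeDivisor y.1 ↔ (hU.primeIdealOf y).asIdeal.height = 1 := by
  have hloc := hU.isLocalization_stalk y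
  let _ : Algebra Γ(X, U) (X.presheaf.stalk y.1) := (X.presheaf.germ U y.1 y.2).hom.toAlgebra
  rw [IsPrimeDivisor, IsLocalization.AtPrime.ringKrullDim_eq_height (hU.primeIdealOf y).asIdeal]
  exact WithBot.coe_eq_one

lemma exists_specializes_primeIdealOf_eq {X : Scheme.{u}} {U : X.Opens} (hU : IsAffineOpen U)
    (x : U) (Q : Ideal Γ(X, U)) [hQ : Q.IsPrime] (hQx : Q ≤ (hU.primeIdealOf x).asIdeal) :
    ∃ y : U, y.1 ⤳ x.1 ∧ (hU.primeIdealOf y).asIdeal = Q := by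
  let q : PrimeSpectrum Γ(X, U) := ⟨Q, hQ⟩
  have hq : hU.fromSpec q ∈ U := by
    have : hU.fromSpec q ∈ Set.range hU.fromSpec := ⟨q, rfl⟩
    rwa [hU.range_fromSpec] at this
  refine ⟨⟨hU.fromSpec q, hq⟩, ?_, ?_⟩
  · have h := ((PrimeSpectrum.le_iff_specializes q (hU.primeIdealOf x)).mp hQx).map
      hU.fromSpec.continuous
    rwa [hU.fromSpec_primeIdealOf] at h
  · have h1 := hU.fromSpec_primeIdealOf ⟨hU.fromSpec q, hq⟩
    have h2 := hU.fromSpec.isOpenEmbedding.injective h1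
    rw [h2]

lemma isIntegrallyClosed_stalk {X : Scheme.{u}} [IsIntegral X] {U : X.Opens}
    [IsIntegrallyClosed Γ(X, U)] (hU : IsAffineOpen U) (x : U) :
    IsIntegrallyClosed (X.presheaf.stalk x.1) := by
  have hloc := hU.isLocalization_stalk x
  have : Nonempty U := ⟨x⟩
  let _ : Algebra Γ(X, U) (X.presheaf.stalk x.1) := (X.presheaf.germ U x.1 x.2).hom.toAlgebra
  exact isIntegrallyClosed_of_isLocalization _ (hU.primeIdealOf x).asIdeal.primeCompl
    (Ideal.primeCompl_le_nonZeroDivisors _)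

variable {k : Type u} [Field k] {X : Scheme.{u}} (f : X ⟶ Spec (.of k)) [IsIntegral X]

lemma localRing_le_of_specializes {x y : X} (h : y ⤳ x) : localRing f x ≤ localRing f y := by
  rintro _ ⟨s, rfl⟩
  refine ⟨(X.presheaf.stalkSpecializes h).hom s, ?_⟩
  have := X.presheaf.stalkSpecializes_comp ((genericPoint_spec X).specializes trivial) h
  exact congr($(this).hom s)

variable {f} {U : X.Opens}

/-- The inclusion of the ring of sections over a nonempty open set into the function field. -/
def sectionsToFunField (f : X ⟶ Spec (.of k)) (U : X.Opens) [Nonempty U] : Γ(X, U) →+* FunField f :=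
  (X.germToFunctionField U).hom

lemma sectionsToFunField_injective [Nonempty U] : Function.Injective (sectionsToFunField f U) :=
  X.germToFunctionField_injective U

lemma stalkToFunField_germ [Nonempty U] (x : X) (hx : x ∈ U) (s : Γ(X, U)) :
    stalkToFunField f x (X.presheaf.germ U x hx s) = sectionsToFunField f U s :=
  Scheme.algebraMap_germ_eq_germToFunctionField X hx s

lemma stalkToFunField_injective (x : X) : Function.Injective (stalkToFunField f x) :=
  IsFractionRing.injective (X.presheaf.stalk x) X.functionField

lemma mem_localRing_iff (hU : IsAffineOpen U) [Nonempty U] (x : U) (z : FunField f) :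
    z ∈ localRing f x ↔ ∃ a b : Γ(X, U), b ∉ (hU.primeIdealOf x).asIdeal ∧
      z * sectionsToFunField f U b = sectionsToFunField f U a := by
  have hloc := hU.isLocalization_stalk x
  let _ : Algebra Γ(X, U) (X.presheaf.stalk x.1) := (X.presheaf.germ U x.1 x.2).hom.toAlgebra
  have e (a : Γ(X, U)) : stalkToFunField f x.1 (algebraMap Γ(X, U) (X.presheaf.stalk x.1) a) =
      sectionsToFunField f U a := stalkToFunField_germ x.1 x.2 a
  constructor
  · rintro ⟨s, rfl⟩
    obtain ⟨⟨a, b⟩, hab⟩ := IsLocalization.surj (hU.primeIdealOf x).asIdeal.primeCompl s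
    refine ⟨a, b, b.2, ?_⟩
    rw [← e, ← e, ← hab, map_mul]
  · rintro ⟨a, b, hb, hab⟩
    refine ⟨IsLocalization.mk' _ a (⟨b, hb⟩ : (hU.primeIdealOf x).asIdeal.primeCompl), ?_⟩
    have hb0 : sectionsToFunField f U b ≠ 0 := by
      rw [map_ne_zero_iff _ sectionsToFunField_injective]
      rintro rfl
      exact hb (zero_mem _)
    apply mul_right_cancel₀ hb0
    change stalkToFunField f x.1 _ * _ = _
    rw [hab, ← e, ← e, ← map_mul]
    congr 1
    exact IsLocalization.mk'_spec _ a (⟨b, hb⟩ : (hU.primeIdealOf x).asIdeal.primeCompl)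

lemma range_le_localRing [Nonempty U] (x : U) (a : Γ(X, U)) :
    sectionsToFunField f U a ∈ localRing f x.1 :=
  ⟨X.presheaf.germ U x.1 x.2 a, stalkToFunField_germ x.1 x.2 a⟩

lemma mem_range_of_forall_mem_localRing (hU : IsAffineOpen U) [Nonempty U] (z : FunField f)
    (h : ∀ x : U, z ∈ localRing f x.1) : ∃ a, sectionsToFunField f U a = z := by
  algebraize [sectionsToFunField f U]
  have htop : denomIdeal Γ(X, U) z = ⊤ := by
    by_contra hne
    obtain ⟨M, hM, hle⟩ := Ideal.exists_le_maximal _ hne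
    let q : PrimeSpectrum Γ(X, U) := ⟨M, hM.isPrime⟩
    have hq : hU.fromSpec q ∈ U := by
      have : hU.fromSpec q ∈ Set.range hU.fromSpec := ⟨q, rfl⟩
      rwa [hU.range_fromSpec] at this
    have h1 := hU.fromSpec_primeIdealOf ⟨hU.fromSpec q, hq⟩
    have h2 := hU.fromSpec.isOpenEmbedding.injective h1
    obtain ⟨a, b, hb, hab⟩ := (mem_localRing_iff hU _ z).mp (h ⟨hU.fromSpec q, hq⟩)
    rw [h2] at hb
    exact hb (hle ⟨a, by rw [mul_comm]; exact hab⟩)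
  obtain ⟨a, ha⟩ := (Ideal.eq_top_iff_one _).mp htop
  exact ⟨a, by rw [map_one, one_mul] at ha; exact ha.symm⟩

variable [IsNoetherianRing Γ(X, U)] [IsIntegrallyClosed Γ(X, U)]

/-- On a normal Noetherian affine open set, a rational function that is regular at the prime
divisors through a point is regular at that point. -/
lemma mem_localRing_of_forall_isPrimeDivisor (hU : IsAffineOpen U) [Nonempty U] (x : U)
    (z : FunField f) (h : ∀ y : X, IsPrimeDivisor y → y ⤳ x.1 → z ∈ localRing f y) :
    z ∈ localRing f x.1 := by
  algebraize [sectionsToFunField f U]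
  have : IsFractionRing Γ(X, U) (FunField f) := functionField_isFractionRing_of_isAffineOpen X U hU
  have := exists_denom_notMem_of_height_one (hU.primeIdealOf x).asIdeal z ?_
  · obtain ⟨b, ⟨a, hab⟩, hb⟩ := SetLike.not_le_iff_exists.mp this
    exact (mem_localRing_iff hU x z).mpr ⟨a, b, hb, by rw [mul_comm]; exact hab⟩
  · intro Q hQ hht hQx hle
    obtain ⟨y, hyx, rfl⟩ := exists_specializes_primeIdealOf_eq hU x Q hQx
    obtain ⟨a, b, hb, hab⟩ := (mem_localRing_iff hU y z).mp
      (h y.1 ((isPrimeDivisor_iff hU y).mpr hht) hyx)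
    exact hb (hle ⟨a, by rw [mul_comm]; exact hab⟩)

/-- On a normal Noetherian affine open set, the local ring of a prime divisor is a valuation
ring. -/
lemma mem_localRing_or_inv_mem (hU : IsAffineOpen U) (y : U) (hy : IsPrimeDivisor y.1)
    (z : FunField f) : z ∈ localRing f y.1 ∨ z⁻¹ ∈ localRing f y.1 := by
  have hloc := hU.isLocalization_stalk y
  have : IsIntegrallyClosed (X.presheaf.stalk y.1) := isIntegrallyClosed_stalk hU y
  let _ : Algebra Γ(X, U) (X.presheaf.stalk y.1) := (X.presheaf.germ U y.1 y.2).hom.toAlgebra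
  have : IsNoetherianRing (X.presheaf.stalk y.1) :=
    IsLocalization.isNoetherianRing (hU.primeIdealOf y).asIdeal.primeCompl _ inferInstance
  have : Ring.KrullDimLE 1 (X.presheaf.stalk y.1) :=
    (Ring.krullDimLE_iff).mpr (by rw [show ringKrullDim (X.presheaf.stalk y.1) = 1 from hy]; rfl)
  have hiff := (tfae_of_isNoetherianRing_of_isLocalRing_of_isDomain (X.presheaf.stalk y.1)).out 3 1
  have hbot : (⊥ : Ideal (X.presheaf.stalk y.1)).IsPrime := Ideal.isPrime_bot
  have hval : ValuationRing (X.presheaf.stalk y.1) := hiff.mp ⟨inferInstance, fun P hP hP' =>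
    IsLocalRing.eq_maximalIdeal (Ring.krullDimLE_one_iff_of_isPrime_bot.mp inferInstance P hP hP')⟩
  have := ValuationRing.isInteger_or_isInteger (X.presheaf.stalk y.1)
    (K := X.functionField) z
  exact this

end LocalRings

/-! ### Lattice points in a diamond -/

section LatticePoints

/-- An enumeration of the lattice points of the diamond `|i| + |j| ≤ m`. -/
def diamondPoint (m : ℕ) : (Fin (m + 1) × Fin (m + 1)) ⊕ (Fin m × Fin m) → ℤ × ℤ
  | .inl (a, b) => (a + b - m, a - b)
  | .inr (a, b) => (a + b + 1 - m, a - b)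

lemma diamondPoint_injective (m : ℕ) : Function.Injective (diamondPoint m) := by
  rintro (⟨a, b⟩ | ⟨a, b⟩) (⟨c, d⟩ | ⟨c, d⟩) h <;>
    simp only [diamondPoint, Prod.mk.injEq, Sum.inl.injEq, Sum.inr.injEq, Fin.ext_iff,
      reduceCtorEq] at h ⊢ <;> omega

lemma range_diamondPoint (m : ℕ) :
    Set.range (diamondPoint m) = {p : ℤ × ℤ | |p.2| ≤ p.1 + m ∧ |p.2| ≤ -p.1 + m} := by
  ext ⟨i, j⟩
  simp only [Set.mem_range, Set.mem_ofPred_eq, abs_le]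
  constructor
  · rintro ⟨⟨a, b⟩ | ⟨a, b⟩, h⟩ <;> simp only [diamondPoint, Prod.mk.injEq] at h <;> omega
  · rintro h
    rcases Int.emod_two_eq_zero_or_one (i + j + m) with h0 | h0
    · refine ⟨.inl (⟨((i + j + m) / 2).toNat, by omega⟩, ⟨((i - j + m) / 2).toNat, by omega⟩), ?_⟩
      simp only [diamondPoint, Prod.mk.injEq]
      omega
    · refine ⟨.inr (⟨((i + j + m) / 2).toNat, by omega⟩, ⟨((i - j + m) / 2).toNat, by omega⟩), ?_⟩
      simp only [diamondPoint, Prod.mk.injEq]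
      omega

end LatticePoints

/-! ### Anticanonical functions on the four charts -/

section Toric

variable {k F : Type u} [Field k] [Field F] [Algebra k F]

/-- The first coordinates `t` of the four charts `k[t, ts, t/s]`. -/
def chartLeft (x y : F) : Fin 4 → F := ![x, x⁻¹, y, y⁻¹]

/-- The second coordinates `s` of the four charts `k[t, ts, t/s]`. -/
def chartRight (x y : F) : Fin 4 → F := ![y, y, x, x]

/-- The rational 2-form `dx ∧ dy / (xy)`. -/
def logForm (k : Type u) {F : Type u} [Field k] [Field F] [Algebra k F] (x y : F) : TwoForms k F :=
  (x * y)⁻¹ • dWedge x y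

variable {x y : F}

lemma IsCoordinatePair.chart (h : IsCoordinatePair k x y) (i : Fin 4) :
    IsCoordinatePair k (chartLeft x y i) (chartRight x y i) := by
  fin_cases i
  exacts [h, h.inv_left, h.swap, h.swap.inv_left]

/-- On each chart, `dt ∧ ds / s = ± t dx ∧ dy / (xy)`. -/
lemma IsCoordinatePair.exists_chart_form (h : IsCoordinatePair k x y) (i : Fin 4) :
    ∃ ε : F, (ε = 1 ∨ ε = -1) ∧
      (chartRight x y i)⁻¹ • dWedge (chartLeft x y i) (chartRight x y i) =
        (ε * chartLeft x y i) • logForm k x y := by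
  have hx := h.ne_zero_left
  have hy := h.ne_zero_right
  have hinv (a b : F) : dWedge (k := k) a⁻¹ b = (-a⁻¹ ^ 2) • dWedge a b := by
    rw [dWedge_eq_smul (k := k) (a := a) (b := b) (p := -a⁻¹ ^ 2) (q := 0) (p' := 0) (q' := 1)
      (by rw [Derivation.leibniz_inv]; simp) (by simp)]
    simp
  have hswap : dWedge (k := k) y x = (-1 : F) • dWedge x y := by
    rw [dWedge_eq_smul (k := k) (a := x) (b := y) (p := 0) (q := 1) (p' := 1) (q' := 0)
      (by simp) (by simp)]
    simp
  fin_cases i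
  · refine ⟨1, Or.inl rfl, ?_⟩
    change y⁻¹ • dWedge x y = (1 * x) • (x * y)⁻¹ • dWedge x y
    rw [smul_smul]
    congr 1
    field_simp
  · refine ⟨-1, Or.inr rfl, ?_⟩
    change y⁻¹ • dWedge x⁻¹ y = (-1 * x⁻¹) • (x * y)⁻¹ • dWedge x y
    rw [hinv, smul_smul, smul_smul]
    congr 1
    field_simp
  · refine ⟨-1, Or.inr rfl, ?_⟩
    change x⁻¹ • dWedge y x = (-1 * y) • (x * y)⁻¹ • dWedge x y
    rw [hswap, smul_smul, smul_smul]
    congr 1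
    field_simp
  · refine ⟨1, Or.inl rfl, ?_⟩
    change x⁻¹ • dWedge y⁻¹ x = (1 * y⁻¹) • (x * y)⁻¹ • dWedge x y
    rw [hinv, hswap, smul_smul, smul_smul, smul_smul]
    congr 1
    field_simp

lemma IsCoordinatePair.exists_logForm_equiv (h : IsCoordinatePair k x y) :
    ∃ τ : TwoForms k F ≃ₗ[F] F, τ (logForm k x y) = 1 := by
  obtain ⟨τ, hτ⟩ := h.exists_linearEquiv
  have hxy : x * y ≠ 0 := mul_ne_zero h.ne_zero_left h.ne_zero_right
  refine ⟨τ.trans (LinearEquiv.smulOfNeZero F F (x * y) hxy), ?_⟩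
  simp only [logForm, LinearEquiv.trans_apply, map_smul, hτ, LinearEquiv.smulOfNeZero_apply,
    smul_eq_mul, mul_one, inv_mul_cancel₀ hxy]

/-- The transition functions `tᵢ / tⱼ` are regular on the chart `i`. -/
lemma IsCoordinatePair.div_mem_chart (h : IsCoordinatePair k x y) (i j : Fin 4) :
    chartLeft x y i / chartLeft x y j ∈ chartAlgebra k (chartLeft x y i) (chartRight x y i) := by
  have hx := h.ne_zero_left
  have hy := h.ne_zero_right
  have key (t s : F) (ht : t ≠ 0) : t / t ∈ chartAlgebra k t s ∧ t / t⁻¹ ∈ chartAlgebra k t s ∧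
      t / s ∈ chartAlgebra k t s ∧ t / s⁻¹ ∈ chartAlgebra k t s := by
    refine ⟨by rw [div_self ht]; exact one_mem _, ?_, div_mem_chartAlgebra t s, ?_⟩
    · rw [div_inv_eq_mul]
      exact mul_mem (left_mem_chartAlgebra t s) (left_mem_chartAlgebra t s)
    · rw [div_inv_eq_mul]
      exact mul_mem_chartAlgebra t s
  have h0 := key x y hx
  have h1 := key x⁻¹ y (inv_ne_zero hx)
  have h2 := key y x hy
  have h3 := key y⁻¹ x (inv_ne_zero hy)
  rw [inv_inv] at h1 h3
  fin_cases i <;> fin_cases j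
  exacts [h0.1, h0.2.1, h0.2.2.1, h0.2.2.2, h1.2.1, h1.1, h1.2.2.1, h1.2.2.2,
    h2.2.2.1, h2.2.2.2, h2.1, h2.2.1, h3.2.2.1, h3.2.2.2, h3.2.1, h3.1]

lemma mem_span_of_mul_laurentMonomial_mem (hx : x ≠ 0) (hy : y ≠ 0) {S : Set (ℤ × ℤ)} {z : F}
    (q : ℤ × ℤ) (hz : z * laurentMonomial x y q ∈ Submodule.span k (laurentMonomial x y '' S)) :
    z ∈ Submodule.span k (laurentMonomial x y '' {p | p + q ∈ S}) := by
  have h1 : laurentMonomial x y q * laurentMonomial x y (-q) = 1 := by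
    rw [← laurentMonomial_add hx hy, add_neg_cancel]
    simp [laurentMonomial]
  have h2 := Submodule.mem_map_of_mem (f := LinearMap.mulRight k (laurentMonomial x y (-q))) hz
  rw [LinearMap.mulRight_apply, mul_assoc, h1, mul_one, Submodule.map_span] at h2
  refine Submodule.span_mono ?_ h2
  rintro _ ⟨_, ⟨p, hp, rfl⟩, rfl⟩
  refine ⟨p - q, by simpa using hp, ?_⟩
  rw [LinearMap.mulRight_apply, sub_eq_add_neg, laurentMonomial_add hx hy]

/-- The space of `g` with `g (dx ∧ dy / (xy))⁻ᵐ` regular on all four charts. It is spanned by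
the Laurent monomials with exponents in the diamond `|i| + |j| ≤ m`. -/
def antiCanonicalSpace (k : Type u) {F : Type u} [Field k] [Field F] [Algebra k F] (x y : F)
    (m : ℕ) : Submodule k F :=
  ⨅ i : Fin 4, (Subalgebra.toSubmodule (chartAlgebra k (chartLeft x y i) (chartRight x y i))).comap
    (LinearMap.mulLeft k (chartLeft x y i ^ m))

lemma mem_antiCanonicalSpace {m : ℕ} {g : F} : g ∈ antiCanonicalSpace k x y m ↔
    ∀ i, chartLeft x y i ^ m * g ∈ chartAlgebra k (chartLeft x y i) (chartRight x y i) := by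
  simp [antiCanonicalSpace, Submodule.mem_iInf]

lemma IsCoordinatePair.antiCanonicalSpace_eq_span (h : IsCoordinatePair k x y) (m : ℕ) :
    antiCanonicalSpace k x y m =
      Submodule.span k (laurentMonomial x y '' Set.range (diamondPoint m)) := by
  have hx := h.ne_zero_left
  have hy := h.ne_zero_right
  rw [range_diamondPoint]
  apply le_antisymm
  · intro g hg
    rw [mem_antiCanonicalSpace] at hg
    have h0 : x ^ m * g ∈ chartAlgebra k x y := hg 0
    have h1 : x⁻¹ ^ m * g ∈ chartAlgebra k x⁻¹ y := hg 1
    rw [← Subalgebra.mem_toSubmodule, chartAlgebra_eq_span hx hy] at h0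
    rw [← Subalgebra.mem_toSubmodule, chartAlgebra_eq_span (inv_ne_zero hx) hy] at h1
    have e : laurentMonomial x⁻¹ y '' {p | |p.2| ≤ p.1} =
        laurentMonomial x y '' {p | |p.2| ≤ -p.1} := by
      ext w
      constructor
      · rintro ⟨p, hp, rfl⟩
        exact ⟨(-p.1, p.2), by simpa using hp, by simp [laurentMonomial]⟩
      · rintro ⟨p, hp, rfl⟩
        exact ⟨(-p.1, p.2), by simpa using hp, by simp [laurentMonomial]⟩
    have e0 : x ^ m * g = g * laurentMonomial x y (m, 0) := by simp [laurentMonomial, mul_comm]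
    have e1 : x⁻¹ ^ m * g = g * laurentMonomial x y (-m, 0) := by simp [laurentMonomial, mul_comm]
    rw [e0] at h0
    rw [e, e1] at h1
    have h2 := Submodule.mem_inf.mpr ⟨mem_span_of_mul_laurentMonomial_mem hx hy _ h0,
      mem_span_of_mul_laurentMonomial_mem hx hy _ h1⟩
    rw [h.span_inf_span] at h2
    convert h2 using 4
    ext p
    simp [add_comm]
  · rw [Submodule.span_le]
    rintro _ ⟨⟨a, b⟩, ⟨hp1, hp2⟩, rfl⟩
    rw [SetLike.mem_coe, mem_antiCanonicalSpace]
    simp only at hp1 hp2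
    intro i
    have key (q : ℤ × ℤ) (hq : |q.2| ≤ q.1) (z : F)
        (hz : z = laurentMonomial (chartLeft x y i) (chartRight x y i) q) :
        z ∈ chartAlgebra k (chartLeft x y i) (chartRight x y i) :=
      hz ▸ laurentMonomial_mem_chartAlgebra (h.chart i).ne_zero_left hq
    fin_cases i
    · refine key (a + m, b) (by simpa using hp1) _ ?_
      simp [chartLeft, chartRight, laurentMonomial, zpow_add₀ hx]
      ring
    · refine key (-a + m, b) (by simpa using hp2) _ ?_
      simp [chartLeft, chartRight, laurentMonomial, zpow_add₀ hx]
      field_simp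
    · refine key (b + m, a) ?_ _ ?_
      · simp only [abs_le] at *
        omega
      · simp [chartLeft, chartRight, laurentMonomial, zpow_add₀ hy]
        ring
    · refine key (-b + m, a) ?_ _ ?_
      · simp only [abs_le] at *
        omega
      · simp [chartLeft, chartRight, laurentMonomial, zpow_add₀ hy]
        field_simp

lemma IsCoordinatePair.finrank_antiCanonicalSpace (h : IsCoordinatePair k x y) (m : ℕ) :
    Module.finrank k (antiCanonicalSpace k x y m) = (m + 1) ^ 2 + m ^ 2 := by
  rw [h.antiCanonicalSpace_eq_span, ← Set.range_comp,
    finrank_span_eq_card (h.linearIndependent.comp _ (diamondPoint_injective m))]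
  simp [sq]

end Toric

/-! ### The toric surface of the diamond -/

section ToricSurface

variable {k : Type u} [Field k] {X : Scheme.{u}} (f : X ⟶ Spec (.of k)) [IsIntegral X]

/-- The integral scheme `X` with function field `k(x, y)` is covered by four affine open sets with
coordinate rings `k[t, ts, t/s]`, where `t` is `x`, `1/x`, `y`, `1/y`, glued along the loci where
the transition functions `tⱼ / tᵢ` are regular: it is the toric surface whose
fan consists of the cones over the edges of the square with vertices `(±1, ±1)`. -/
structure IsToricDiamond (x y : FunField f) where
  coord : IsCoordinatePair k x y
  /-- The charts. -/
  chart : Fin 4 → X.Opens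
  isAffineOpen : ∀ i, IsAffineOpen (chart i)
  nonempty : ∀ i, Nonempty (chart i)
  exists_mem : ∀ z : X, ∃ i, z ∈ chart i
  mem_chartAlgebra : ∀ i z, z ∈ chartAlgebra k (chartLeft x y i) (chartRight x y i) ↔
    ∃ a, sectionsToFunField f (chart i) a = z
  mem_chart : ∀ i j, ∀ z ∈ chart i,
    chartLeft x y j / chartLeft x y i ∈ localRing f z → z ∈ chart j

namespace IsToricDiamond

variable {f} {x y : FunField f} (T : IsToricDiamond f x y)
include T

/-- The ring of sections on a chart. -/
def sectionsEquiv (i : Fin 4) :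
    Γ(X, T.chart i) ≃+* chartAlgebra k (chartLeft x y i) (chartRight x y i) :=
  have := T.nonempty i
  RingEquiv.ofBijective ((sectionsToFunField f (T.chart i)).codRestrict _ fun a =>
      (T.mem_chartAlgebra i _).mpr ⟨a, rfl⟩)
    ⟨fun _ _ h => sectionsToFunField_injective (congrArg Subtype.val h), fun z => by
      obtain ⟨a, ha⟩ := (T.mem_chartAlgebra i _).mp z.2
      exact ⟨a, Subtype.ext ha⟩⟩

lemma isNoetherianRing (i : Fin 4) : IsNoetherianRing Γ(X, T.chart i) := by
  have : Algebra.FiniteType k (chartAlgebra k (chartLeft x y i) (chartRight x y i)) :=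
    Algebra.FiniteType.adjoin_of_finite (Set.toFinite _)
  have := Algebra.FiniteType.isNoetherianRing k
    (chartAlgebra k (chartLeft x y i) (chartRight x y i))
  exact isNoetherianRing_of_ringEquiv _ (T.sectionsEquiv i).symm

lemma isIntegrallyClosed (i : Fin 4) : IsIntegrallyClosed Γ(X, T.chart i) := by
  have := T.nonempty i
  algebraize [sectionsToFunField f (T.chart i)]
  have : IsFractionRing Γ(X, T.chart i) (FunField f) :=
    functionField_isFractionRing_of_isAffineOpen X (T.chart i) (T.isAffineOpen i)
  refine (isIntegrallyClosed_iff (FunField f)).mpr fun {z} hz => ?_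
  have hz' : IsIntegral (chartAlgebra k (chartLeft x y i) (chartRight x y i)) z :=
    IsIntegral.map_of_comp_eq (T.sectionsEquiv i).toRingHom (RingHom.id _) rfl hz
  exact (T.mem_chartAlgebra i z).mp ((T.coord.chart i).mem_chartAlgebra_of_isIntegral hz')

lemma chartAlgebra_le_localRing {i : Fin 4} {z : X} (hz : z ∈ T.chart i) :
    chartAlgebra k (chartLeft x y i) (chartRight x y i) ≤ localRing f z := by
  intro w hw
  have := T.nonempty i
  obtain ⟨a, rfl⟩ := (T.mem_chartAlgebra i w).mp hw
  exact range_le_localRing ⟨z, hz⟩ a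

lemma chartLeft_ne_zero (i : Fin 4) : chartLeft x y i ≠ 0 := (T.coord.chart i).ne_zero_left

lemma exists_chart_frac {i : Fin 4} {z : X} (hz : z ∈ T.chart i) {r : FunField f}
    (hr : r ∈ localRing f z) :
    ∃ a ∈ chartAlgebra k (chartLeft x y i) (chartRight x y i),
      ∃ b ∈ chartAlgebra k (chartLeft x y i) (chartRight x y i),
        b ≠ 0 ∧ b⁻¹ ∈ localRing f z ∧ r * b = a := by
  have := T.nonempty i
  obtain ⟨a, b, hb, hab⟩ := (mem_localRing_iff (T.isAffineOpen i) ⟨z, hz⟩ r).mp hr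
  have hb0 : sectionsToFunField f (T.chart i) b ≠ 0 := by
    rw [map_ne_zero_iff _ sectionsToFunField_injective]
    rintro rfl
    exact hb (zero_mem _)
  refine ⟨_, (T.mem_chartAlgebra i _).mpr ⟨a, rfl⟩, _, (T.mem_chartAlgebra i _).mpr ⟨b, rfl⟩,
    hb0, ?_, hab⟩
  exact (mem_localRing_iff (T.isAffineOpen i) ⟨z, hz⟩ _).mpr
    ⟨1, b, hb, by rw [map_one, inv_mul_cancel₀ hb0]⟩

/-- Along a prime divisor that meets the chart `i`, the regular forms are generated by
`tᵢ • dx ∧ dy / (xy)`. -/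
lemma mem_regularForms_iff {i : Fin 4} {z : X} (hz : z ∈ T.chart i) (hp : IsPrimeDivisor z)
    (c : FunField f) :
    c • logForm k x y ∈ regularForms (localRing f z) ↔ c / chartLeft x y i ∈ localRing f z := by
  have := T.isNoetherianRing i
  have := T.isIntegrallyClosed i
  have hy0 : chartRight x y i ≠ 0 := (T.coord.chart i).ne_zero_right
  have hx0 := T.chartLeft_ne_zero i
  have hs := mem_localRing_or_inv_mem (T.isAffineOpen i) ⟨z, hz⟩ hp (chartRight x y i)
  rw [mem_regularForms_iff_of_chart hy0 (T.chartAlgebra_le_localRing hz) hs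
    fun r hr => T.exists_chart_frac hz hr]
  obtain ⟨ε, hε, h⟩ := T.coord.exists_chart_form i
  obtain ⟨τ, hτ⟩ := T.coord.exists_logForm_equiv
  have hεR : ε ∈ localRing f z := by
    rcases hε with rfl | rfl
    exacts [one_mem _, neg_mem (one_mem _)]
  have hε2 : ε * ε = 1 := by rcases hε with rfl | rfl <;> norm_num
  rw [h]
  constructor
  · rintro ⟨r, hr, hrω⟩
    have := congrArg τ hrω
    rw [map_smul, map_smul, map_smul, hτ, smul_eq_mul, smul_eq_mul, smul_eq_mul, mul_one,
      mul_one] at this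
    rw [this]
    have e : r * (ε * chartLeft x y i) / chartLeft x y i = r * ε := by field_simp
    rw [e]
    exact mul_mem hr hεR
  · intro hc
    refine ⟨c / chartLeft x y i * ε, mul_mem hc hεR, ?_⟩
    rw [smul_smul]
    congr 1
    field_simp
    rw [sq, hε2, mul_one]

lemma mem_canonicalStalk_iff {i : Fin 4} {z : X} (hz : z ∈ T.chart i) (c : FunField f) :
    c • logForm k x y ∈ canonicalStalk f z ↔ c / chartLeft x y i ∈ localRing f z := by
  have := T.isNoetherianRing i
  have := T.isIntegrallyClosed i
  have := T.nonempty i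
  constructor
  · intro h
    refine mem_localRing_of_forall_isPrimeDivisor (T.isAffineOpen i) ⟨z, hz⟩ _ fun w hw hwz => ?_
    exact (T.mem_regularForms_iff (hwz.mem_open (T.chart i).isOpen hz) hw c).mp (h w hw hwz)
  · intro h w hw hwz
    exact (T.mem_regularForms_iff (hwz.mem_open (T.chart i).isOpen hz) hw c).mpr
      (localRing_le_of_specializes f hwz h)

lemma exists_eq_smul (ω : TwoForms k (FunField f)) : ∃ c : FunField f, ω = c • logForm k x y := by
  obtain ⟨τ, hτ⟩ := T.coord.exists_logForm_equiv
  exact ⟨τ ω, τ.injective (by rw [map_smul, hτ, smul_eq_mul, mul_one])⟩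

lemma smul_logForm_injective {c d : FunField f} (h : c • logForm k x y = d • logForm k x y) :
    c = d := by
  obtain ⟨τ, hτ⟩ := T.coord.exists_logForm_equiv
  simpa [map_smul, hτ] using congrArg τ h

lemma isCanonicalGenerator {i : Fin 4} {z : X} (hz : z ∈ T.chart i) :
    IsCanonicalGenerator f z (chartLeft x y i • logForm k x y) := by
  have hx0 := T.chartLeft_ne_zero i
  ext ω
  obtain ⟨c, rfl⟩ := T.exists_eq_smul ω
  rw [T.mem_canonicalStalk_iff hz]
  constructor
  · intro h
    exact ⟨_, h, by rw [smul_smul, div_mul_cancel₀ _ hx0]⟩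
  · rintro ⟨r, hr, hrω⟩
    rw [smul_smul] at hrω
    rwa [T.smul_logForm_injective hrω, mul_div_cancel_right₀ _ hx0]

/-- The toric charts have canonical singularities. Any valuation ring `R` contains `s` or `1/s`, so
`dt ∧ ds / s` is regular on `R`. -/
lemma mem_regularForms_of_valuation {i : Fin 4} {z : X} (hz : z ∈ T.chart i)
    {R : Subalgebra k (FunField f)} (hR : ∀ a, a ∈ R ∨ a⁻¹ ∈ R) (hRz : localRing f z ≤ R)
    {ω : TwoForms k (FunField f)} (hω : ω ∈ canonicalStalk f z) : ω ∈ regularForms R := by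
  have hx0 := T.chartLeft_ne_zero i
  obtain ⟨c, rfl⟩ := T.exists_eq_smul ω
  rw [T.mem_canonicalStalk_iff hz] at hω
  obtain ⟨ε, hε, h⟩ := T.coord.exists_chart_form i
  have hεR : ε ∈ R := by
    rcases hε with rfl | rfl
    exacts [one_mem _, neg_mem (one_mem _)]
  have hε2 : ε * ε = 1 := by rcases hε with rfl | rfl <;> norm_num
  have := smul_dWedge_mem_regularForms (T.coord.chart i).ne_zero_right
    ((T.chartAlgebra_le_localRing hz).trans hRz) (hR _) (mul_mem (hRz hω) hεR)
  rw [h, smul_smul] at this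
  convert! this using 2
  field_simp
  rw [sq, hε2, mul_one]

/-- The homogeneous function of degree `m` on the line of 2-forms with value `g` at
`dx ∧ dy / (xy)`. -/
lemma exists_section (m : ℕ) (g : FunField f) :
    ∃ s : TwoForms k (FunField f) → FunField f, ∀ c, s (c • logForm k x y) = c ^ m * g := by
  obtain ⟨τ, hτ⟩ := T.coord.exists_logForm_equiv
  exact ⟨fun ω => τ ω ^ m * g, fun c => by simp [map_smul, hτ]⟩

/-- A section of `ω⁻ᵐ` is regular if and only if its value at the generator of `ω` on each chart is
a function on this chart. -/
lemma mem_antiCanonicalSections_iff {m : ℕ} {g : FunField f}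
    {s : TwoForms k (FunField f) → FunField f} (hs : ∀ c, s (c • logForm k x y) = c ^ m * g) :
    s ∈ antiCanonicalSections f m ↔ g ∈ antiCanonicalSpace k x y m := by
  rw [mem_antiCanonicalSpace]
  constructor
  · intro h i
    have := T.isNoetherianRing i
    have := T.isIntegrallyClosed i
    have := T.nonempty i
    refine (T.mem_chartAlgebra i _).mpr (mem_range_of_forall_mem_localRing (T.isAffineOpen i) _
      fun z => mem_localRing_of_forall_isPrimeDivisor (T.isAffineOpen i) z _ fun w hw hwz => ?_)
    have hwi := hwz.mem_open (T.chart i).isOpen z.2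
    rw [← hs]
    refine h.2 w hw _ ((T.mem_regularForms_iff hwi hw _).mpr ?_)
    rw [div_self (T.chartLeft_ne_zero i)]
    exact one_mem _
  · intro h
    refine ⟨fun c ω => ?_, fun z hz ω hω => ?_⟩
    · obtain ⟨d, rfl⟩ := T.exists_eq_smul ω
      rw [smul_smul, hs, hs, mul_pow, mul_assoc]
    · obtain ⟨d, rfl⟩ := T.exists_eq_smul ω
      obtain ⟨i, hi⟩ := T.exists_mem z
      rw [T.mem_regularForms_iff hi hz] at hω
      have e : d ^ m * g = (d / chartLeft x y i) ^ m * (chartLeft x y i ^ m * g) := by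
        rw [div_pow, ← mul_assoc, div_mul_cancel₀ _ (pow_ne_zero m (T.chartLeft_ne_zero i))]
      rw [hs, e]
      exact mul_mem (pow_mem hω m) (T.chartAlgebra_le_localRing hi (h i))

lemma finrank_antiCanonicalSections (m : ℕ) :
    Module.finrank k (antiCanonicalSections f m) = (m + 1) ^ 2 + m ^ 2 := by
  rw [← T.coord.finrank_antiCanonicalSpace m]
  have hs (s : antiCanonicalSections f m) (c : FunField f) :
      s.1 (c • logForm k x y) = c ^ m * s.1 (logForm k x y) := s.2.1 c _
  let φ : antiCanonicalSections f m →ₗ[k] antiCanonicalSpace k x y m :=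
    { toFun := fun s => ⟨s.1 (logForm k x y), (T.mem_antiCanonicalSections_iff (hs s)).mp s.2⟩
      map_add' := fun _ _ => rfl
      map_smul' := fun _ _ => rfl }
  refine (LinearEquiv.ofBijective φ ⟨fun s t h => ?_, fun g => ?_⟩).finrank_eq
  · ext ω
    obtain ⟨c, rfl⟩ := T.exists_eq_smul ω
    have h' : s.1 (logForm k x y) = t.1 (logForm k x y) := congrArg Subtype.val h
    rw [hs, hs, h']
  · obtain ⟨s, hsg⟩ := T.exists_section m g.1
    refine ⟨⟨s, (T.mem_antiCanonicalSections_iff hsg).mpr g.2⟩, Subtype.ext ?_⟩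
    have := hsg 1
    rwa [one_smul, one_pow, one_mul] at this

/-- The chart `j` is the nonvanishing locus of the section of `ω⁻¹` that takes `dx ∧ dy / (xy)` to
`1 / tⱼ`. -/
lemma nonvanishingAt_iff {j : Fin 4} {s : TwoForms k (FunField f) → FunField f}
    (hs : ∀ c, s (c • logForm k x y) = c ^ 1 * (chartLeft x y j)⁻¹) (z : X) :
    z ∈ T.chart j ↔ NonvanishingAt f s z := by
  have hj := T.chartLeft_ne_zero j
  constructor
  · intro hz
    have h1 : s (chartLeft x y j • logForm k x y) = 1 := by
      rw [hs, pow_one, mul_inv_cancel₀ hj]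
    refine ⟨_, T.isCanonicalGenerator hz, ?_, ?_, ?_⟩ <;> rw [h1]
    · exact one_ne_zero
    · exact one_mem _
    · rw [inv_one]
      exact one_mem _
  · rintro ⟨ω, hω, h0, h1, h2⟩
    obtain ⟨i, hi⟩ := T.exists_mem z
    have hi0 := T.chartLeft_ne_zero i
    refine T.mem_chart i j z hi ?_
    obtain ⟨d, rfl⟩ := T.exists_eq_smul ω
    -- The generators `tᵢ • η` and `d • η` of the canonical stalk differ by a unit.
    have hgen : chartLeft x y i • logForm k x y ∈ canonicalStalk f z := by
      rw [T.mem_canonicalStalk_iff hi, div_self hi0]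
      exact one_mem _
    rw [hω] at hgen
    obtain ⟨r, hr, hrd⟩ := hgen
    rw [smul_smul] at hrd
    have hid := T.smul_logForm_injective hrd
    have hd : d ∈ ({c | c • logForm k x y ∈ canonicalStalk f z} : Set (FunField f)) := by
      rw [Set.mem_ofPred_eq, hω]
      exact ⟨1, one_mem _, (one_smul _ _).symm⟩
    rw [Set.mem_ofPred_eq, T.mem_canonicalStalk_iff hi] at hd
    rw [hs, pow_one] at h0 h1 h2
    have hd0 : d ≠ 0 := left_ne_zero_of_mul h0
    have e : chartLeft x y j / chartLeft x y i =
        (d * (chartLeft x y j)⁻¹)⁻¹ * (d / chartLeft x y i) := by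
      field_simp
    rw [e]
    exact mul_mem h2 hd

/-- The toric surface of the diamond is a quartic Del Pezzo surface. -/
theorem isDelPezzoOfDegree [IsAlgClosed k] [CharZero k] (hf : IsProper f) :
    IsDelPezzoOfDegree f 4 where
  proper := hf
  dim_eq_two := T.coord.trdeg_eq
  normal z := by
    obtain ⟨i, hi⟩ := T.exists_mem z
    have := T.isIntegrallyClosed i
    exact isIntegrallyClosed_stalk (T.isAffineOpen i) ⟨z, hi⟩
  gorenstein z := by
    obtain ⟨i, hi⟩ := T.exists_mem z
    exact ⟨_, T.isCanonicalGenerator hi⟩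
  canonical z R hR hRz ω hω := by
    obtain ⟨i, hi⟩ := T.exists_mem z
    exact T.mem_regularForms_of_valuation hi (fun a => R.mem_or_inv_mem a) (fun a ha => hRz a ha) hω
  ample z := by
    obtain ⟨j, hj⟩ := T.exists_mem z
    obtain ⟨s, hs⟩ := T.exists_section 1 (chartLeft x y j)⁻¹
    refine ⟨1, one_pos, s, (T.mem_antiCanonicalSections_iff hs).mpr ?_, T.chart j,
      T.isAffineOpen j, hj, T.nonvanishingAt_iff hs⟩
    rw [mem_antiCanonicalSpace]
    intro i
    rw [pow_one, ← div_eq_mul_inv]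
    exact T.coord.div_mem_chart i j
  degree_eq := by
    simp_rw [T.finrank_antiCanonicalSections]
    have h1 : Filter.Tendsto (fun m : ℕ => (4 : ℝ) + 4 * (1 / (m : ℝ)) + 2 * (1 / (m : ℝ)) ^ 2)
        Filter.atTop (nhds (4 + 4 * 0 + 2 * 0 ^ 2)) := by
      have h0 := tendsto_one_div_atTop_nhds_zero_nat (𝕜 := ℝ)
      exact (tendsto_const_nhds.add (h0.const_mul 4)).add ((h0.pow 2).const_mul 2)
    norm_num only [mul_zero, add_zero, zero_pow] at h1
    rw [Nat.cast_ofNat]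
    refine h1.congr' ?_
    filter_upwards [Filter.eventually_gt_atTop 0] with m hm
    have : (m : ℝ) ≠ 0 := by positivity
    push_cast
    field_simp
    ring

end IsToricDiamond

end ToricSurface

/-! ### The coordinate ring of `𝒳₂` -/

section CoordinateRing

open MvPolynomial

variable {k : Type u} [Field k] {P₁ P₂ : k × k}

/-- The coordinate functions `x, y, z₁, z₂` on `𝒳₂`. -/
def coordX2 (P₁ P₂ : k × k) (i : Fin 4) : RingX2 k P₁ P₂ := Ideal.Quotient.mk _ (X i)

lemma coordX2_rel_left : (coordX2 P₁ P₂ 0 - algebraMap k _ P₁.1) ^ 2 +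
    (coordX2 P₁ P₂ 1 - algebraMap k _ P₁.2) ^ 2 = coordX2 P₁ P₂ 2 ^ 2 := by
  have : (Ideal.Quotient.mk (idealX2 k P₁ P₂)) (distEq k P₁ 2) = 0 :=
    Ideal.Quotient.eq_zero_iff_mem.mpr (Ideal.subset_span (by simp))
  exact sub_eq_zero.mp this

lemma coordX2_rel_right : (coordX2 P₁ P₂ 0 - algebraMap k _ P₂.1) ^ 2 +
    (coordX2 P₁ P₂ 1 - algebraMap k _ P₂.2) ^ 2 = coordX2 P₁ P₂ 3 ^ 2 := by
  have : (Ideal.Quotient.mk (idealX2 k P₁ P₂)) (distEq k P₂ 3) = 0 :=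
    Ideal.Quotient.eq_zero_iff_mem.mpr (Ideal.subset_span (by simp))
  exact sub_eq_zero.mp this

/-- The homomorphism from the coordinate ring of `𝒳₂` given by a point of `𝒳₂` with values in a
`k`-algebra. -/
def evalX2 {B : Type*} [CommRing B] [Algebra k B] (v : Fin 4 → B)
    (h₁ : (v 0 - algebraMap k B P₁.1) ^ 2 + (v 1 - algebraMap k B P₁.2) ^ 2 = v 2 ^ 2)
    (h₂ : (v 0 - algebraMap k B P₂.1) ^ 2 + (v 1 - algebraMap k B P₂.2) ^ 2 = v 3 ^ 2) :
    RingX2 k P₁ P₂ →ₐ[k] B :=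
  Ideal.Quotient.liftₐ _ (aeval v) fun a ha => by
    have : idealX2 k P₁ P₂ ≤ RingHom.ker (aeval (R := k) v) := by
      refine Ideal.span_le.mpr ?_
      rintro p (rfl | rfl)
      · simp [distEq, h₁]
      · simp [distEq, h₂]
    exact this ha

@[simp]
lemma evalX2_coordX2 {B : Type*} [CommRing B] [Algebra k B] (v : Fin 4 → B) (h₁ h₂) (i : Fin 4) :
    evalX2 (P₁ := P₁) (P₂ := P₂) v h₁ h₂ (coordX2 P₁ P₂ i) = v i :=
  aeval_X v i

lemma algHom_ext_coordX2 {B : Type*} [CommRing B] [Algebra k B] {f g : RingX2 k P₁ P₂ →ₐ[k] B}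
    (h : ∀ i, f (coordX2 P₁ P₂ i) = g (coordX2 P₁ P₂ i)) : f = g := by
  refine Ideal.Quotient.algHom_ext _ (MvPolynomial.algHom_ext fun i => h i)

lemma adjoin_coordX2 : Algebra.adjoin k (Set.range (coordX2 P₁ P₂)) = ⊤ := by
  have h := congrArg (Subalgebra.map (Ideal.Quotient.mkₐ k (idealX2 k P₁ P₂)))
    (MvPolynomial.adjoin_range_X (R := k) (σ := Fin 4))
  rw [AlgHom.map_adjoin, ← Set.range_comp, Algebra.map_top,
    (AlgHom.range_eq_top _).mpr (Ideal.Quotient.mkₐ_surjective k _)] at h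
  exact h

/-- Nonzero polynomials in `x`, `y` are not zero divisors on `𝒳₂`: the coordinate ring of `𝒳₂` is
obtained from `k[x, y]` by adjoining a root of a monic polynomial twice, and so is free over
`k[x, y]`. -/
lemma mul_eq_zero_of_ne_zero {p : MvPolynomial (Fin 2) k} (hp : p ≠ 0) {r : RingX2 k P₁ P₂}
    (hr : aeval ![coordX2 P₁ P₂ 0, coordX2 P₁ P₂ 1] p * r = 0) : r = 0 := by
  let f (P : k × k) : MvPolynomial (Fin 2) k := (X 0 - C P.1) ^ 2 + (X 1 - C P.2) ^ 2
  let q₁ : Polynomial (MvPolynomial (Fin 2) k) := .X ^ 2 - .C (f P₁)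
  let R₁ := AdjoinRoot q₁
  let q₂ : Polynomial R₁ := .X ^ 2 - .C (algebraMap _ R₁ (f P₂))
  let R₂ := AdjoinRoot q₂
  have : Module.Free (MvPolynomial (Fin 2) k) R₁ :=
    (Polynomial.monic_X_pow_sub_C _ two_ne_zero).free_adjoinRoot
  have : Module.Free R₁ R₂ := (Polynomial.monic_X_pow_sub_C _ two_ne_zero).free_adjoinRoot
  have : IsScalarTower (MvPolynomial (Fin 2) k) R₁ R₂ := inferInstance
  have : Module.Free (MvPolynomial (Fin 2) k) R₂ := Module.Free.trans (S := R₁)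
  have e₁ : algebraMap (MvPolynomial (Fin 2) k) R₁ (f P₁) = AdjoinRoot.root q₁ ^ 2 := by
    have := AdjoinRoot.eval₂_root q₁
    simp only [q₁, Polynomial.eval₂_sub, Polynomial.eval₂_C, Polynomial.eval₂_X_pow] at this
    exact (sub_eq_zero.mp this).symm
  have e₂ : algebraMap (MvPolynomial (Fin 2) k) R₂ (f P₂) = AdjoinRoot.root q₂ ^ 2 := by
    have := AdjoinRoot.eval₂_root q₂
    simp only [q₂, Polynomial.eval₂_sub, Polynomial.eval₂_C, Polynomial.eval₂_X_pow] at this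
    exact (sub_eq_zero.mp this).symm
  let ι := algebraMap (MvPolynomial (Fin 2) k) R₂
  have hι (c : k) : ι (C c) = algebraMap k R₂ c := rfl
  let θ : RingX2 k P₁ P₂ →ₐ[k] R₂ := evalX2
    ![ι (X 0), ι (X 1), algebraMap R₁ R₂ (AdjoinRoot.root q₁), AdjoinRoot.root q₂]
    (by
      have := congrArg (algebraMap R₁ R₂) e₁
      rw [← IsScalarTower.algebraMap_apply, map_pow] at this
      simpa [f, ι, ← hι] using this)
    (by simpa [f, ι, ← hι] using e₂)
  let χ₀ : MvPolynomial (Fin 2) k →+* RingX2 k P₁ P₂ :=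
    (aeval ![coordX2 P₁ P₂ 0, coordX2 P₁ P₂ 1]).toRingHom
  let χ₁ : R₁ →+* RingX2 k P₁ P₂ := AdjoinRoot.lift χ₀ (coordX2 P₁ P₂ 2) (by
    simp only [q₁, Polynomial.eval₂_sub, Polynomial.eval₂_C, Polynomial.eval₂_X_pow]
    simp [f, χ₀, coordX2_rel_left])
  let χ₂ : R₂ →+* RingX2 k P₁ P₂ := AdjoinRoot.lift χ₁ (coordX2 P₁ P₂ 3) (by
    have : χ₁ (algebraMap _ R₁ (f P₂)) = χ₀ (f P₂) := AdjoinRoot.lift_of _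
    simp only [q₂, Polynomial.eval₂_sub, Polynomial.eval₂_C, Polynomial.eval₂_X_pow, this]
    simp [f, χ₀, coordX2_rel_right])
  have hχ (a) : χ₂ (ι a) = χ₀ a := by
    have h1 : χ₂ (algebraMap R₁ R₂ (algebraMap _ R₁ a)) = χ₁ (algebraMap _ R₁ a) :=
      AdjoinRoot.lift_of _
    exact h1.trans (AdjoinRoot.lift_of _)
  have hχθ (a) : χ₂ (θ a) = a := by
    let χ₂' : R₂ →ₐ[k] RingX2 k P₁ P₂ := { χ₂ with
      commutes' c := (hχ (C c)).trans (by simp [χ₀]) }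
    refine DFunLike.congr_fun (f := χ₂'.comp θ) (g := AlgHom.id k _)
      (algHom_ext_coordX2 fun i => ?_) a
    change χ₂ (θ (coordX2 P₁ P₂ i)) = coordX2 P₁ P₂ i
    fin_cases i
    · simpa [θ, χ₀] using hχ (X 0)
    · simpa [θ, χ₀] using hχ (X 1)
    · have h1 : χ₂ (algebraMap R₁ R₂ (AdjoinRoot.root q₁)) = χ₁ (AdjoinRoot.root q₁) :=
        AdjoinRoot.lift_of _
      simpa [θ] using h1.trans (AdjoinRoot.lift_root _)
    · have h1 : χ₂ (AdjoinRoot.root q₂) = coordX2 P₁ P₂ 3 := AdjoinRoot.lift_root _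
      exact (congrArg χ₂ (evalX2_coordX2 _ _ _ 3)).trans h1
  have hθ (a) : θ (χ₀ a) = ι a := by
    have : θ.comp (aeval ![coordX2 P₁ P₂ 0, coordX2 P₁ P₂ 1]) =
        IsScalarTower.toAlgHom k (MvPolynomial (Fin 2) k) R₂ := by
      refine MvPolynomial.algHom_ext fun i => ?_
      fin_cases i <;> simp [θ, ι]
    exact DFunLike.congr_fun this a
  have h0 : p • θ r = 0 := by
    rw [Algebra.smul_def]
    change ι p * _ = 0
    rw [← hθ, ← map_mul]
    exact (congrArg θ hr).trans (map_zero θ)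
  have : θ r = 0 := (smul_eq_zero.mp h0).resolve_left hp
  rw [← hχθ r, this, map_zero]

end CoordinateRing

/-! ### A parametrization of `𝒳₂` -/

section Parametrization

open MvPolynomial

variable {k : Type u} [Field k] (P₁ P₂ : k × k)

/-- The coefficient of `2 l` in the linear equation for `l` which says that `paramPoint` has the
right distance from `P₂`. -/
def paramDen : MvPolynomial (Fin 2) k :=
  X 1 * (1 + X 0 ^ 2) + C (P₂.1 - P₁.1) * (1 - X 0 ^ 2) + C (P₂.2 - P₁.2) * (2 * X 0)

/-- The constant term of the linear equation for `l`. -/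
def paramNum : MvPolynomial (Fin 2) k :=
  C ((P₂.1 - P₁.1) ^ 2 + (P₂.2 - P₁.2) ^ 2) - X 1 ^ 2

/-- The condition that `Q` is not on the line `P₁ P₂`. -/
def paramSlope : MvPolynomial (Fin 2) k :=
  C (P₂.1 - P₁.1) * (2 * X 0) - C (P₂.2 - P₁.2) * (1 - X 0 ^ 2)

/-- The product of the functions that have to be invertible on the domain of the parametrization. -/
def paramDisc : MvPolynomial (Fin 2) k :=
  X 0 * paramNum P₁ P₂ * paramDen P₁ P₂ * paramSlope P₁ P₂

/-- The equation in the `Q`-plane of the lines through `P₁` that are horizontal or pass through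
`P₂`. Over their complement the parametrization is an isomorphism. -/
def branchPoly : MvPolynomial (Fin 2) k :=
  (X 1 - C P₁.2) *
    (C (P₂.1 - P₁.1) * (X 1 - C P₁.2) - C (P₂.2 - P₁.2) * (X 0 - C P₁.1))

/-- The function `branchPoly` on `𝒳₂`. -/
def branchX2 : RingX2 k P₁ P₂ := aeval ![coordX2 P₁ P₂ 0, coordX2 P₁ P₂ 1] (branchPoly P₁ P₂)

variable {P₁ P₂}

lemma branchPoly_ne_zero (hP : P₁ ≠ P₂) : branchPoly P₁ P₂ ≠ 0 := by
  refine mul_ne_zero ?_ ?_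
  · intro h
    have h1 := congrArg (eval ![0, P₁.2 + 1]) h
    simp at h1
  · intro h
    have h1 := congrArg (eval ![P₁.1, P₁.2 + 1]) h
    have h2 := congrArg (eval ![P₁.1 + 1, P₁.2]) h
    simp at h1 h2
    exact hP (Prod.ext (sub_eq_zero.mp h1).symm (sub_eq_zero.mp h2))

lemma paramDisc_ne_zero [CharZero k] (hP : P₁ ≠ P₂) : paramDisc P₁ P₂ ≠ 0 := by
  refine mul_ne_zero (mul_ne_zero (mul_ne_zero (X_ne_zero _) ?_) ?_) ?_
  · intro h
    have h1 := congrArg (eval ![0, 0]) h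
    have h2 := congrArg (eval ![0, 1]) h
    simp [paramNum] at h1 h2
    rw [h1] at h2
    simp at h2
  · intro h
    have h1 := congrArg (eval ![0, 0]) h
    have h2 := congrArg (eval ![0, 1]) h
    simp [paramDen] at h1 h2
    rw [h1] at h2
    simp at h2
  · intro h
    have h1 := congrArg (eval ![0, 0]) h
    have h2 := congrArg (eval ![1, 0]) h
    simp [paramSlope] at h1 h2
    exact hP (Prod.ext (sub_eq_zero.mp h2).symm (sub_eq_zero.mp h1))

variable {B : Type*} [CommRing B] [Algebra k B]

/-- The point of `𝒳₂` on the line of slope `2 m / (1 - m²)` through `P₁`, at the distance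
`l (1 + m²)` from it, with difference of the distances `n`. -/
def paramPoint (P₁ : k × k) (m n l : B) : Fin 4 → B :=
  ![algebraMap k B P₁.1 + l * (1 - m ^ 2), algebraMap k B P₁.2 + 2 * m * l, l * (1 + m ^ 2),
    l * (1 + m ^ 2) + n]

lemma map_paramPoint {C : Type*} [CommRing C] [Algebra k C] (f : B →ₐ[k] C) (m n l : B)
    (i : Fin 4) : f (paramPoint P₁ m n l i) = paramPoint P₁ (f m) (f n) (f l) i := by
  fin_cases i <;> simp [paramPoint, map_ofNat]

lemma paramPoint_rel_left (m n l : B) :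
    (paramPoint P₁ m n l 0 - algebraMap k B P₁.1) ^ 2 +
      (paramPoint P₁ m n l 1 - algebraMap k B P₁.2) ^ 2 = paramPoint P₁ m n l 2 ^ 2 := by
  simp [paramPoint]; ring

lemma paramPoint_rel_right {m n l : B}
    (h : 2 * l * aeval ![m, n] (paramDen P₁ P₂) = aeval ![m, n] (paramNum P₁ P₂)) :
    (paramPoint P₁ m n l 0 - algebraMap k B P₂.1) ^ 2 +
      (paramPoint P₁ m n l 1 - algebraMap k B P₂.2) ^ 2 = paramPoint P₁ m n l 3 ^ 2 := by
  simp [paramDen, paramNum] at h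
  simp [paramPoint]
  linear_combination -h

lemma aeval_paramDisc (v : Fin 2 → B) : aeval v (paramDisc P₁ P₂) =
    v 0 * aeval v (paramNum P₁ P₂) * aeval v (paramDen P₁ P₂) * aeval v (paramSlope P₁ P₂) := by
  simp [paramDisc]

/-- The value of a homomorphism at `branchX2`. -/
lemma map_branchX2 (f : RingX2 k P₁ P₂ →ₐ[k] B) : f (branchX2 P₁ P₂) =
    (f (coordX2 P₁ P₂ 1) - algebraMap k B P₁.2) *
    (algebraMap k B (P₂.1 - P₁.1) * (f (coordX2 P₁ P₂ 1) - algebraMap k B P₁.2) -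
      algebraMap k B (P₂.2 - P₁.2) * (f (coordX2 P₁ P₂ 0) - algebraMap k B P₁.1)) := by
  simp [branchX2, branchPoly]

/-- At a point of `𝒳₂` where `branchX2` is invertible the parameters can be recovered. -/
lemma param_of_isUnit [CharZero k] (f : RingX2 k P₁ P₂ →ₐ[k] B) (hf : IsUnit (f (branchX2 P₁ P₂))) :
    ∃ m n l : B, IsUnit (aeval ![m, n] (paramDisc P₁ P₂)) ∧
      2 * l * aeval ![m, n] (paramDen P₁ P₂) = aeval ![m, n] (paramNum P₁ P₂) ∧
      ∀ i, f (coordX2 P₁ P₂ i) = paramPoint P₁ m n l i := by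
  have r1 := congrArg f (coordX2_rel_left (P₁ := P₁) (P₂ := P₂))
  have r2 := congrArg f (coordX2_rel_right (P₁ := P₁) (P₂ := P₂))
  have h2 : IsUnit (algebraMap k B 2) := (isUnit_iff_ne_zero.mpr two_ne_zero).map _
  rw [map_branchX2, IsUnit.mul_iff] at hf
  obtain ⟨⟨u, hu⟩, hs⟩ := hf
  obtain ⟨c, hc⟩ : ∃ c : B, 2 * c = 1 := ⟨algebraMap k B 2⁻¹, by
    rw [← map_ofNat (algebraMap k B) 2, ← map_mul]; simp⟩
  simp only [map_add, map_sub, map_pow, AlgHom.commutes] at r1 r2 hs hu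
  set x := f (coordX2 P₁ P₂ 0)
  set y := f (coordX2 P₁ P₂ 1)
  set z := f (coordX2 P₁ P₂ 2)
  set w := f (coordX2 P₁ P₂ 3)
  set a₁ := algebraMap k B P₁.1
  set b₁ := algebraMap k B P₁.2
  set a₂ := algebraMap k B P₂.1
  set b₂ := algebraMap k B P₂.2
  set m : B := (z - (x - a₁)) * u⁻¹.1
  have hm : m * (y - b₁) = z - (x - a₁) := by rw [← hu]; simp [m]
  have hm' : m * (z + (x - a₁)) = y - b₁ := by
    refine u.isUnit.mul_left_cancel ?_
    rw [hu]
    linear_combination (z + (x - a₁)) * hm - r1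
  have hden : (z + (x - a₁)) * aeval ![m, w - z] (paramDen P₁ P₂) =
      aeval ![m, w - z] (paramNum P₁ P₂) := by
    simp [paramDen, paramNum]
    linear_combination (m * (w - z - (a₂ - a₁)) + 2 * (b₂ - b₁)) * hm' +
      (w - z - (a₂ - a₁)) * hm + r1 - r2
  have hslope : (z + (x - a₁)) * aeval ![m, w - z] (paramSlope P₁ P₂) =
      2 * ((a₂ - a₁) * (y - b₁) - (b₂ - b₁) * (x - a₁)) := by
    simp [paramSlope]
    linear_combination (m * (b₂ - b₁) + 2 * (a₂ - a₁)) * hm' + (b₂ - b₁) * hm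
  have hnum : aeval ![m, w - z] (paramNum P₁ P₂) *
      ((a₂ - a₁) ^ 2 + (b₂ - b₁) ^ 2 - (w + z) ^ 2) =
      - (2 * ((a₂ - a₁) * (y - b₁) - (b₂ - b₁) * (x - a₁))) ^ 2 := by
    simp [paramNum]
    linear_combination 2 * ((a₂ - a₁) ^ 2 + (b₂ - b₁) ^ 2) * (r1 + r2) - (w ^ 2 - z ^ 2 +
      ((x - a₂) ^ 2 + (y - b₂) ^ 2) - ((x - a₁) ^ 2 + (y - b₁) ^ 2)) * (r2 - r1)
  have hs2 : IsUnit (2 * ((a₂ - a₁) * (y - b₁) - (b₂ - b₁) * (x - a₁))) :=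
    (IsUnit.of_mul_eq_one _ hc).mul hs
  have hun : IsUnit (aeval ![m, w - z] (paramNum P₁ P₂)) :=
    isUnit_of_mul_isUnit_left (hnum ▸ (hs2.pow 2).neg)
  refine ⟨m, w - z, c * (z + (x - a₁)), ?_, ?_, ?_⟩
  · rw [aeval_paramDisc]
    refine ((IsUnit.mul ?_ hun).mul ?_).mul ?_
    · exact isUnit_of_mul_isUnit_left (hm' ▸ hu ▸ u.isUnit)
    · exact isUnit_of_mul_isUnit_right (hden ▸ hun)
    · exact isUnit_of_mul_isUnit_right (hslope ▸ hs2)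
  · rw [← hden]
    linear_combination (z + (x - a₁)) * aeval ![m, w - z] (paramDen P₁ P₂) * hc
  · have e1 : c * (z + (x - a₁)) * (1 - m ^ 2) = x - a₁ := by
      linear_combination (x - a₁) * hc - c * m * hm' - c * hm
    have e2 : c * (z + (x - a₁)) * (1 + m ^ 2) = z := by
      linear_combination z * hc + c * m * hm' + c * hm
    intro i
    fin_cases i
    · simp only [paramPoint]
      change x = _ + _
      rw [e1]; ring
    · change y = _
      simp only [paramPoint]
      change y = b₁ + 2 * m * _
      linear_combination (b₁ - y) * hc - 2 * c * hm'
    · exact e2.symm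
    · change w = _ + (w - z)
      rw [e2]; ring

variable (P₁ P₂)

/-- The coordinate ring of the open subset of the parameter plane that is isomorphic to an open
subset of `𝒳₂`. -/
abbrev ParamRing : Type u := Localization.Away (paramDisc P₁ P₂)

/-- The functions `m` and `n` on the parameter space. -/
def paramCoord (i : Fin 2) : ParamRing P₁ P₂ := algebraMap _ _ (X i : MvPolynomial (Fin 2) k)

variable {P₁ P₂}

lemma aeval_paramCoord (p : MvPolynomial (Fin 2) k) :
    aeval (paramCoord P₁ P₂) p = algebraMap _ (ParamRing P₁ P₂) p := by
  have : aeval (paramCoord P₁ P₂) =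
      IsScalarTower.toAlgHom k (MvPolynomial (Fin 2) k) (ParamRing P₁ P₂) :=
    MvPolynomial.algHom_ext fun i => by simp [paramCoord]
  exact DFunLike.congr_fun this p

lemma aeval_paramCoord' (p : MvPolynomial (Fin 2) k) :
    aeval ![paramCoord P₁ P₂ 0, paramCoord P₁ P₂ 1] p = algebraMap _ (ParamRing P₁ P₂) p := by
  rw [← aeval_paramCoord]
  congr 2
  ext i
  fin_cases i <;> rfl

lemma isUnit_two (k B : Type*) [Field k] [CharZero k] [CommRing B] [Algebra k B] :
    IsUnit (2 : B) := by
  rw [← map_ofNat (algebraMap k B) 2]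
  exact (isUnit_iff_ne_zero.mpr two_ne_zero).map _

lemma isUnit_algebraMap_param : IsUnit (paramCoord P₁ P₂ 0) ∧
    IsUnit (algebraMap _ (ParamRing P₁ P₂) (paramNum P₁ P₂)) ∧
    IsUnit (algebraMap _ (ParamRing P₁ P₂) (paramDen P₁ P₂)) ∧
    IsUnit (algebraMap _ (ParamRing P₁ P₂) (paramSlope P₁ P₂)) := by
  have hu : IsUnit (algebraMap _ (ParamRing P₁ P₂) (paramDisc P₁ P₂)) :=
    IsLocalization.Away.algebraMap_isUnit _
  simp only [← aeval_paramCoord] at hu ⊢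
  simpa only [aeval_paramDisc, IsUnit.mul_iff, and_assoc] using hu

lemma exists_paramScale [CharZero k] : ∃ l : ParamRing P₁ P₂,
    2 * l * algebraMap _ _ (paramDen P₁ P₂) = algebraMap _ _ (paramNum P₁ P₂) ∧ IsUnit l := by
  obtain ⟨-, hn, ⟨d, hd⟩, -⟩ := isUnit_algebraMap_param (P₁ := P₁) (P₂ := P₂)
  obtain ⟨c, hc⟩ := isUnit_two k (ParamRing P₁ P₂)
  refine ⟨c⁻¹.1 * algebraMap _ _ (paramNum P₁ P₂) * d⁻¹.1, ?_,
    (c⁻¹.isUnit.mul hn).mul d⁻¹.isUnit⟩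
  have h1 := d.inv_mul
  have h2 := c.inv_mul
  rw [← hd, ← hc]
  linear_combination algebraMap _ (ParamRing P₁ P₂) (paramNum P₁ P₂) * (h2 +
    c⁻¹.1 * c.1 * h1)

variable (P₁ P₂)

/-- The factor `l` of the parametrization, as a function of `m` and `n`. -/
def paramScale [CharZero k] : ParamRing P₁ P₂ := exists_paramScale.choose

lemma paramScale_mul [CharZero k] : 2 * paramScale P₁ P₂ * algebraMap _ _ (paramDen P₁ P₂) =
    algebraMap _ _ (paramNum P₁ P₂) :=
  exists_paramScale.choose_spec.1

lemma isUnit_paramScale [CharZero k] : IsUnit (paramScale P₁ P₂) :=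
  exists_paramScale.choose_spec.2

/-- The parametrization of `𝒳₂`, as a homomorphism of rings of functions. -/
def paramX2 [CharZero k] : RingX2 k P₁ P₂ →ₐ[k] ParamRing P₁ P₂ :=
  evalX2 (paramPoint P₁ (paramCoord P₁ P₂ 0) (paramCoord P₁ P₂ 1) (paramScale P₁ P₂))
    (paramPoint_rel_left _ _ _) (paramPoint_rel_right (by
      simpa only [aeval_paramCoord'] using paramScale_mul P₁ P₂))

variable {P₁ P₂} [CharZero k]

lemma paramX2_coordX2 (i : Fin 4) : paramX2 P₁ P₂ (coordX2 P₁ P₂ i) =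
    paramPoint P₁ (paramCoord P₁ P₂ 0) (paramCoord P₁ P₂ 1) (paramScale P₁ P₂) i :=
  evalX2_coordX2 _ _ _ i

lemma isUnit_paramX2_branchX2 : IsUnit (paramX2 P₁ P₂ (branchX2 P₁ P₂)) := by
  obtain ⟨hm, -, -, hs⟩ := isUnit_algebraMap_param (P₁ := P₁) (P₂ := P₂)
  rw [map_branchX2]
  simp only [paramX2_coordX2]
  refine Eq.subst (motive := fun z => IsUnit z) ?_
    ((((isUnit_two k _).mul hm).mul ((isUnit_paramScale P₁ P₂).pow 2)).mul hs)
  rw [← aeval_paramCoord]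
  simp [paramPoint, paramSlope]
  ring

/-- The parametrization identifies an open subset of the parameter plane with the nonvanishing
locus of `branchX2` on `𝒳₂`. -/
lemma isLocalization_paramX2 :
    @IsLocalization.Away _ _ (branchX2 P₁ P₂) (ParamRing P₁ P₂) _ (paramX2 P₁ P₂).toAlgebra := by
  let _ : Algebra (RingX2 k P₁ P₂) (ParamRing P₁ P₂) := (paramX2 P₁ P₂).toAlgebra
  have : IsScalarTower k (RingX2 k P₁ P₂) (ParamRing P₁ P₂) :=
    IsScalarTower.of_algHom (paramX2 P₁ P₂)
  let R := Localization.Away (branchX2 P₁ P₂)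
  let ι : RingX2 k P₁ P₂ →ₐ[k] R := IsScalarTower.toAlgHom k _ R
  obtain ⟨m, n, l, hu, hl, hi⟩ := param_of_isUnit ι (IsLocalization.Away.algebraMap_isUnit _)
  let φ : R →ₐ[RingX2 k P₁ P₂] ParamRing P₁ P₂ :=
    IsLocalization.liftAlgHom (M := Submonoid.powers (branchX2 P₁ P₂))
      (f := Algebra.ofId (RingX2 k P₁ P₂) (ParamRing P₁ P₂)) (by
        rintro ⟨_, N, rfl⟩
        exact (map_pow (paramX2 P₁ P₂) _ N).symm ▸ isUnit_paramX2_branchX2.pow N)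
  let ψ : ParamRing P₁ P₂ →ₐ[k] R :=
    IsLocalization.liftAlgHom (M := Submonoid.powers (paramDisc P₁ P₂))
      (f := aeval ![m, n]) (by
        rintro ⟨_, N, rfl⟩
        simpa using hu.pow N)
  have hψ (p) : ψ (algebraMap _ _ p) = aeval ![m, n] p := IsLocalization.lift_eq _ p
  have hφ (a) : φ (ι a) = paramX2 P₁ P₂ a := IsLocalization.lift_eq _ a
  have hψm : ψ (paramCoord P₁ P₂ 0) = m := by simp [paramCoord, hψ]
  have hψn : ψ (paramCoord P₁ P₂ 1) = n := by simp [paramCoord, hψ]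
  have hψl : ψ (paramScale P₁ P₂) = l := by
    have h1 := congrArg ψ (paramScale_mul P₁ P₂)
    rw [map_mul, map_mul, hψ, hψ, map_ofNat, ← hl] at h1
    rw [aeval_paramDisc, IsUnit.mul_iff, IsUnit.mul_iff] at hu
    exact (isUnit_two k R).mul_left_cancel (hu.1.2.mul_right_cancel h1)
  have hp (i) := (congrArg (φ.restrictScalars k) (hi i)).symm
  simp only [map_paramPoint] at hp
  have hp' (i) := (hp i).trans ((hφ _).trans (paramX2_coordX2 i))
  have h0 := hp' 0
  have h1 := hp' 1
  have h2'' := hp' 2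
  have h3 := hp' 3
  simp only [AlgHom.coe_restrictScalars', paramPoint, Matrix.cons_val] at h0 h1 h2'' h3
  have hφn : φ n = paramCoord P₁ P₂ 1 := by linear_combination h3 - h2''
  have hφl : φ l = paramScale P₁ P₂ := by
    refine (isUnit_two k _).mul_left_cancel ?_
    linear_combination h0 + h2''
  have hφm : φ m = paramCoord P₁ P₂ 0 := by
    refine ((isUnit_two k _).mul (isUnit_paramScale P₁ P₂)).mul_left_cancel ?_
    change 2 * paramScale P₁ P₂ * _ = 2 * paramScale P₁ P₂ * _
    rw [hφl] at h1
    linear_combination h1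
  have hφψ : (φ.restrictScalars k).comp ψ = AlgHom.id k _ := by
    refine IsLocalization.algHom_ext (Submonoid.powers (paramDisc P₁ P₂)) ?_
    refine MvPolynomial.algHom_ext fun i => ?_
    change φ (ψ (paramCoord P₁ P₂ i)) = paramCoord P₁ P₂ i
    fin_cases i
    · exact (congrArg φ hψm).trans hφm
    · exact (congrArg φ hψn).trans hφn
  have hψφ : ψ.comp (φ.restrictScalars k) = AlgHom.id k _ := by
    refine IsLocalization.algHom_ext (Submonoid.powers (branchX2 P₁ P₂)) ?_
    refine algHom_ext_coordX2 fun i => ?_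
    change ψ (φ (ι (coordX2 P₁ P₂ i))) = ι (coordX2 P₁ P₂ i)
    rw [hφ, paramX2_coordX2, map_paramPoint, hψm, hψn, hψl, hi]
  exact IsLocalization.isLocalization_of_algEquiv _ (AlgEquiv.ofBijective φ
    ⟨fun a b h => by
      rw [← AlgHom.id_apply (R := k) a, ← AlgHom.id_apply (R := k) b, ← hψφ]
      exact congrArg ψ h,
    fun a => ⟨ψ a, DFunLike.congr_fun hφψ a⟩⟩)

end Parametrization

/-! ### Rationality of `𝒳₂` and density of its rational points -/

section Rationality

open MvPolynomial

variable {k : Type u} [Field k]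

/-- A principal localization of a domain gives a dominant open immersion. -/
lemma birationalOver_of_isLocalization {A B : Type u} [CommRing A] [CommRing B]
    [Algebra k A] [Algebra k B] (f : A →ₐ[k] B) (hf : Function.Injective f) (a : A)
    (h : @IsLocalization.Away A _ a B _ f.toAlgebra) :
    Scheme.BirationalOver (Spec.map (CommRingCat.ofHom (algebraMap k B)))
      (Spec.map (CommRingCat.ofHom (algebraMap k A))) := by
  let _ : Algebra A B := f.toAlgebra
  have : IsOpenImmersion (Spec.map (CommRingCat.ofHom f.toRingHom)) :=
    IsOpenImmersion.of_isLocalization (S := B) a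
  have : IsDominant (Spec.map (CommRingCat.ofHom f.toRingHom)) := by
    refine ⟨(PrimeSpectrum.denseRange_comap_iff_ker_le_nilRadical f.toRingHom).mpr ?_⟩
    rw [(RingHom.injective_iff_ker_eq_bot f.toRingHom).mp hf]
    exact bot_le
  refine (Spec.map (CommRingCat.ofHom f.toRingHom)).birationalOver _ _ ?_
  rw [← Spec.map_comp, ← CommRingCat.ofHom_comp]
  congr 2
  exact f.comp_algebraMap

lemma trdeg_eq_of_isLocalization {A B : Type u} [CommRing A] [CommRing B] [IsDomain A] [IsDomain B]
    [Algebra k A] [Algebra k B] [Algebra A B] [IsScalarTower k A B] [FaithfulSMul A B]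
    (M : Submonoid A) [IsLocalization M B] : Algebra.trdeg k A = Algebra.trdeg k B := by
  have := IsLocalization.isAlgebraic B M
  rw [← trdeg_add_eq (R := k) (S := A) (A := B),
    trdeg_eq_zero (R := A) (A := B), add_zero]

variable [CharZero k] {P₁ P₂ : k × k}

lemma paramX2_injective (hP : P₁ ≠ P₂) : Function.Injective (paramX2 P₁ P₂) := by
  let _ : Algebra (RingX2 k P₁ P₂) (ParamRing P₁ P₂) := (paramX2 P₁ P₂).toAlgebra
  have : IsLocalization.Away (branchX2 P₁ P₂) (ParamRing P₁ P₂) := isLocalization_paramX2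
  refine IsLocalization.injective (M := Submonoid.powers (branchX2 P₁ P₂)) (ParamRing P₁ P₂) ?_
  rw [Submonoid.powers_le, mem_nonZeroDivisors_iff_left]
  exact fun r hr => mul_eq_zero_of_ne_zero (branchPoly_ne_zero hP) hr

lemma isDomain_paramRing (hP : P₁ ≠ P₂) : IsDomain (ParamRing P₁ P₂) :=
  IsLocalization.isDomain_localization (by
    rw [Submonoid.powers_le]
    exact mem_nonZeroDivisors_of_ne_zero (paramDisc_ne_zero hP))

lemma isDomain_ringX2 (hP : P₁ ≠ P₂) : IsDomain (RingX2 k P₁ P₂) :=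
  have := isDomain_paramRing hP
  (paramX2_injective hP).isDomain (paramX2 P₁ P₂).toRingHom

lemma trdeg_ringX2 (hP : P₁ ≠ P₂) : Algebra.trdeg k (RingX2 k P₁ P₂) = 2 := by
  have := isDomain_ringX2 hP
  have := isDomain_paramRing hP
  let _ : Algebra (RingX2 k P₁ P₂) (ParamRing P₁ P₂) := (paramX2 P₁ P₂).toAlgebra
  have : IsScalarTower k (RingX2 k P₁ P₂) (ParamRing P₁ P₂) :=
    IsScalarTower.of_algHom (paramX2 P₁ P₂)
  have : IsLocalization.Away (branchX2 P₁ P₂) (ParamRing P₁ P₂) := isLocalization_paramX2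
  have : FaithfulSMul (RingX2 k P₁ P₂) (ParamRing P₁ P₂) :=
    (faithfulSMul_iff_algebraMap_injective _ _).mpr (paramX2_injective hP)
  have : FaithfulSMul (MvPolynomial (Fin 2) k) (ParamRing P₁ P₂) :=
    (faithfulSMul_iff_algebraMap_injective _ _).mpr
      (IsLocalization.injective (M := Submonoid.powers (paramDisc P₁ P₂)) _ (by
        rw [Submonoid.powers_le]
        exact mem_nonZeroDivisors_of_ne_zero (paramDisc_ne_zero hP)))
  rw [trdeg_eq_of_isLocalization (k := k) (B := ParamRing P₁ P₂)
    (Submonoid.powers (branchX2 P₁ P₂)), ← trdeg_eq_of_isLocalization (k := k)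
    (A := MvPolynomial (Fin 2) k) (Submonoid.powers (paramDisc P₁ P₂)),
    MvPolynomial.trdeg_of_isDomain]
  simp

lemma birationalOver_affineSpace (k : Type) [Field k] [CharZero k] {P₁ P₂ : k × k} (hP : P₁ ≠ P₂) :
    Scheme.BirationalOver (X2.toBase k P₁ P₂)
      (AffineSpace (Fin 2) (Spec (.of k)) ↘ Spec (.of k)) := by
  have h1 : Scheme.BirationalOver (Spec.map (CommRingCat.ofHom (algebraMap k (ParamRing P₁ P₂))))
      (X2.toBase k P₁ P₂) :=
    birationalOver_of_isLocalization (paramX2 P₁ P₂) (paramX2_injective hP) _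
      isLocalization_paramX2
  have h2 : Scheme.BirationalOver (Spec.map (CommRingCat.ofHom (algebraMap k (ParamRing P₁ P₂))))
      (Spec.map (CommRingCat.ofHom (algebraMap k (MvPolynomial (Fin 2) k)))) := by
    refine birationalOver_of_isLocalization
      (IsScalarTower.toAlgHom k (MvPolynomial (Fin 2) k) (ParamRing P₁ P₂)) ?_ (paramDisc P₁ P₂) ?_
    · exact IsLocalization.injective (M := Submonoid.powers (paramDisc P₁ P₂)) _ (by
        rw [Submonoid.powers_le]
        exact mem_nonZeroDivisors_of_ne_zero (paramDisc_ne_zero hP))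
    · have : (IsScalarTower.toAlgHom k (MvPolynomial (Fin 2) k) (ParamRing P₁ P₂)).toAlgebra =
          OreLocalization.instAlgebra := Algebra.algebra_ext _ _ fun _ => rfl
      rw [this]
      infer_instance
  refine h1.symm.trans (h2.trans ?_)
  exact Scheme.Hom.birationalOver (AffineSpace.SpecIso (Fin 2) (.of k)).inv _ _
    (AffineSpace.SpecIso_inv_over _)

lemma mem_pointsX2_iff {k : Type*} [Field k] {P₁ P₂ : k × k} (v : Fin 4 → k) :
    v ∈ pointsX2 k P₁ P₂ ↔ (v 0 - P₁.1) ^ 2 + (v 1 - P₁.2) ^ 2 = v 2 ^ 2 ∧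
      (v 0 - P₂.1) ^ 2 + (v 1 - P₂.2) ^ 2 = v 3 ^ 2 := by
  rw [pointsX2, idealX2, zeroLocus_span]
  simp [distEq, sub_eq_zero]

/-- The evaluation of functions at a point of the parameter plane. -/
lemma exists_eval_paramRing (x : Fin 2 → k) (hx : eval x (paramDisc P₁ P₂) ≠ 0) (l : k)
    (hl : 2 * l * aeval x (paramDen P₁ P₂) = aeval x (paramNum P₁ P₂)) :
    ∃ ev : ParamRing P₁ P₂ →ₐ[k] k,
      (∀ p, ev (algebraMap (MvPolynomial (Fin 2) k) _ p) = aeval x p) ∧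
      ∀ p, ev (paramX2 P₁ P₂ (Ideal.Quotient.mk _ p)) =
        aeval (paramPoint P₁ (x 0) (x 1) l) p := by
  let ev : ParamRing P₁ P₂ →ₐ[k] k := IsLocalization.liftAlgHom
    (M := Submonoid.powers (paramDisc P₁ P₂)) (f := aeval x) (by
      rintro ⟨_, N, rfl⟩
      simpa using fun h => absurd h hx)
  have hev (p : MvPolynomial (Fin 2) k) : ev (algebraMap _ _ p) = aeval x p :=
    IsLocalization.lift_eq _ p
  have hls : ev (paramScale P₁ P₂) = l := by
    have h1 := congrArg ev (paramScale_mul P₁ P₂)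
    rw [map_mul, map_mul, map_ofNat, hev, hev, ← hl] at h1
    have hx' : aeval x (paramDisc P₁ P₂) ≠ 0 := hx
    rw [aeval_paramDisc] at hx'
    exact mul_left_cancel₀ (two_ne_zero (α := k))
      (mul_right_cancel₀ (right_ne_zero_of_mul (left_ne_zero_of_mul hx')) h1)
  refine ⟨ev, hev, fun p => ?_⟩
  have : (ev.comp (paramX2 P₁ P₂)).comp (Ideal.Quotient.mkₐ k _) =
      aeval (paramPoint P₁ (x 0) (x 1) l) := by
    refine MvPolynomial.algHom_ext fun i => ?_
    rw [aeval_X]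
    change ev (paramX2 P₁ P₂ (coordX2 P₁ P₂ i)) = _
    have e0 : ev (paramCoord P₁ P₂ 0) = x 0 := by simp [paramCoord, hev]
    have e1 : ev (paramCoord P₁ P₂ 1) = x 1 := by simp [paramCoord, hev]
    rw [paramX2_coordX2, map_paramPoint, e0, e1, hls]
  exact DFunLike.congr_fun this p

/-- A polynomial that vanishes on the `k`-rational points of `𝒳₂` vanishes on `𝒳₂`: composed with
the parametrization, it vanishes at the `k`-rational points of the plane. -/
lemma zeroLocus_vanishingIdeal_pointsX2 {K : Type*} [Field K] [Algebra k K] (hP : P₁ ≠ P₂)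
    {Q₁ Q₂ : K × K} (h₁ : (algebraMap k K P₁.1, algebraMap k K P₁.2) = Q₁)
    (h₂ : (algebraMap k K P₂.1, algebraMap k K P₂.2) = Q₂) :
    zeroLocus K (vanishingIdeal K ((fun q : Fin 4 → k => fun i => algebraMap k K (q i)) ''
      pointsX2 k P₁ P₂)) = pointsX2 K Q₁ Q₂ := by
  have : CharZero K := charZero_of_injective_algebraMap (algebraMap k K).injective
  have hQ : Q₁ ≠ Q₂ := by
    rintro rfl
    rw [Prod.ext_iff] at h₂
    have e := (algebraMap k K).injective
    have e1 := congrArg Prod.fst h₁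
    have e2 := congrArg Prod.snd h₁
    exact hP (Prod.ext (e (e1.trans h₂.1.symm)) (e (e2.trans h₂.2.symm)))
  have key (p : MvPolynomial (Fin 4) K)
      (hp : ∀ q ∈ pointsX2 k P₁ P₂, aeval (fun i => algebraMap k K (q i)) p = 0) :
      p ∈ idealX2 K Q₁ Q₂ := by
    rw [← Ideal.Quotient.eq_zero_iff_mem]
    refine paramX2_injective hQ ?_
    rw [map_zero]
    obtain ⟨⟨q, ⟨_, N, rfl⟩⟩, hq⟩ := IsLocalization.surj (Submonoid.powers (paramDisc Q₁ Q₂))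
      (paramX2 Q₁ Q₂ (Ideal.Quotient.mk _ p))
    have hq0 : q * paramDisc Q₁ Q₂ = 0 := by
      refine MvPolynomial.funext_set (fun _ => Set.range (algebraMap k K)) (fun _ =>
        Set.infinite_range_of_injective (algebraMap k K).injective) fun x hx => ?_
      choose y hy using fun i => hx i trivial
      rw [map_mul, map_zero]
      by_cases hg : eval x (paramDisc Q₁ Q₂) = 0
      · rw [hg, mul_zero]
      have hg' : aeval x (paramDisc Q₁ Q₂) ≠ 0 := hg
      have hxy : x = ![algebraMap k K (y 0), algebraMap k K (y 1)] := by
        ext i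
        fin_cases i <;> simp [hy]
      rw [aeval_paramDisc] at hg'
      have hden := right_ne_zero_of_mul (left_ne_zero_of_mul hg')
      have hd : aeval x (paramDen Q₁ Q₂) = algebraMap k K (aeval y (paramDen P₁ P₂)) := by
        rw [hxy, ← h₁, ← h₂]
        simp [paramDen, map_ofNat]
      have hn : aeval x (paramNum Q₁ Q₂) = algebraMap k K (aeval y (paramNum P₁ P₂)) := by
        rw [hxy, ← h₁, ← h₂]
        simp [paramNum]
      have hden' : aeval y (paramDen P₁ P₂) ≠ 0 := by
        intro h
        rw [hd, h, map_zero] at hden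
        exact hden rfl
      obtain ⟨l, hl⟩ : ∃ l : k, 2 * l * aeval y (paramDen P₁ P₂) = aeval y (paramNum P₁ P₂) :=
        ⟨aeval y (paramNum P₁ P₂) / (2 * aeval y (paramDen P₁ P₂)), by field_simp⟩
      obtain ⟨ev, hev, hev'⟩ := exists_eval_paramRing (P₁ := Q₁) (P₂ := Q₂) x hg
        (algebraMap k K l) (by rw [hd, hn, ← hl]; simp [map_ofNat])
      have hyv : ![y 0, y 1] = y := by
        ext i
        fin_cases i <;> rfl
      have hpt : paramPoint P₁ (y 0) (y 1) l ∈ pointsX2 k P₁ P₂ :=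
        (mem_pointsX2_iff _).mpr ⟨paramPoint_rel_left _ _ _,
          paramPoint_rel_right (by rw [hyv]; exact hl)⟩
      have hpt' : (fun i => algebraMap k K (paramPoint P₁ (y 0) (y 1) l i)) =
          paramPoint Q₁ (x 0) (x 1) (algebraMap k K l) := by
        rw [← h₁, hxy]
        ext i
        fin_cases i <;> simp [paramPoint, map_ofNat]
      have := congrArg ev hq
      rw [map_mul, hev', ← hpt', hp _ hpt, zero_mul, hev] at this
      change aeval x q * _ = 0
      rw [← this, zero_mul]
    have hq1 : q = 0 := (mul_eq_zero.mp hq0).resolve_right (paramDisc_ne_zero hQ)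
    rw [hq1, map_zero] at hq
    exact ((IsLocalization.map_units (ParamRing Q₁ Q₂)
      (⟨_, N, rfl⟩ : Submonoid.powers (paramDisc Q₁ Q₂))).mul_left_eq_zero).mp hq
  refine Set.Subset.antisymm (zeroLocus_anti_mono ?_) ?_
  · refine Ideal.span_le.mpr ?_
    rintro _ (rfl | rfl) _ ⟨q, hq, rfl⟩
    all_goals
      have := (mem_pointsX2_iff q).mp hq
      simp only [distEq, map_sub, map_add, map_pow, aeval_X, aeval_C, Algebra.algebraMap_self,
        RingHom.id_apply, ← h₁, ← h₂]
      simp only [← map_sub, ← map_add, ← map_pow, this, sub_self]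
  · intro x hx p hp
    exact hx p (key p fun q hq => hp _ ⟨q, hq, rfl⟩)

end Rationality

/-! ### Morphisms to `Proj` -/

section MapsToProj

open HomogeneousLocalization

variable {A σ : Type u} [CommRing A] [SetLike σ A] [AddSubgroupClass σ A] (𝒜 : ℕ → σ)
  [GradedRing 𝒜]

/-- The homomorphism from the degree zero part of `A[1/r]` given by a homomorphism from `A` that
takes `r` to a unit. -/
def awayLift {B : Type*} [CommRing B] (g : A →+* B) {r : A} (hr : IsUnit (g r)) :
    Away 𝒜 r →+* B :=
  (IsLocalization.Away.lift r hr : Localization.Away r →+* B).comp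
    (algebraMap (Away 𝒜 r) (Localization.Away r))

lemma awayLift_mk {B : Type*} [CommRing B] (g : A →+* B) {r : A} (hr : IsUnit (g r)) {d : ℕ}
    (hd : r ∈ 𝒜 d) (n : ℕ) (a : A) (ha : a ∈ 𝒜 (n • d)) :
    awayLift 𝒜 g hr (Away.mk 𝒜 hd n a ha) * g r ^ n = g a := by
  rw [awayLift, RingHom.comp_apply, HomogeneousLocalization.algebraMap_apply, Away.val_mk]
  have := IsLocalization.mk'_spec (Localization.Away r) a (⟨r ^ n, n, rfl⟩ : Submonoid.powers r)
  have := congrArg (IsLocalization.Away.lift r hr : Localization.Away r →+* B) this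
  rwa [map_mul, IsLocalization.Away.lift_eq, IsLocalization.Away.lift_eq, map_pow,
    ← Localization.mk_eq_mk'] at this

lemma awayLift_comp {B R : Type*} [CommRing B] [CommRing R] (f : A →+* R) (g : R →+* B) {r : A}
    (hr : IsUnit (g (f r))) (h : Submonoid.powers r ≤ (Submonoid.powers (f r)).comap f) :
    (IsLocalization.Away.lift (f r) hr : Localization.Away (f r) →+* B).comp
      ((IsLocalization.map (Localization.Away (f r)) f h).comp
        (algebraMap (Away 𝒜 r) (Localization.Away r))) = awayLift 𝒜 (g.comp f) hr := by
  rw [awayLift, ← RingHom.comp_assoc]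
  congr 1
  refine IsLocalization.ringHom_ext (Submonoid.powers r) ?_
  rw [RingHom.comp_assoc, IsLocalization.map_comp, ← RingHom.comp_assoc,
    IsLocalization.Away.lift_comp]
  exact (IsLocalization.Away.lift_comp (g := g.comp f) r hr).symm

lemma isoOfEq_inv_restrict_ι {X Y : Scheme.{u}} (f : X ⟶ Y) {U : X.Opens} (V : Y.Opens)
    (e : f ⁻¹ᵁ V = U) : (X.isoOfEq e).inv ≫ f ∣_ V ≫ V.ι = U.ι ≫ f := by
  rw [morphismRestrict_ι, Scheme.isoOfEq_inv_ι_assoc]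

/-- Where the coordinate `r` is invertible, a morphism to `Proj` is a morphism to the chart
`D₊(r)`. -/
lemma comp_fromOfGlobalSections {X : Scheme.{u}} (f : A →+* Γ(X, ⊤))
    (hf : (HomogeneousIdeal.irrelevant 𝒜).toIdeal.map f = ⊤) {B : CommRingCat.{u}}
    (g : Spec B ⟶ X) (φ : A →+* B) (hφ : (g.appTop ≫ (Scheme.ΓSpecIso B).hom).hom.comp f = φ)
    {r : A} {d : ℕ} (hd : r ∈ 𝒜 d) (h0 : 0 < d) (hu : IsUnit (φ r)) :
    g ≫ Proj.fromOfGlobalSections 𝒜 f hf =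
      Spec.map (CommRingCat.ofHom (awayLift 𝒜 φ hu)) ≫ Proj.awayι 𝒜 r hd h0 := by
  subst hφ
  let G : Γ(X, ⊤) →+* B := (g.appTop ≫ (Scheme.ΓSpecIso B).hom).hom
  have hrange : Set.range g ⊆ Set.range (X.basicOpen (f r)).ι := by
    have hu' : IsUnit (g.appTop (f r)) := by
      have : (g.appTop (f r)) =
          (Scheme.ΓSpecIso B).inv ((Scheme.ΓSpecIso B).hom (g.appTop (f r))) :=
        ((Scheme.ΓSpecIso B).hom_inv_id_apply _).symm
      rw [this]
      exact hu.map (Scheme.ΓSpecIso B).inv.hom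
    rw [Scheme.Opens.range_ι]
    rintro _ ⟨z, rfl⟩
    change z ∈ g ⁻¹ᵁ X.basicOpen (f r)
    rw [Scheme.preimage_basicOpen_top, Scheme.basicOpen_of_isUnit _ hu']
    trivial
  let u := IsOpenImmersion.lift (X.basicOpen (f r)).ι g hrange
  have hu' : u ≫ (X.basicOpen (f r)).ι = g := IsOpenImmersion.lift_fac _ _ _
  have h1 : g ≫ Proj.fromOfGlobalSections 𝒜 f hf =
      u ≫ Proj.toBasicOpenOfGlobalSections 𝒜 f rfl h0 hd ≫ (Proj.basicOpen 𝒜 r).ι := by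
    rw [← Proj.fromOfGlobalSections_resLE 𝒜 f hf h0 hd, Scheme.Hom.resLE_comp_ι, ← hu',
      Category.assoc]
  have hχ : u ≫ (X.isoOfEq (X.toSpecΓ_preimage_basicOpen (f r))).inv ≫ X.toSpecΓ ∣_ _ ≫
      (basicOpenIsoSpecAway _).hom =
      Spec.map (CommRingCat.ofHom (IsLocalization.Away.lift (g := G) (f r) hu :
        Localization.Away (f r) →+* B)) := by
    rw [← cancel_mono (Spec.map (CommRingCat.ofHom (algebraMap Γ(X, ⊤) (Localization.Away (f r)))))]
    simp only [Category.assoc]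
    rw [basicOpenIsoSpecAway_hom_SpecMap]
    refine (congrArg (u ≫ ·) (isoOfEq_inv_restrict_ι X.toSpecΓ _ _)).trans ?_
    rw [reassoc_of% hu', Scheme.toSpecΓ_naturality, ← SpecMap_ΓSpecIso_hom, ← Spec.map_comp,
      ← Spec.map_comp]
    congr 1
    ext a
    exact (IsLocalization.Away.lift_eq (g := G) (f r) hu a).symm
  rw [h1, Proj.toBasicOpenOfGlobalSections]
  simp only [Category.assoc]
  rw [Proj.basicOpenIsoSpec_inv_ι, reassoc_of% hχ, ← Spec.map_comp_assoc]
  congr 2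
  rw [← CommRingCat.ofHom_comp, awayLift_comp 𝒜 f G hu]

lemma comp_ι_appLE {X Y : Scheme.{u}} (U : X.Opens) (p : Y ⟶ U.toScheme) (h) :
    (p ≫ U.ι).appLE U ⊤ h = U.topIso.inv ≫ p.appTop := by
  have e : p.appTop = p.appLE ⊤ ⊤ le_top := by
    rw [Scheme.Hom.appTop, Scheme.Hom.app_eq_appLE]; rfl
  rw [Scheme.Hom.comp_appLE, e, ← p.map_appLE (U := U.ι ⁻¹ᵁ U) (U' := ⊤) (V := ⊤) h
    (eqToHom (by simp)).op]
  rw [← Category.assoc]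
  congr 1
  simp
  exact (congrArg X.presheaf.map (Subsingleton.elim _ _)).trans (X.presheaf.map_comp _ _)

lemma awayToSection_awayι_appLE {r : A} {d : ℕ} (hd : r ∈ 𝒜 d) (h0 : 0 < d) (h) :
    Proj.awayToSection 𝒜 r ≫ (Proj.awayι 𝒜 r hd h0).appLE (Proj.basicOpen 𝒜 r) ⊤ h =
      (Scheme.ΓSpecIso _).inv := by
  have h1 : (Proj.basicOpenToSpec 𝒜 r).appTop = (Scheme.ΓSpecIso _).hom ≫
      Proj.awayToSection 𝒜 r ≫ (Proj.basicOpen 𝒜 r).topIso.inv :=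
    Proj.basicOpenToSpec_app_top 𝒜 r
  have h2 : Proj.awayToSection 𝒜 r = (Scheme.ΓSpecIso _).inv ≫
      (Proj.basicOpenIsoSpec 𝒜 r hd h0).hom.appTop ≫ (Proj.basicOpen 𝒜 r).topIso.hom := by
    rw [Proj.basicOpenIsoSpec_hom, Iso.eq_inv_comp]
    refine (Iso.comp_inv_eq _).mp ?_
    exact (Category.assoc _ _ _).trans h1.symm
  have h3 : (Proj.basicOpen 𝒜 r).topIso.hom ≫
      (Proj.awayι 𝒜 r hd h0).appLE (Proj.basicOpen 𝒜 r) ⊤ h =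
      (Proj.basicOpenIsoSpec 𝒜 r hd h0).inv.appTop := by
    rw [← Iso.eq_inv_comp]
    exact comp_ι_appLE _ _ _
  rw [h2, Category.assoc, Category.assoc, h3, ← Scheme.Hom.comp_appTop]
  simp

end MapsToProj

/-! ### Function fields and dominant points -/

section DominantPoint

variable {k : Type u} [Field k] {X : Scheme.{u}} (f : X ⟶ Spec (.of k)) [IsIntegral X]
  {K : Type u} [Field K] (g : Spec (.of K) ⟶ X) [IsDominant g]

lemma genericPoint_eq_of_isDominant : g (IsLocalRing.closedPoint K) = genericPoint X := by
  have : IsGenericPoint (g (IsLocalRing.closedPoint K)) Set.univ := by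
    rw [isGenericPoint_def, ← g.denseRange.closure_range]
    congr 1
    ext z
    constructor
    · rintro rfl
      exact ⟨_, rfl⟩
    · rintro ⟨y, rfl⟩
      exact congrArg g (Subsingleton.elim y _)
  exact this.eq (genericPoint_spec X)

/-- A dominant morphism from the spectrum of a field embeds the function field. -/
def funFieldMap : FunField f →+* K :=
  (X.presheaf.stalkSpecializes (genericPoint_eq_of_isDominant g ▸ specializes_rfl :
      g (IsLocalRing.closedPoint K) ⤳ genericPoint X) ≫
    Scheme.stalkClosedPointTo (R := .of K) g).hom

lemma preimage_eq_top_of_nonempty (U : X.Opens) [h : Nonempty U] : ⊤ ≤ g ⁻¹ᵁ U := by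
  refine (Scheme.preimage_eq_top_of_closedPoint_mem g ?_).ge
  rw [genericPoint_eq_of_isDominant]
  obtain ⟨x, hx⟩ := h
  exact ((genericPoint_spec X).specializes trivial : genericPoint X ⤳ x).mem_open U.2 hx

lemma funFieldMap_sections (U : X.Opens) [Nonempty U] (s : Γ(X, U)) :
    funFieldMap f g (sectionsToFunField f U s) =
      (Scheme.ΓSpecIso (.of K)).hom (g.appLE U ⊤ (preimage_eq_top_of_nonempty g U) s) := by
  have h1 := Scheme.germ_stalkClosedPointTo g U
    ((preimage_eq_top_of_nonempty g U) trivial)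
  have h2 := X.presheaf.germ_stalkSpecializes_assoc (U := U) (y := genericPoint X)
    (genericPoint_eq_of_isDominant g ▸ (preimage_eq_top_of_nonempty g U) trivial)
    (genericPoint_eq_of_isDominant g ▸ specializes_rfl :
      g (IsLocalRing.closedPoint K) ⤳ genericPoint X) (Scheme.stalkClosedPointTo (R := .of K) g)
  have h3 := congrArg (fun φ => φ.hom s) (h2.trans h1)
  refine h3.trans ?_
  simp [Scheme.Hom.app_eq_appLE, Scheme.Hom.appLE_map_assoc]

lemma funFieldMap_algebraMap [Algebra k K]
    (hg : g ≫ f = Spec.map (CommRingCat.ofHom (algebraMap k K))) (c : k) :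
    funFieldMap f g (algebraMap k (FunField f) c) = algebraMap k K c := by
  have : Nonempty (⊤ : X.Opens) := ⟨⟨genericPoint X, trivial⟩⟩
  refine (funFieldMap_sections f g ⊤ (f.appTop ((Scheme.ΓSpecIso (.of k)).inv c))).trans ?_
  have h1 : f.appTop ≫ g.appLE ⊤ ⊤ le_top =
    (Spec.map (CommRingCat.ofHom (algebraMap k K))).appTop := by
    rw [← hg]
    simp [Scheme.Hom.appLE]
    exact congrArg (f.appTop ≫ ·) (Category.comp_id _)
  have h2 := Scheme.ΓSpecIso_naturality (CommRingCat.ofHom (algebraMap k K))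
  rw [← h1] at h2
  have h3 := congrArg (fun φ => φ.hom ((Scheme.ΓSpecIso (.of k)).inv c)) h2
  refine h3.trans ?_
  simp

end DominantPoint

/-! ### The projective closure of `𝒳₂` -/

section Closure

lemma isIntegral_image {X Y : Scheme.{u}} (f : X ⟶ Y) [QuasiCompact f] [IsIntegral X] :
    IsIntegral f.image := by
  have : IrreducibleSpace f.image := by
    rw [irreducibleSpace_def]
    convert ((IrreducibleSpace.isIrreducible_univ X).image _
      f.toImage.continuous.continuousOn).closure
    simpa using f.toImage.denseRange.closure_range.symm
  have : IsReduced f.image := by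
    have (x : f.image) : _root_.IsReduced (f.image.presheaf.stalk x) := by
      obtain ⟨_, ⟨U, hU, rfl⟩, hxU, -⟩ := Y.isBasis_affineOpens.exists_subset_of_mem_open
        (Set.mem_univ (f.imageι x)) isOpen_univ
      have hV : IsAffineOpen (f.imageι ⁻¹ᵁ U) := hU.preimage f.imageι
      have : _root_.IsReduced Γ(f.image, f.imageι ⁻¹ᵁ U) :=
        isReduced_of_injective (f.toImage.app (f.imageι ⁻¹ᵁ U)).hom
          (f.toImage_app_injective ⟨U, hU⟩)
      have hloc := hV.isLocalization_stalk ⟨x, hxU⟩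
      let _ : Algebra Γ(f.image, f.imageι ⁻¹ᵁ U) (f.image.presheaf.stalk x) :=
        (f.image.presheaf.germ _ x hxU).hom.toAlgebra
      exact isReduced_localizationPreserves (hV.primeIdealOf ⟨x, hxU⟩).asIdeal.primeCompl _ this
    exact isReduced_of_isReduced_stalk _
  exact isIntegral_of_irreducibleSpace_of_isReduced _

variable {k : Type u} [Field k]

open MvPolynomial

lemma finiteType_homogeneousSubmodule :
    Algebra.FiniteType (homogeneousSubmodule (Fin 5) k 0) (MvPolynomial (Fin 5) k) := by
  have := IsScalarTower.of_algebraMap_eq (R := k) (S := homogeneousSubmodule (Fin 5) k 0)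
    (A := MvPolynomial (Fin 5) k) fun _ => rfl
  exact Algebra.FiniteType.of_restrictScalars_finiteType k _ _

lemma algebraMap_homogeneousSubmodule_bijective :
    Function.Bijective (algebraMap k (homogeneousSubmodule (Fin 5) k 0)) := by
  refine ⟨fun a b h => C_injective (Fin 5) k (congrArg Subtype.val h), fun p => ?_⟩
  obtain ⟨c, hc⟩ := Submodule.mem_one.mp ((homogeneousSubmodule_zero (σ := Fin 5) (R := k)).le p.2)
  exact ⟨c, Subtype.ext hc⟩

lemma isProper_P4 : IsProper (P4.toBase k) := by
  have := finiteType_homogeneousSubmodule (k := k)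
  have : IsIso (CommRingCat.ofHom (algebraMap k (homogeneousSubmodule (Fin 5) k 0))) :=
    (ConcreteCategory.isIso_iff_bijective _).mpr algebraMap_homogeneousSubmodule_bijective
  have h1 : IsProper (Proj.toSpecZero (homogeneousSubmodule (Fin 5) k)) := inferInstance
  have h2 : IsProper (Spec.map
      (CommRingCat.ofHom (algebraMap k (homogeneousSubmodule (Fin 5) k 0)))) := inferInstance
  exact MorphismProperty.comp_mem @IsProper _ _ h1 h2

/-- The standard affine charts of `ℙ⁴`. -/
def P4.basicOpen (r : MvPolynomial (Fin 5) k) : (P4 k).Opens :=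
  Proj.basicOpen (homogeneousSubmodule (Fin 5) k) r

/-- The inclusion of a chart of `ℙ⁴`. -/
def P4.awayι {r : MvPolynomial (Fin 5) k} (hr : r ∈ homogeneousSubmodule (Fin 5) k 1) :
    Spec (.of (HomogeneousLocalization.Away (homogeneousSubmodule (Fin 5) k) r)) ⟶ P4 k :=
  Proj.awayι (homogeneousSubmodule (Fin 5) k) r hr one_pos

/-- An element of the degree zero part of a localization of the homogeneous coordinate ring as a
function on a chart of `ℙ⁴`. -/
def P4.awayToSection (r : MvPolynomial (Fin 5) k) :
    CommRingCat.of (HomogeneousLocalization.Away (homogeneousSubmodule (Fin 5) k) r) ⟶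
      Γ(P4 k, P4.basicOpen r) :=
  Proj.awayToSection (homogeneousSubmodule (Fin 5) k) r

lemma P4.isAffineOpen_basicOpen {r : MvPolynomial (Fin 5) k}
    (hr : r ∈ homogeneousSubmodule (Fin 5) k 1) : IsAffineOpen (P4.basicOpen r) :=
  Proj.isAffineOpen_basicOpen _ r hr one_pos

lemma P4.awayι_mem_basicOpen {r : MvPolynomial (Fin 5) k}
    (hr : r ∈ homogeneousSubmodule (Fin 5) k 1) (z) : P4.awayι hr z ∈ P4.basicOpen r := by
  have : z ∈ P4.awayι hr ⁻¹ᵁ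
      (Proj.awayι (homogeneousSubmodule (Fin 5) k) r hr one_pos).opensRange :=
    ⟨z, rfl⟩
  rwa [Proj.opensRange_awayι] at this

lemma P4.awayToSection_appLE {r : MvPolynomial (Fin 5) k}
    (hr : r ∈ homogeneousSubmodule (Fin 5) k 1) (h) :
    P4.awayToSection r ≫ (P4.awayι hr).appLE (P4.basicOpen r) ⊤ h = (Scheme.ΓSpecIso _).inv :=
  awayToSection_awayι_appLE _ hr one_pos h

lemma P4.awayToSection_surjective {r : MvPolynomial (Fin 5) k}
    (hr : r ∈ homogeneousSubmodule (Fin 5) k 1) :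
    Function.Surjective (P4.awayToSection r) := by
  have : IsIso (P4.awayToSection r) :=
    inferInstanceAs (IsIso
      (Proj.basicOpenIsoAway (homogeneousSubmodule (Fin 5) k) r hr one_pos).hom)
  exact ((ConcreteCategory.isIso_iff_bijective _).mp this).2

lemma P4.awayι_toBase {r : MvPolynomial (Fin 5) k} (hr : r ∈ homogeneousSubmodule (Fin 5) k 1) :
    P4.awayι hr ≫ P4.toBase k = Spec.map (CommRingCat.ofHom
      ((HomogeneousLocalization.fromZeroRingHom (homogeneousSubmodule (Fin 5) k) _).comp
        (algebraMap k (homogeneousSubmodule (Fin 5) k 0)))) := by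
  refine (Proj.awayι_toSpecZero_assoc (homogeneousSubmodule (Fin 5) k) r hr one_pos _).trans ?_
  rw [← Spec.map_comp, ← CommRingCat.ofHom_comp]

lemma P4.mem_basicOpen_of_isUnit {r r' : MvPolynomial (Fin 5) k}
    (hr : r ∈ homogeneousSubmodule (Fin 5) k 1) (hr' : r' ∈ homogeneousSubmodule (Fin 5) k 1)
    {z : P4 k} (hz : z ∈ P4.basicOpen r)
    (hu : IsUnit ((P4 k).presheaf.germ _ z hz (P4.awayToSection r
      (HomogeneousLocalization.Away.mk _ hr 1 r' hr')))) : z ∈ P4.basicOpen r' := by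
  have hz' : z ∈ (Proj.awayι (homogeneousSubmodule (Fin 5) k) r hr one_pos).opensRange := by
    rwa [Proj.opensRange_awayι]
  obtain ⟨w, rfl⟩ : ∃ w, P4.awayι hr w = z := hz'
  change w ∈ P4.awayι hr ⁻¹ᵁ P4.basicOpen r'
  have h1 : P4.awayι hr ⁻¹ᵁ P4.basicOpen r' =
      PrimeSpectrum.basicOpen (HomogeneousLocalization.Away.isLocalizationElem hr hr') :=
    Proj.awayι_preimage_basicOpen _ hr one_pos hr' one_pos
  have h2 : HomogeneousLocalization.Away.isLocalizationElem hr hr' =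
      HomogeneousLocalization.Away.mk _ hr 1 r' hr' := by
    simp only [HomogeneousLocalization.Away.isLocalizationElem, pow_one]
  rw [h1, h2]
  set b := HomogeneousLocalization.Away.mk _ hr 1 r' hr'
  have h3 : w ∈ P4.awayι hr ⁻¹ᵁ (P4 k).basicOpen (P4.awayToSection r b) :=
    ((P4 k).mem_basicOpen _ _ hz).mpr hu
  have htop : ⊤ ≤ P4.awayι hr ⁻¹ᵁ P4.basicOpen r := fun w _ => P4.awayι_mem_basicOpen hr w
  have h4 : (P4.awayι hr).appLE (P4.basicOpen r) ⊤ htop (P4.awayToSection r b) =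
      (Scheme.ΓSpecIso _).inv b := congrArg (fun φ => φ.hom b) (P4.awayToSection_appLE hr htop)
  have h5 := Scheme.basicOpen_appLE (P4.awayι hr) ⊤ (P4.basicOpen r) htop (P4.awayToSection r b)
  rw [h4] at h5
  exact (basicOpen_eq_of_affine
    (R := .of (HomogeneousLocalization.Away (homogeneousSubmodule (Fin 5) k) r)) b).le
      (h5.ge ⟨trivial, h3⟩)

lemma P4.awayToSection_comp_appLE {B : CommRingCat.{u}} {r : MvPolynomial (Fin 5) k}
    (hr : r ∈ homogeneousSubmodule (Fin 5) k 1)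
    (φ : CommRingCat.of (HomogeneousLocalization.Away (homogeneousSubmodule (Fin 5) k) r) ⟶ B)
    {q : Spec B ⟶ P4 k} (hq : q = Spec.map φ ≫ P4.awayι hr) (h) :
    P4.awayToSection r ≫ q.appLE (P4.basicOpen r) ⊤ h ≫ (Scheme.ΓSpecIso B).hom = φ := by
  subst hq
  have htop : ⊤ ≤ P4.awayι hr ⁻¹ᵁ P4.basicOpen r := fun w _ => P4.awayι_mem_basicOpen hr w
  rw [← Scheme.Hom.appLE_comp_appLE _ _ _ ⊤ ⊤ htop le_top, Category.assoc,
    reassoc_of% (P4.awayToSection_appLE hr htop), Iso.inv_comp_eq, ← Scheme.ΓSpecIso_naturality]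
  congr 1

variable (P₁ P₂ : k × k)

instance : IsAffine (X2 k P₁ P₂) := inferInstanceAs (IsAffine (Spec _))

instance : QuasiCompact (X2.toP4 k P₁ P₂) := by
  have := isProper_P4 (k := k)
  have : IsSeparated (P4.toBase k) := this.toIsSeparated
  have : QuasiCompact (X2.toP4 k P₁ P₂ ≫ P4.toBase k) := by
    infer_instance
  exact QuasiCompact.of_comp _ (P4.toBase k)

/-- The inclusion of `𝒳₂` in its projective closure. -/
def X2.toX2Bar : X2 k P₁ P₂ ⟶ X2Bar k P₁ P₂ := (X2.toP4 k P₁ P₂).toImage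

/-- The inclusion of the projective closure of `𝒳₂` in `ℙ⁴`. -/
def X2Bar.toP4 : X2Bar k P₁ P₂ ⟶ P4 k := (X2.toP4 k P₁ P₂).imageι

instance : IsClosedImmersion (X2Bar.toP4 P₁ P₂) :=
  inferInstanceAs (IsClosedImmersion (X2.toP4 k P₁ P₂).imageι)

instance : IsDominant (X2.toX2Bar P₁ P₂) :=
  inferInstanceAs (IsDominant (X2.toP4 k P₁ P₂).toImage)

lemma toX2Bar_toP4 : X2.toX2Bar P₁ P₂ ≫ X2Bar.toP4 P₁ P₂ = X2.toP4 k P₁ P₂ :=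
  Scheme.Hom.toImage_imageι _

lemma isProper_X2Bar : IsProper (X2Bar.toBase k P₁ P₂) :=
  MorphismProperty.comp_mem @IsProper _ _
    (inferInstanceAs (IsProper (X2Bar.toP4 P₁ P₂))) isProper_P4

/-- The field of rational functions on `𝒳₂`. -/
abbrev FieldX2 : Type u := FractionRing (RingX2 k P₁ P₂)

/-- The generic point of `𝒳₂`. -/
def genericX2 : Spec (.of (FieldX2 P₁ P₂)) ⟶ X2 k P₁ P₂ :=
  Spec.map (CommRingCat.ofHom (algebraMap (RingX2 k P₁ P₂) (FieldX2 P₁ P₂)))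

instance : IsDominant (genericX2 P₁ P₂) := by
  refine ⟨(PrimeSpectrum.denseRange_comap_iff_ker_le_nilRadical
    (algebraMap (RingX2 k P₁ P₂) (FieldX2 P₁ P₂))).mpr ?_⟩
  rw [(RingHom.injective_iff_ker_eq_bot _).mp (IsFractionRing.injective _ _)]
  exact bot_le

/-- The homogeneous coordinates of the generic point of `𝒳₂`. -/
def genericCoords : MvPolynomial (Fin 5) k →ₐ[k] FieldX2 P₁ P₂ :=
  aeval ![algebraMap _ _ (coordX2 P₁ P₂ 0), algebraMap _ _ (coordX2 P₁ P₂ 1),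
    algebraMap _ _ (coordX2 P₁ P₂ 2), algebraMap _ _ (coordX2 P₁ P₂ 3), 1]

variable {P₁ P₂}

lemma genericX2_comp_toP4 {r : MvPolynomial (Fin 5) k} (hr : r ∈ homogeneousSubmodule (Fin 5) k 1)
    (h0 : IsUnit ((genericCoords P₁ P₂ : MvPolynomial (Fin 5) k →+* FieldX2 P₁ P₂) r)) :
    genericX2 P₁ P₂ ≫ X2.toP4 k P₁ P₂ =
      Spec.map (CommRingCat.ofHom (awayLift (homogeneousSubmodule (Fin 5) k) _ h0)) ≫
        P4.awayι hr := by
  refine comp_fromOfGlobalSections (B := .of (FieldX2 P₁ P₂)) _ _ _ _ _ ?_ hr one_pos h0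
  have h := Scheme.ΓSpecIso_naturality
    (CommRingCat.ofHom (algebraMap (RingX2 k P₁ P₂) (FieldX2 P₁ P₂)))
  change ((genericX2 P₁ P₂).appTop ≫ _) = _ at h
  rw [h]
  have h1 : (CommRingCat.Hom.hom ((Scheme.ΓSpecIso (.of (RingX2 k P₁ P₂))).hom ≫
      CommRingCat.ofHom (algebraMap (RingX2 k P₁ P₂) (FieldX2 P₁ P₂)))).comp
        ((Scheme.ΓSpecIso (.of (RingX2 k P₁ P₂))).inv.hom.comp (homogCoords k P₁ P₂)) =
      (algebraMap (RingX2 k P₁ P₂) (FieldX2 P₁ P₂)).comp (homogCoords k P₁ P₂) :=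
    RingHom.ext fun z => congrArg (algebraMap (RingX2 k P₁ P₂) (FieldX2 P₁ P₂))
      ((Scheme.ΓSpecIso (.of (RingX2 k P₁ P₂))).inv_hom_id_apply (homogCoords k P₁ P₂ z))
  refine h1.trans (MvPolynomial.ringHom_ext (fun c => ?_) (fun i => ?_))
  · simp [homogCoords, ← IsScalarTower.algebraMap_apply]
  · fin_cases i <;> simp [homogCoords, genericCoords, coordX2]

variable [IsDomain (RingX2 k P₁ P₂)]

instance : IsIntegral (X2 k P₁ P₂) := inferInstanceAs (IsIntegral (Spec _))

instance : IsIntegral (X2Bar k P₁ P₂) := isIntegral_image _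

end Closure

/-! ### Complements of hyperplane sections -/

section Charts

lemma aeval_div_of_isHomogeneous {k F σ : Type*} [Field k] [Field F] [Algebra k F]
    {p : MvPolynomial σ k} {n : ℕ} (hp : p.IsHomogeneous n) (v : σ → F) (c : F) :
    MvPolynomial.aeval (fun i => v i / c) p = MvPolynomial.aeval v p / c ^ n := by
  rw [MvPolynomial.aeval_def, MvPolynomial.aeval_def, MvPolynomial.eval₂_eq,
    MvPolynomial.eval₂_eq, Finset.sum_div]
  refine Finset.sum_congr rfl fun d hd => ?_
  have := hp.degree_eq_sum_deg_support hd
  rw [mul_div_assoc]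
  congr 1
  rw [this]
  simp_rw [div_pow, Finset.prod_div_distrib, Finset.prod_pow_eq_pow_sum]


open MvPolynomial HomogeneousLocalization

variable {k : Type u} [Field k] (P₁ P₂ : k × k)

/-- The generic point of the projective closure of `𝒳₂`. -/
def genericX2Bar : Spec (.of (FieldX2 P₁ P₂)) ⟶ X2Bar k P₁ P₂ :=
  genericX2 P₁ P₂ ≫ X2.toX2Bar P₁ P₂

instance : IsDominant (genericX2Bar P₁ P₂) := inferInstanceAs (IsDominant (_ ≫ _))

/-- The complement of a hyperplane section in the projective closure of `𝒳₂`. -/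
def chartX2Bar (r : MvPolynomial (Fin 5) k) : (X2Bar k P₁ P₂).Opens :=
  X2Bar.toP4 P₁ P₂ ⁻¹ᵁ P4.basicOpen r

variable {P₁ P₂}

lemma isAffineOpen_chartX2Bar {r : MvPolynomial (Fin 5) k}
    (hr : r ∈ homogeneousSubmodule (Fin 5) k 1) : IsAffineOpen (chartX2Bar P₁ P₂ r) :=
  (P4.isAffineOpen_basicOpen hr).preimage (X2Bar.toP4 P₁ P₂)

lemma genericX2Bar_toP4 : genericX2Bar P₁ P₂ ≫ X2Bar.toP4 P₁ P₂ =
    genericX2 P₁ P₂ ≫ X2.toP4 k P₁ P₂ := by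
  rw [genericX2Bar, Category.assoc, toX2Bar_toP4]

lemma genericCoords_four : genericCoords P₁ P₂ (X 4) = 1 := by
  simp [genericCoords]

lemma genericX2Bar_toBase : genericX2Bar P₁ P₂ ≫ X2Bar.toBase k P₁ P₂ =
    Spec.map (CommRingCat.ofHom (algebraMap k (FieldX2 P₁ P₂))) := by
  have h0 : IsUnit ((genericCoords P₁ P₂ : MvPolynomial (Fin 5) k →+* FieldX2 P₁ P₂) (X 4)) := by
    simp [genericCoords_four]
  have hX : X 4 ∈ homogeneousSubmodule (Fin 5) k 1 := isHomogeneous_X k 4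
  have h1 : genericX2Bar P₁ P₂ ≫ X2Bar.toBase k P₁ P₂ =
      (genericX2 P₁ P₂ ≫ X2.toP4 k P₁ P₂) ≫ P4.toBase k := by
    rw [← genericX2Bar_toP4, Category.assoc]
    rfl
  rw [h1, genericX2_comp_toP4 hX h0, Category.assoc, P4.awayι_toBase,
    ← Spec.map_comp]
  congr 1
  ext c
  change awayLift _ _ h0 (fromZeroRingHom _ _ _) = _
  have := awayLift_mk (homogeneousSubmodule (Fin 5) k) _ h0 hX 0 (C c)
    (isHomogeneous_C _ c)
  rw [pow_zero, mul_one] at this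
  refine Eq.trans ?_ (this.trans ?_)
  · congr 1
  · simp

/-- The function on a chart of `𝒳₂` given by an element of the degree zero part of a localization
of the homogeneous coordinate ring. -/
def chartFunction (r : MvPolynomial (Fin 5) k) :
    Away (homogeneousSubmodule (Fin 5) k) r →+* Γ(X2Bar k P₁ P₂, chartX2Bar P₁ P₂ r) :=
  ((X2Bar.toP4 P₁ P₂).app (P4.basicOpen r)).hom.comp
    (P4.awayToSection r).hom

lemma chartFunction_surjective {r : MvPolynomial (Fin 5) k}
    (hr : r ∈ homogeneousSubmodule (Fin 5) k 1) :
    Function.Surjective (chartFunction (P₁ := P₁) (P₂ := P₂) r) :=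
  ((X2Bar.toP4 P₁ P₂).app_surjective _ (P4.isAffineOpen_basicOpen hr)).comp
    (P4.awayToSection_surjective hr)

lemma exists_mem_chartX2Bar {ι : Type*} (r : ι → MvPolynomial (Fin 5) k)
    (hr : ∀ i, r i ∈ homogeneousSubmodule (Fin 5) k 1)
    (h : ∀ i, X i ∈ Submodule.span k (Set.range r)) (z : X2Bar k P₁ P₂) :
    ∃ i, z ∈ chartX2Bar P₁ P₂ (r i) := by
  have h1 : Algebra.adjoin (homogeneousSubmodule (Fin 5) k 0) (Set.range r) = ⊤ := by
    set S := Algebra.adjoin (homogeneousSubmodule (Fin 5) k 0) (Set.range r)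
    have hC (c : k) : C c ∈ S := S.algebraMap_mem ⟨C c, isHomogeneous_C _ c⟩
    refine top_le_iff.mp fun p _ => ?_
    induction p using MvPolynomial.induction_on with
    | C c => exact hC c
    | add p q hp hq => exact add_mem (hp trivial) (hq trivial)
    | mul_X p i hp =>
      refine mul_mem (hp trivial) ?_
      refine Submodule.span_induction (fun x hx => Algebra.subset_adjoin hx) (zero_mem S)
        (fun _ _ _ _ => add_mem) (fun c x _ hx => ?_) (h i)
      rw [smul_eq_C_mul]
      exact mul_mem (hC c) hx
  have h2 := Proj.iSup_basicOpen_eq_top' (homogeneousSubmodule (Fin 5) k) r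
    (fun i => ⟨1, hr i⟩) h1
  obtain ⟨i, hi⟩ := TopologicalSpace.Opens.mem_iSup.mp (h2.ge (trivial : X2Bar.toP4 P₁ P₂ z ∈ ⊤))
  exact ⟨i, hi⟩

variable [IsDomain (RingX2 k P₁ P₂)]

lemma nonempty_chartX2Bar {r : MvPolynomial (Fin 5) k}
    (hr : r ∈ homogeneousSubmodule (Fin 5) k 1) (h0 : genericCoords P₁ P₂ r ≠ 0) :
    Nonempty (chartX2Bar P₁ P₂ r) := by
  obtain ⟨p⟩ : Nonempty (Spec (.of (FieldX2 P₁ P₂))) := inferInstance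
  refine ⟨⟨genericX2Bar P₁ P₂ p, ?_⟩⟩
  change X2Bar.toP4 P₁ P₂ (genericX2Bar P₁ P₂ p) ∈ P4.basicOpen r
  rw [← Scheme.Hom.comp_apply, genericX2Bar_toP4, genericX2_comp_toP4 hr h0.isUnit,
    Scheme.Hom.comp_apply]
  exact P4.awayι_mem_basicOpen hr _

/-- The functions on the complement of the hyperplane `r = 0` restrict at the generic point of `𝒳₂`
to the polynomials in the quotients of the homogeneous coordinates by `r`. -/
lemma exists_awayLift_iff {r : MvPolynomial (Fin 5) k}
    (hr : r ∈ homogeneousSubmodule (Fin 5) k 1) (h0 : genericCoords P₁ P₂ r ≠ 0)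
    (z : FieldX2 P₁ P₂) :
    (∃ b, awayLift (homogeneousSubmodule (Fin 5) k)
      (genericCoords P₁ P₂ : MvPolynomial (Fin 5) k →+* FieldX2 P₁ P₂) h0.isUnit b = z) ↔
    z ∈ Algebra.adjoin k
      (Set.range fun i => genericCoords P₁ P₂ (X i) / genericCoords P₁ P₂ r) := by
  have hmk (n : ℕ) (a : MvPolynomial (Fin 5) k) (ha : a ∈ homogeneousSubmodule (Fin 5) k (n • 1)) :
      awayLift (homogeneousSubmodule (Fin 5) k)
        (genericCoords P₁ P₂ : MvPolynomial (Fin 5) k →+* FieldX2 P₁ P₂) h0.isUnit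
        (Away.mk _ hr n a ha) = genericCoords P₁ P₂ a / genericCoords P₁ P₂ r ^ n :=
    (eq_div_iff (pow_ne_zero _ h0)).mpr (awayLift_mk _ _ h0.isUnit hr n a ha)
  constructor
  · rintro ⟨b, rfl⟩
    obtain ⟨n, a, ha, rfl⟩ := Away.mk_surjective _ hr b
    have ha' : a.IsHomogeneous n := by simpa using ha
    rw [hmk, Algebra.adjoin_range_eq_range_aeval]
    refine ⟨a, (aeval_div_of_isHomogeneous ha' _ _).trans ?_⟩
    rw [← comp_aeval_apply, aeval_X_left_apply]
  · intro hz
    let S : Subalgebra k (FieldX2 P₁ P₂) :=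
      { (awayLift (homogeneousSubmodule (Fin 5) k)
          (genericCoords P₁ P₂ : MvPolynomial (Fin 5) k →+* FieldX2 P₁ P₂) h0.isUnit).range with
        algebraMap_mem' := fun c => ⟨Away.mk _ hr 0 (C c) (isHomogeneous_C _ c),
          (hmk _ _ _).trans (by
            rw [pow_zero, div_one]
            exact (genericCoords P₁ P₂).commutes c)⟩ }
    refine (Algebra.adjoin_le ?_ : _ ≤ S) hz
    rintro _ ⟨i, rfl⟩
    exact ⟨Away.mk _ hr 1 (X i) (isHomogeneous_X k i), (hmk _ _ _).trans (by rw [pow_one])⟩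

variable (P₁ P₂) in
/-- The pullback of rational functions on the projective closure of `𝒳₂` to its generic point, as
rational functions on `𝒳₂`. -/
def funFieldX2Bar : FunField (X2Bar.toBase k P₁ P₂) →ₐ[k] FieldX2 P₁ P₂ where
  __ := funFieldMap (X2Bar.toBase k P₁ P₂) (genericX2Bar P₁ P₂)
  commutes' := funFieldMap_algebraMap _ _ genericX2Bar_toBase

lemma funFieldX2Bar_chartFunction {r : MvPolynomial (Fin 5) k}
    (hr : r ∈ homogeneousSubmodule (Fin 5) k 1) (h0 : genericCoords P₁ P₂ r ≠ 0)
    [Nonempty (chartX2Bar P₁ P₂ r)] (b : Away (homogeneousSubmodule (Fin 5) k) r) :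
    funFieldX2Bar P₁ P₂ (sectionsToFunField _ (chartX2Bar P₁ P₂ r) (chartFunction r b)) =
      awayLift (homogeneousSubmodule (Fin 5) k)
        (genericCoords P₁ P₂ : MvPolynomial (Fin 5) k →+* FieldX2 P₁ P₂) h0.isUnit b := by
  refine (funFieldMap_sections _ _ _ _).trans ?_
  have h1 : (X2Bar.toP4 P₁ P₂).app (P4.basicOpen r) ≫ (genericX2Bar P₁ P₂).appLE
      (chartX2Bar P₁ P₂ r) ⊤ (preimage_eq_top_of_nonempty _ _) =
      (genericX2Bar P₁ P₂ ≫ X2Bar.toP4 P₁ P₂).appLE (P4.basicOpen r) ⊤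
        (preimage_eq_top_of_nonempty (genericX2Bar P₁ P₂) (chartX2Bar P₁ P₂ r)) :=
    (Scheme.Hom.comp_appLE _ _ _ _ _).symm
  have h2 : P4.awayToSection r ≫ (genericX2Bar P₁ P₂ ≫ X2Bar.toP4 P₁ P₂).appLE (P4.basicOpen r) ⊤
        (preimage_eq_top_of_nonempty (genericX2Bar P₁ P₂) (chartX2Bar P₁ P₂ r)) ≫
        (Scheme.ΓSpecIso _).hom =
      CommRingCat.ofHom (awayLift (homogeneousSubmodule (Fin 5) k)
        (genericCoords P₁ P₂ : MvPolynomial (Fin 5) k →+* FieldX2 P₁ P₂) h0.isUnit) :=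
    P4.awayToSection_comp_appLE hr _ (genericX2Bar_toP4.trans (genericX2_comp_toP4 hr h0.isUnit)) _
  rw [← h1] at h2
  exact congrArg (fun φ => φ.hom b) h2

lemma exists_section_chartX2Bar_iff {r : MvPolynomial (Fin 5) k}
    (hr : r ∈ homogeneousSubmodule (Fin 5) k 1) (h0 : genericCoords P₁ P₂ r ≠ 0)
    [Nonempty (chartX2Bar P₁ P₂ r)] (w : FunField (X2Bar.toBase k P₁ P₂)) :
    (∃ s, sectionsToFunField _ (chartX2Bar P₁ P₂ r) s = w) ↔ funFieldX2Bar P₁ P₂ w ∈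
      Algebra.adjoin k (Set.range fun i => genericCoords P₁ P₂ (X i) / genericCoords P₁ P₂ r) := by
  rw [← exists_awayLift_iff hr h0]
  constructor
  · rintro ⟨s, rfl⟩
    obtain ⟨b, rfl⟩ := chartFunction_surjective hr s
    exact ⟨b, (funFieldX2Bar_chartFunction hr h0 b).symm⟩
  · rintro ⟨b, hb⟩
    exact ⟨chartFunction r b, (funFieldX2Bar P₁ P₂).injective
      ((funFieldX2Bar_chartFunction hr h0 b).trans hb)⟩

lemma funFieldX2Bar_bijective : Function.Bijective (funFieldX2Bar P₁ P₂) := by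
  refine ⟨(funFieldX2Bar P₁ P₂).injective, fun z => ?_⟩
  have h4 : genericCoords P₁ P₂ (X 4) ≠ 0 := by simp [genericCoords_four]
  have hX : X 4 ∈ homogeneousSubmodule (Fin 5) k 1 := isHomogeneous_X k 4
  have := nonempty_chartX2Bar hX h4
  have hA (a : RingX2 k P₁ P₂) : algebraMap _ _ a ∈ (funFieldX2Bar P₁ P₂).fieldRange := by
    have h1 : a ∈ Algebra.adjoin k (Set.range (coordX2 P₁ P₂)) := adjoin_coordX2.ge trivial
    have h2 := Subalgebra.mem_map.mpr
      ⟨a, h1, (rfl : IsScalarTower.toAlgHom k (RingX2 k P₁ P₂) (FieldX2 P₁ P₂) a = _)⟩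
    rw [AlgHom.map_adjoin] at h2
    refine (Algebra.adjoin_le ?_ : _ ≤ (funFieldX2Bar P₁ P₂).range) h2
    rintro _ ⟨_, ⟨i, rfl⟩, rfl⟩
    obtain ⟨b, hb⟩ := (exists_awayLift_iff hX h4 (algebraMap _ _ (coordX2 P₁ P₂ i))).mpr
      (Algebra.subset_adjoin ⟨i.castSucc, by
        fin_cases i <;> simp [genericCoords]⟩)
    exact ⟨_, (funFieldX2Bar_chartFunction hX h4 b).trans hb⟩
  obtain ⟨a, b, -, rfl⟩ := IsFractionRing.div_surjective (A := RingX2 k P₁ P₂) z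
  exact div_mem (hA a) (hA b)

/-- Regularity of `r / r'` at a point where the linear form `r` is nonzero means that `r'` is
nonzero there as well. -/
lemma mem_chartX2Bar_of_mem_localRing {r r' : MvPolynomial (Fin 5) k}
    (hr : r ∈ homogeneousSubmodule (Fin 5) k 1) (hr' : r' ∈ homogeneousSubmodule (Fin 5) k 1)
    (h0 : genericCoords P₁ P₂ r ≠ 0) (h0' : genericCoords P₁ P₂ r' ≠ 0)
    {z : X2Bar k P₁ P₂} (hz : z ∈ chartX2Bar P₁ P₂ r) {w : FunField (X2Bar.toBase k P₁ P₂)}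
    (hw : funFieldX2Bar P₁ P₂ w = genericCoords P₁ P₂ r / genericCoords P₁ P₂ r')
    (hwz : w ∈ localRing (X2Bar.toBase k P₁ P₂) z) : z ∈ chartX2Bar P₁ P₂ r' := by
  have : Nonempty (chartX2Bar P₁ P₂ r) := ⟨⟨z, hz⟩⟩
  set b := Away.mk (homogeneousSubmodule (Fin 5) k) hr 1 r' hr'
  have hb : funFieldX2Bar P₁ P₂ (sectionsToFunField _ (chartX2Bar P₁ P₂ r) (chartFunction r b)) =
      genericCoords P₁ P₂ r' / genericCoords P₁ P₂ r := by
    rw [funFieldX2Bar_chartFunction hr h0, eq_div_iff h0]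
    have := awayLift_mk _ (genericCoords P₁ P₂ : MvPolynomial (Fin 5) k →+* FieldX2 P₁ P₂)
      h0.isUnit hr 1 r' hr'
    rwa [pow_one] at this
  obtain ⟨u, rfl⟩ := hwz
  have hu : IsUnit ((X2Bar k P₁ P₂).presheaf.germ _ z hz (chartFunction r b)) := by
    refine IsUnit.of_mul_eq_one u ?_
    refine stalkToFunField_injective (f := X2Bar.toBase k P₁ P₂) z ?_
    refine (funFieldX2Bar P₁ P₂).injective ?_
    change funFieldX2Bar P₁ P₂ _ = funFieldX2Bar P₁ P₂ _
    rw [map_mul, map_mul, map_one, map_one, stalkToFunField_germ, hb]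
    refine (congrArg (_ * ·) hw).trans ?_
    field_simp
  refine P4.mem_basicOpen_of_isUnit hr hr' (z := X2Bar.toP4 P₁ P₂ z) hz ?_
  refine isUnit_of_map_unit ((X2Bar.toP4 P₁ P₂).stalkMap z).hom _ ?_
  refine (congrArg IsUnit ?_).mpr hu
  exact Scheme.Hom.germ_stalkMap_apply (X2Bar.toP4 P₁ P₂) _ z hz _

variable (P₁ P₂) in
/-- The function field of the projective closure of `𝒳₂` is the field of rational functions
on `𝒳₂`. -/
def funFieldEquivX2Bar : FunField (X2Bar.toBase k P₁ P₂) ≃ₐ[k] FieldX2 P₁ P₂ :=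
  AlgEquiv.ofBijective _ funFieldX2Bar_bijective

end Charts

/-! ### Transport of toric coordinates along field isomorphisms -/

section Transfer

variable {k F F' : Type u} [Field k] [Field F] [Algebra k F] [Field F'] [Algebra k F']

lemma map_chartLeft {x y : F} (f : F →ₐ[k] F') (i : Fin 4) :
    f (chartLeft x y i) = chartLeft (f x) (f y) i := by
  fin_cases i <;> simp [chartLeft]

lemma map_chartRight {x y : F} (f : F →ₐ[k] F') (i : Fin 4) :
    f (chartRight x y i) = chartRight (f x) (f y) i := by
  fin_cases i <;> simp [chartRight]

lemma map_mem_chartAlgebra_iff {t s z : F} (f : F →ₐ[k] F') :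
    f z ∈ chartAlgebra k (f t) (f s) ↔ z ∈ chartAlgebra k t s := by
  have : chartAlgebra k (f t) (f s) = (chartAlgebra k t s).map f := by
    rw [chartAlgebra, chartAlgebra, AlgHom.map_adjoin]
    simp [Set.image_insert_eq]
  rw [this]
  exact ⟨fun ⟨w, hw, h⟩ => f.injective h ▸ hw, fun h => ⟨z, h, rfl⟩⟩

lemma IsCoordinatePair.of_algEquiv (e : F ≃ₐ[k] F') {x y : F}
    (h : IsCoordinatePair k (e x) (e y)) : IsCoordinatePair k x y where
  trdeg_eq := e.trdeg_eq.trans h.trdeg_eq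
  adjoin_eq_top := by
    have h1 := IntermediateField.adjoin_map k {e x, e y} (e.symm : F' →ₐ[k] F)
    rw [h.adjoin_eq_top, ← AlgHom.fieldRange_eq_map] at h1
    have h2 : (e.symm : F' →ₐ[k] F).fieldRange = ⊤ := AlgEquiv.fieldRange_eq_top e.symm
    rw [h2, Set.image_pair] at h1
    simpa using h1.symm

end Transfer

/-! ### Diagonal coordinates on the projective closure -/

section Diamond

open MvPolynomial

variable {k : Type u} [Field k] (P₁ P₂ : k × k)

/-- In coordinates `u + iv` of the plane along the vector `P₂ - P₁` from `P₁`, scaled by its length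
`δ`, the equations of `𝒳₂` become `(δz₁)² - u² = v²` and `(δz₂)² - (u - δ²w)² = v²`. These are the
linear form `v` and the linear factors of the left hand sides. -/
def diamondForm (δ : k) : Fin 5 → MvPolynomial (Fin 5) k :=
  let w : MvPolynomial (Fin 5) k := X 4
  let p := X 0 - P₁.1 • w
  let q := X 1 - P₁.2 • w
  let u := (P₂.1 - P₁.1) • p + (P₂.2 - P₁.2) • q
  let v := (P₂.1 - P₁.1) • q - (P₂.2 - P₁.2) • p
  ![v, δ • X 2 + u, δ • X 2 - u, δ • X 3 + (u - δ ^ 2 • w), δ • X 3 - (u - δ ^ 2 • w)]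

variable {P₁ P₂}

lemma diamondForm_mem_span (δ : k) (j : Fin 5) :
    diamondForm P₁ P₂ δ j ∈ Submodule.span k (Set.range (X : Fin 5 → MvPolynomial (Fin 5) k)) := by
  set S := Submodule.span k (Set.range (X : Fin 5 → MvPolynomial (Fin 5) k))
  have hX (i : Fin 5) (c : k) : c • X i ∈ S := S.smul_mem _ (Submodule.subset_span ⟨i, rfl⟩)
  have hX' (i : Fin 5) : X i ∈ S := Submodule.subset_span ⟨i, rfl⟩
  have hp (i : Fin 5) (c : k) : X i - c • X 4 ∈ S := sub_mem (hX' i) (hX 4 c)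
  have hu (a b : k) : a • (X 0 - P₁.1 • X 4) + b • (X 1 - P₁.2 • X 4) ∈ S :=
    add_mem (S.smul_mem _ (hp _ _)) (S.smul_mem _ (hp _ _))
  fin_cases j
  · exact sub_mem (S.smul_mem _ (hp _ _)) (S.smul_mem _ (hp _ _))
  · exact add_mem (hX _ _) (hu _ _)
  · exact sub_mem (hX _ _) (hu _ _)
  · exact add_mem (hX _ _) (sub_mem (hu _ _) (hX _ _))
  · exact sub_mem (hX _ _) (sub_mem (hu _ _) (hX _ _))

lemma diamondForm_mem (δ : k) (j : Fin 5) :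
    diamondForm P₁ P₂ δ j ∈ homogeneousSubmodule (Fin 5) k 1 := by
  refine (Submodule.span_le.mpr ?_ : Submodule.span k (Set.range X) ≤ _) (diamondForm_mem_span δ j)
  rintro _ ⟨i, rfl⟩
  exact isHomogeneous_X k i

/-- The linear forms `diamondForm` are coordinates on `ℙ⁴`: `X i` is recovered from them after
multiplication by `2δ²` or `2δ`. -/
lemma X_mem_span_diamondForm [CharZero k] {δ : k} (h0 : δ ≠ 0)
    (hδ : δ ^ 2 = (P₂.1 - P₁.1) ^ 2 + (P₂.2 - P₁.2) ^ 2) (i : Fin 5) :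
    X i ∈ Submodule.span k (Set.range (diamondForm P₁ P₂ δ)) := by
  set S := Submodule.span k (Set.range (diamondForm P₁ P₂ δ)) with hS
  have hl (j : Fin 5) : diamondForm P₁ P₂ δ j ∈ S := Submodule.subset_span ⟨j, rfl⟩
  have h2 : 2 * δ ≠ 0 := mul_ne_zero two_ne_zero h0
  have hD : 2 * δ ^ 2 ≠ 0 := mul_ne_zero two_ne_zero (pow_ne_zero 2 h0)
  have hC2 : (C 2 : MvPolynomial (Fin 5) k) = 2 := map_ofNat C 2
  have hδ' : (C δ ^ 2 : MvPolynomial (Fin 5) k) =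
      (C P₂.1 - C P₁.1) ^ 2 + (C P₂.2 - C P₁.2) ^ 2 := by
    rw [← map_pow, hδ]
    simp
  have e4 : (2 * δ ^ 2) • (X 4 : MvPolynomial (Fin 5) k) = diamondForm P₁ P₂ δ 1 -
      diamondForm P₁ P₂ δ 2 - diamondForm P₁ P₂ δ 3 + diamondForm P₁ P₂ δ 4 := by
    simp [diamondForm, smul_eq_C_mul, hC2]
    ring
  have m4 : (X 4 : MvPolynomial (Fin 5) k) ∈ S := by
    rw [← S.smul_mem_iff hD, e4]
    exact add_mem (sub_mem (sub_mem (hl _) (hl _)) (hl _)) (hl _)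
  have e0 : (2 * δ ^ 2) • (X 0 : MvPolynomial (Fin 5) k) =
      (P₂.1 - P₁.1) • (diamondForm P₁ P₂ δ 1 - diamondForm P₁ P₂ δ 2) -
      (2 * (P₂.2 - P₁.2)) • diamondForm P₁ P₂ δ 0 + (2 * δ ^ 2 * P₁.1) • X 4 := by
    simp [diamondForm, smul_eq_C_mul, hδ', hC2]
    ring
  have e1 : (2 * δ ^ 2) • (X 1 : MvPolynomial (Fin 5) k) =
      (P₂.2 - P₁.2) • (diamondForm P₁ P₂ δ 1 - diamondForm P₁ P₂ δ 2) +
      (2 * (P₂.1 - P₁.1)) • diamondForm P₁ P₂ δ 0 + (2 * δ ^ 2 * P₁.2) • X 4 := by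
    simp [diamondForm, smul_eq_C_mul, hδ', hC2]
    ring
  have e2 : (2 * δ) • (X 2 : MvPolynomial (Fin 5) k) =
      diamondForm P₁ P₂ δ 1 + diamondForm P₁ P₂ δ 2 := by
    simp [diamondForm, smul_eq_C_mul, hC2]
    ring
  have e3 : (2 * δ) • (X 3 : MvPolynomial (Fin 5) k) =
      diamondForm P₁ P₂ δ 3 + diamondForm P₁ P₂ δ 4 := by
    simp [diamondForm, smul_eq_C_mul, hC2]
    ring
  fin_cases i
  · rw [← S.smul_mem_iff hD]
    exact e0 ▸ add_mem (sub_mem (S.smul_mem _ (sub_mem (hl _) (hl _))) (S.smul_mem _ (hl _)))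
      (S.smul_mem _ m4)
  · rw [← S.smul_mem_iff hD]
    exact e1 ▸ add_mem (add_mem (S.smul_mem _ (sub_mem (hl _) (hl _))) (S.smul_mem _ (hl _)))
      (S.smul_mem _ m4)
  · rw [← S.smul_mem_iff h2]
    exact e2 ▸ add_mem (hl _) (hl _)
  · rw [← S.smul_mem_iff h2]
    exact e3 ▸ add_mem (hl _) (hl _)
  · exact m4

variable (P₁ P₂) in
/-- The values of the forms `diamondForm` at the generic point of `𝒳₂`. -/
def diamondValue (δ : k) (j : Fin 5) : FieldX2 P₁ P₂ := genericCoords P₁ P₂ (diamondForm P₁ P₂ δ j)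

lemma genericCoords_rel_left :
    (genericCoords P₁ P₂ (X 0) - algebraMap k _ P₁.1) ^ 2 +
      (genericCoords P₁ P₂ (X 1) - algebraMap k _ P₁.2) ^ 2 = genericCoords P₁ P₂ (X 2) ^ 2 := by
  have := congrArg (algebraMap (RingX2 k P₁ P₂) (FieldX2 P₁ P₂)) coordX2_rel_left
  simpa [genericCoords, ← IsScalarTower.algebraMap_apply] using this

lemma genericCoords_rel_right :
    (genericCoords P₁ P₂ (X 0) - algebraMap k _ P₂.1) ^ 2 +
      (genericCoords P₁ P₂ (X 1) - algebraMap k _ P₂.2) ^ 2 = genericCoords P₁ P₂ (X 3) ^ 2 := by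
  have := congrArg (algebraMap (RingX2 k P₁ P₂) (FieldX2 P₁ P₂)) coordX2_rel_right
  simpa [genericCoords, ← IsScalarTower.algebraMap_apply] using this

lemma diamondValue_mul_left {δ : k} (hδ : δ ^ 2 = (P₂.1 - P₁.1) ^ 2 + (P₂.2 - P₁.2) ^ 2) :
    diamondValue P₁ P₂ δ 1 * diamondValue P₁ P₂ δ 2 = diamondValue P₁ P₂ δ 0 ^ 2 := by
  have h1 := congrArg (algebraMap k (FieldX2 P₁ P₂)) hδ
  have h2 := genericCoords_rel_left (P₁ := P₁) (P₂ := P₂)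
  simp only [map_pow, map_add, map_sub] at h1
  simp [diamondValue, diamondForm, Algebra.smul_def, genericCoords_four]
  linear_combination (-1 : FieldX2 P₁ P₂) * (algebraMap k (FieldX2 P₁ P₂) δ) ^ 2 * h2 +
    ((genericCoords P₁ P₂ (X 0) - algebraMap k _ P₁.1) ^ 2 +
      (genericCoords P₁ P₂ (X 1) - algebraMap k _ P₁.2) ^ 2) * h1

lemma diamondValue_mul_right {δ : k} (hδ : δ ^ 2 = (P₂.1 - P₁.1) ^ 2 + (P₂.2 - P₁.2) ^ 2) :
    diamondValue P₁ P₂ δ 3 * diamondValue P₁ P₂ δ 4 = diamondValue P₁ P₂ δ 0 ^ 2 := by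
  have h1 := congrArg (algebraMap k (FieldX2 P₁ P₂)) hδ
  have h2 := genericCoords_rel_right (P₁ := P₁) (P₂ := P₂)
  simp only [map_pow, map_add, map_sub] at h1
  simp [diamondValue, diamondForm, Algebra.smul_def, genericCoords_four]
  rw [h1]
  linear_combination (-1 : FieldX2 P₁ P₂) *
    ((algebraMap k (FieldX2 P₁ P₂) P₂.1 - algebraMap k (FieldX2 P₁ P₂) P₁.1) ^ 2 +
      (algebraMap k (FieldX2 P₁ P₂) P₂.2 - algebraMap k (FieldX2 P₁ P₂) P₁.2) ^ 2) * h2 +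
    (genericCoords P₁ P₂ (X 3)) ^ 2 * h1

variable [IsDomain (RingX2 k P₁ P₂)]

lemma diamondValue_zero_ne_zero {δ : k} (h0 : δ ≠ 0)
    (hδ : δ ^ 2 = (P₂.1 - P₁.1) ^ 2 + (P₂.2 - P₁.2) ^ 2) : diamondValue P₁ P₂ δ 0 ≠ 0 := by
  let p : MvPolynomial (Fin 2) k :=
    C (P₂.1 - P₁.1) * (X 1 - C P₁.2) - C (P₂.2 - P₁.2) * (X 0 - C P₁.1)
  have hp : p ≠ 0 := by
    intro h
    have := congrArg (eval ![P₁.1 - (P₂.2 - P₁.2), P₁.2 + (P₂.1 - P₁.1)]) h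
    simp [p] at this
    refine pow_ne_zero 2 h0 (hδ.trans ?_)
    linear_combination this
  have hv : diamondValue P₁ P₂ δ 0 = algebraMap (RingX2 k P₁ P₂) (FieldX2 P₁ P₂)
      (aeval ![coordX2 P₁ P₂ 0, coordX2 P₁ P₂ 1] p) := by
    simp [diamondValue, diamondForm, Algebra.smul_def, genericCoords, p,
      ← IsScalarTower.algebraMap_apply]
  rw [hv, Ne, FaithfulSMul.algebraMap_eq_zero_iff]
  intro h
  exact one_ne_zero (mul_eq_zero_of_ne_zero hp (r := (1 : RingX2 k P₁ P₂)) (by rw [h, zero_mul]))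

lemma diamondValue_ne_zero {δ : k} (h0 : δ ≠ 0)
    (hδ : δ ^ 2 = (P₂.1 - P₁.1) ^ 2 + (P₂.2 - P₁.2) ^ 2) (j : Fin 5) :
    diamondValue P₁ P₂ δ j ≠ 0 := by
  have h := diamondValue_zero_ne_zero h0 hδ
  have hl := diamondValue_mul_left hδ ▸ pow_ne_zero 2 h
  have hr := diamondValue_mul_right hδ ▸ pow_ne_zero 2 h
  fin_cases j
  exacts [h, left_ne_zero_of_mul hl, right_ne_zero_of_mul hl, left_ne_zero_of_mul hr,
    right_ne_zero_of_mul hr]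

end Diamond

/-! ### The toric structure of the projective closure -/

lemma adjoin_range_eq_of_span_eq {R A M ι κ : Type*} [CommSemiring R] [Semiring A] [Algebra R A]
    [AddCommMonoid M] [Module R M] {f : ι → M} {g : κ → M}
    (h : Submodule.span R (Set.range f) = Submodule.span R (Set.range g)) (φ : M →ₗ[R] A) :
    Algebra.adjoin R (Set.range (φ ∘ f)) = Algebra.adjoin R (Set.range (φ ∘ g)) := by
  rw [← Algebra.adjoin_span, Set.range_comp, ← Submodule.map_span, h, Submodule.map_span,
    ← Set.range_comp, Algebra.adjoin_span]

lemma exists_chartLeft_eq {F : Type*} [Field F] (x y : F) (i : Fin 4) :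
    ∃ j, chartLeft x y j = chartRight x y i := by
  fin_cases i
  exacts [⟨2, rfl⟩, ⟨2, rfl⟩, ⟨0, rfl⟩, ⟨0, rfl⟩]

lemma exists_chartLeft_inv_eq {F : Type*} [Field F] (x y : F) (i : Fin 4) :
    ∃ j, chartLeft x y j = (chartRight x y i)⁻¹ := by
  fin_cases i
  exacts [⟨3, rfl⟩, ⟨3, rfl⟩, ⟨1, rfl⟩, ⟨1, rfl⟩]

section Toric

open MvPolynomial

variable {k : Type u} [Field k] {P₁ P₂ : k × k} {δ : k}

/-- The linear forms `diamondForm` may replace the homogeneous coordinates. -/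
lemma adjoin_range_diamondValue [CharZero k] [IsDomain (RingX2 k P₁ P₂)] (h0 : δ ≠ 0)
    (hδ : δ ^ 2 = (P₂.1 - P₁.1) ^ 2 + (P₂.2 - P₁.2) ^ 2) (c : FieldX2 P₁ P₂) :
    Algebra.adjoin k (Set.range fun i => genericCoords P₁ P₂ (X i) / c) =
      Algebra.adjoin k (Set.range fun j => diamondValue P₁ P₂ δ j / c) := by
  have h : Submodule.span k (Set.range (X : Fin 5 → MvPolynomial (Fin 5) k)) =
      Submodule.span k (Set.range (diamondForm P₁ P₂ δ)) := by
    refine le_antisymm ?_ ?_ <;> rw [Submodule.span_le] <;> rintro _ ⟨i, rfl⟩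
    exacts [X_mem_span_diamondForm h0 hδ i, diamondForm_mem_span δ i]
  have := adjoin_range_eq_of_span_eq h
    (LinearMap.mulRight k c⁻¹ ∘ₗ (genericCoords P₁ P₂).toLinearMap)
  simpa [Function.comp_def, diamondValue, div_eq_mul_inv] using this

variable (P₁ P₂) in
/-- The pair of coordinates on `𝒳₂` in which its closure is a toric surface. -/
def diamondCoord (δ : k) [IsDomain (RingX2 k P₁ P₂)] : Fin 2 → FieldX2 P₁ P₂ :=
  ![diamondValue P₁ P₂ δ 0 / diamondValue P₁ P₂ δ 1,
    diamondValue P₁ P₂ δ 0 / diamondValue P₁ P₂ δ 3]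

variable [IsDomain (RingX2 k P₁ P₂)] (h0 : δ ≠ 0)
  (hδ : δ ^ 2 = (P₂.1 - P₁.1) ^ 2 + (P₂.2 - P₁.2) ^ 2)
include h0 hδ

lemma diamondValue_div (i : Fin 4) : diamondValue P₁ P₂ δ 0 / diamondValue P₁ P₂ δ i.succ =
    chartLeft (diamondCoord P₁ P₂ δ 0) (diamondCoord P₁ P₂ δ 1) i := by
  have h := diamondValue_ne_zero h0 hδ
  have h1 := diamondValue_mul_left hδ
  have h2 := diamondValue_mul_right hδ
  fin_cases i
  · rfl
  · change diamondValue P₁ P₂ δ 0 / diamondValue P₁ P₂ δ 2 =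
      (diamondValue P₁ P₂ δ 0 / diamondValue P₁ P₂ δ 1)⁻¹
    rw [inv_div, div_eq_div_iff (h 2) (h 0), h1, sq]
  · rfl
  · change diamondValue P₁ P₂ δ 0 / diamondValue P₁ P₂ δ 4 =
      (diamondValue P₁ P₂ δ 0 / diamondValue P₁ P₂ δ 3)⁻¹
    rw [inv_div, div_eq_div_iff (h 4) (h 0), h2, sq]

/-- At the generic point, the form `j + 1` is `v / tⱼ`. -/
lemma diamondValue_succ_div (i j : Fin 4) :
    diamondValue P₁ P₂ δ j.succ / diamondValue P₁ P₂ δ i.succ =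
      chartLeft (diamondCoord P₁ P₂ δ 0) (diamondCoord P₁ P₂ δ 1) i /
        chartLeft (diamondCoord P₁ P₂ δ 0) (diamondCoord P₁ P₂ δ 1) j := by
  have h := diamondValue_ne_zero h0 hδ
  rw [← diamondValue_div h0 hδ, ← diamondValue_div h0 hδ, div_div_div_cancel_left' _ _ (h 0)]

variable [CharZero k]

lemma isCoordinatePair_diamondCoord (hP : P₁ ≠ P₂) :
    IsCoordinatePair k (diamondCoord P₁ P₂ δ 0) (diamondCoord P₁ P₂ δ 1) where
  trdeg_eq := by
    rw [← trdeg_ringX2 hP]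
    exact (trdeg_eq_of_isLocalization (nonZeroDivisors (RingX2 k P₁ P₂))).symm
  adjoin_eq_top := by
    set E := IntermediateField.adjoin k {diamondCoord P₁ P₂ δ 0, diamondCoord P₁ P₂ δ 1}
    have h := diamondValue_ne_zero h0 hδ
    have hx : diamondCoord P₁ P₂ δ 0 ∈ E := IntermediateField.subset_adjoin _ _ (by simp)
    have hy : diamondCoord P₁ P₂ δ 1 ∈ E := IntermediateField.subset_adjoin _ _ (by simp)
    have h1 (j : Fin 4) :
        chartLeft (diamondCoord P₁ P₂ δ 0) (diamondCoord P₁ P₂ δ 1) j ∈ E := by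
      fin_cases j
      exacts [hx, inv_mem hx, hy, inv_mem hy]
    have h2 (j : Fin 5) : diamondValue P₁ P₂ δ j / diamondValue P₁ P₂ δ 0 ∈ E := by
      refine Fin.cases ?_ (fun j => ?_) j
      · rw [div_self (h 0)]
        exact one_mem _
      · rw [← inv_div, diamondValue_div h0 hδ]
        exact inv_mem (h1 j)
    have h3 (i : Fin 5) : genericCoords P₁ P₂ (X i) / diamondValue P₁ P₂ δ 0 ∈ E := by
      have h4 : Algebra.adjoin k
          (Set.range fun j => diamondValue P₁ P₂ δ j / diamondValue P₁ P₂ δ 0) ≤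
          E.toSubalgebra := by
        rw [Algebra.adjoin_le_iff]
        rintro _ ⟨j, rfl⟩
        exact h2 j
      rw [← adjoin_range_diamondValue h0 hδ] at h4
      exact h4 (Algebra.subset_adjoin ⟨i, rfl⟩)
    -- the coordinate `w` is `1` at the generic point
    have h4 (i : Fin 5) : genericCoords P₁ P₂ (X i) ∈ E := by
      have := div_mem (h3 i) (h3 4)
      rwa [div_div_div_cancel_right₀ (h 0), genericCoords_four, div_one] at this
    have h5 (a : RingX2 k P₁ P₂) : algebraMap _ (FieldX2 P₁ P₂) a ∈ E := by
      have h6 := Subalgebra.mem_map.mpr ⟨a, adjoin_coordX2.ge trivial,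
        (rfl : IsScalarTower.toAlgHom k (RingX2 k P₁ P₂) (FieldX2 P₁ P₂) a = _)⟩
      rw [AlgHom.map_adjoin] at h6
      refine (Algebra.adjoin_le ?_ : _ ≤ E.toSubalgebra) h6
      rintro _ ⟨_, ⟨i, rfl⟩, rfl⟩
      refine (congrArg (· ∈ E) ?_).mp (h4 i.castSucc)
      fin_cases i <;> simp [genericCoords]
    refine top_le_iff.mp fun z _ => ?_
    obtain ⟨a, b, -, rfl⟩ := IsFractionRing.div_surjective (A := RingX2 k P₁ P₂) z
    exact div_mem (h5 a) (h5 b)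

lemma adjoin_diamondValue_div (hP : P₁ ≠ P₂) (i : Fin 4) : Algebra.adjoin k
    (Set.range fun j => genericCoords P₁ P₂ (X j) / diamondValue P₁ P₂ δ i.succ) =
      chartAlgebra k (chartLeft (diamondCoord P₁ P₂ δ 0) (diamondCoord P₁ P₂ δ 1) i)
        (chartRight (diamondCoord P₁ P₂ δ 0) (diamondCoord P₁ P₂ δ 1) i) := by
  rw [adjoin_range_diamondValue h0 hδ]
  refine le_antisymm ?_ ?_
  · rw [Algebra.adjoin_le_iff]
    rintro _ ⟨j, rfl⟩
    refine Fin.cases ?_ (fun j => ?_) j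
    · change diamondValue P₁ P₂ δ 0 / _ ∈ _
      rw [diamondValue_div h0 hδ]
      exact left_mem_chartAlgebra _ _
    · change diamondValue P₁ P₂ δ j.succ / _ ∈ _
      rw [diamondValue_succ_div h0 hδ]
      exact (isCoordinatePair_diamondCoord h0 hδ hP).div_mem_chart i j
  · have h1 (j : Fin 4) : chartLeft (diamondCoord P₁ P₂ δ 0) (diamondCoord P₁ P₂ δ 1) i /
        chartLeft (diamondCoord P₁ P₂ δ 0) (diamondCoord P₁ P₂ δ 1) j ∈ Algebra.adjoin k
          (Set.range fun j => diamondValue P₁ P₂ δ j / diamondValue P₁ P₂ δ i.succ) :=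
      Algebra.subset_adjoin ⟨j.succ, diamondValue_succ_div h0 hδ i j⟩
    rw [chartAlgebra, Algebra.adjoin_le_iff]
    rintro _ (rfl | rfl | rfl)
    · exact Algebra.subset_adjoin ⟨0, diamondValue_div h0 hδ i⟩
    · obtain ⟨j, hj⟩ := exists_chartLeft_inv_eq (diamondCoord P₁ P₂ δ 0) (diamondCoord P₁ P₂ δ 1) i
      rw [← inv_inv (chartRight _ _ i), ← hj, ← div_eq_mul_inv]
      exact h1 j
    · obtain ⟨j, hj⟩ := exists_chartLeft_eq (diamondCoord P₁ P₂ δ 0) (diamondCoord P₁ P₂ δ 1) i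
      rw [← hj]
      exact h1 j

/-- The closure of `𝒳₂` in `ℙ⁴` is the toric surface given by a square. -/
def isToricDiamondX2Bar (hP : P₁ ≠ P₂) : IsToricDiamond (X2Bar.toBase k P₁ P₂)
    ((funFieldEquivX2Bar P₁ P₂).symm (diamondCoord P₁ P₂ δ 0))
    ((funFieldEquivX2Bar P₁ P₂).symm (diamondCoord P₁ P₂ δ 1)) where
  coord := IsCoordinatePair.of_algEquiv (funFieldEquivX2Bar P₁ P₂)
    (by simpa using isCoordinatePair_diamondCoord h0 hδ hP)
  chart i := chartX2Bar P₁ P₂ (diamondForm P₁ P₂ δ i.succ)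
  isAffineOpen i := isAffineOpen_chartX2Bar (diamondForm_mem δ _)
  nonempty i := nonempty_chartX2Bar (diamondForm_mem δ _) (diamondValue_ne_zero h0 hδ _)
  exists_mem z := by
    have h := diamondValue_ne_zero h0 hδ
    obtain ⟨j, hj⟩ := exists_mem_chartX2Bar (diamondForm P₁ P₂ δ) (diamondForm_mem δ)
      (X_mem_span_diamondForm h0 hδ) z
    revert hj
    refine Fin.cases (fun hj => ?_) (fun i hj => ⟨i, hj⟩) j
    -- `v² = (δz₁ + u)(δz₁ - u)`, so `δz₁ + u` has no zeros where `v` has none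
    have : Nonempty (chartX2Bar P₁ P₂ (diamondForm P₁ P₂ δ 0)) := ⟨⟨z, hj⟩⟩
    have h1 : funFieldX2Bar P₁ P₂ ((funFieldEquivX2Bar P₁ P₂).symm (diamondCoord P₁ P₂ δ 0)) =
        diamondCoord P₁ P₂ δ 0 := (funFieldEquivX2Bar P₁ P₂).apply_symm_apply _
    have h2 : diamondCoord P₁ P₂ δ 0 = diamondValue P₁ P₂ δ 2 / diamondValue P₁ P₂ δ 0 := by
      change diamondValue P₁ P₂ δ 0 / diamondValue P₁ P₂ δ 1 = _
      rw [div_eq_div_iff (h 1) (h 0), mul_comm (diamondValue P₁ P₂ δ 2), diamondValue_mul_left hδ,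
        sq]
    obtain ⟨s, hs⟩ := (exists_section_chartX2Bar_iff (diamondForm_mem δ 0) (h 0)
      ((funFieldEquivX2Bar P₁ P₂).symm (diamondCoord P₁ P₂ δ 0))).mpr (by
        refine (congrArg (_ ∈ ·) (adjoin_range_diamondValue h0 hδ (diamondValue P₁ P₂ δ 0))).mpr ?_
        rw [h1, h2]
        exact Algebra.subset_adjoin ⟨2, rfl⟩)
    exact ⟨0, mem_chartX2Bar_of_mem_localRing (diamondForm_mem δ 0) (diamondForm_mem δ 1) (h 0)
      (h 1) hj h1 (hs ▸ range_le_localRing ⟨z, hj⟩ s)⟩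
  mem_chartAlgebra i z := by
    have := nonempty_chartX2Bar (P₁ := P₁) (P₂ := P₂) (diamondForm_mem δ i.succ)
      (diamondValue_ne_zero h0 hδ i.succ)
    rw [exists_section_chartX2Bar_iff (diamondForm_mem δ i.succ)
      (diamondValue_ne_zero h0 hδ i.succ)]
    refine Iff.trans ?_ (congrArg (_ ∈ ·) (adjoin_diamondValue_div h0 hδ hP i)).symm.to_iff
    rw [← map_mem_chartAlgebra_iff (funFieldX2Bar P₁ P₂), map_chartLeft, map_chartRight]
    have h1 (w) : funFieldX2Bar P₁ P₂ ((funFieldEquivX2Bar P₁ P₂).symm w) = w :=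
      (funFieldEquivX2Bar P₁ P₂).apply_symm_apply w
    rw [h1, h1]
  mem_chart i j z hz h := by
    refine mem_chartX2Bar_of_mem_localRing (diamondForm_mem δ i.succ) (diamondForm_mem δ j.succ)
      (diamondValue_ne_zero h0 hδ _) (diamondValue_ne_zero h0 hδ _) hz ?_ h
    have h1 (w) : funFieldX2Bar P₁ P₂ ((funFieldEquivX2Bar P₁ P₂).symm w) = w :=
      (funFieldEquivX2Bar P₁ P₂).apply_symm_apply w
    rw [map_div₀, map_chartLeft, map_chartLeft, h1, h1]
    exact (diamondValue_succ_div h0 hδ j i).symm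

end Toric

theorem isDelPezzoSurface_X2Bar {k : Type u} [Field k] [IsAlgClosed k] [CharZero k] {P₁ P₂ : k × k}
    (hP : (P₂.1 - P₁.1) ^ 2 + (P₂.2 - P₁.2) ^ 2 ≠ 0) :
    IsDelPezzoSurface (X2Bar.toBase k P₁ P₂) 4 := by
  have hne : P₁ ≠ P₂ := by
    rintro rfl
    simp at hP
  obtain ⟨δ, hδ⟩ := IsAlgClosed.exists_pow_nat_eq ((P₂.1 - P₁.1) ^ 2 + (P₂.2 - P₁.2) ^ 2) two_pos
  have h0 : δ ≠ 0 := by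
    rintro rfl
    exact hP (by rw [← hδ]; simp)
  have := isDomain_ringX2 hne
  exact ⟨inferInstance, (isToricDiamondX2Bar h0 hδ hne).isDelPezzoOfDegree (isProper_X2Bar P₁ P₂)⟩

end RationalDistance

end

theorem mainTheorem5 :
    (∀ P₁ P₂ : ℝ × ℝ, P₁ ≠ P₂ →
      RationalDistance.IsDelPezzoSurface
        (RationalDistance.X2Bar.toBase ℂ ((P₁.1 : ℂ), (P₁.2 : ℂ)) ((P₂.1 : ℂ), (P₂.2 : ℂ))) 4) ∧
    (∀ P₁ P₂ : ℚ × ℚ, P₁ ≠ P₂ →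
      AlgebraicGeometry.Scheme.BirationalOver
        (RationalDistance.X2.toBase ℚ P₁ P₂)
        (AlgebraicGeometry.AffineSpace (Fin 2) (AlgebraicGeometry.Spec (.of ℚ)) ↘
          AlgebraicGeometry.Spec (.of ℚ)) ∧
      MvPolynomial.zeroLocus ℂ (MvPolynomial.vanishingIdeal ℂ
          ((fun q : Fin 4 → ℚ => fun i => (q i : ℂ)) '' RationalDistance.pointsX2 ℚ P₁ P₂)) =
        RationalDistance.pointsX2 ℂ ((P₁.1 : ℂ), (P₁.2 : ℂ)) ((P₂.1 : ℂ), (P₂.2 : ℂ))) := by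
  refine ⟨fun P₁ P₂ hP => RationalDistance.isDelPezzoSurface_X2Bar fun h => hP ?_,
    fun P₁ P₂ hP => ⟨RationalDistance.birationalOver_affineSpace ℚ hP,
      RationalDistance.zeroLocus_vanishingIdeal_pointsX2 hP rfl rfl⟩⟩
  -- a sum of two real squares vanishes only if both terms do
  have h' : (P₂.1 - P₁.1) ^ 2 + (P₂.2 - P₁.2) ^ 2 = 0 := by
    dsimp only at h
    exact_mod_cast h
  exact Prod.ext (by nlinarith [sq_nonneg (P₂.1 - P₁.1), sq_nonneg (P₂.2 - P₁.2)])
    (by nlinarith [sq_nonneg (P₂.1 - P₁.1), sq_nonneg (P₂.2 - P₁.2)])
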